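/- Let $R$ be a commutative Noetherian ring, let $A$ be an $R$-algebra that is finitely generated and projective as an $R$-module, and let $\Lambda$ be a finite poset. Write $A\text{-mod}$ for the category of finitely generated left $A$-modules and $R\text{-proj}$, $A\text{-proj}$ for the finitely generated projective modules. For a module $T$, $\operatorname{add} T$ is the class of direct summands of finite direct sums of copies of $T$. For a family of $A$-modules $\{X(\lambda)\}_{\lambda\in\Lambda}$ and $S\subseteq\Lambda$, let $\mathcal F(\tilde X_{S})$ be the class of $A$-modules $M$ with a finite filtration (possibly of length $0$) whose successive quotients are isomorphic to modules $X(\lambda)\otimes_R U$ with $\lambda\in S$ and $U\in R\text{-proj}$; put $\mathcal F(\tilde X)=\mathcal F(\tilde X_\Lambda)$. Let $(A,\{\Delta(\lambda)\}_{\lambda\in\Lambda})$ be a split quasi-hereditary $R$-algebra, that is: (i) $\Delta(\lambda)\in A\text{-mod}\cap R\text{-proj}$; (ii) $\operatorname{Hom}_A(\Delta(\lambda),\Delta(\mu))\ne0$ implies $\lambda\le\mu$; (iii) $\operatorname{End}_A(\Delta(\lambda))\cong R$; (iv)–(v) there are $P(\lambda)\in A\text{-proj}$ and exact sequences $0\to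 C(\lambda)\to P(\lambda)\to\Delta(\lambda)\to0$ with $C(\lambda)\in\mathcal F(\tilde\Delta_{\mu>\lambda})$, such that $\operatorname{add}\bigl(\bigoplus_{\lambda}P(\lambda)\bigr)=A\text{-proj}$. Put $D=\operatorname{Hom}_R(-,R)$. Let $\{\nabla(\lambda)\}_{\lambda\in\Lambda}$ be its costandard modules, i.e. finitely generated $A$-modules such that $(A^{op},\{D\nabla(\lambda)\}_{\lambda\in\Lambda})$ is split quasi-hereditary (with the same order on $\Lambda$) and $\operatorname{Ext}^i_A(\Delta(\lambda),\nabla(\beta))$ is isomorphic to $R$ if $i=0$ and $\lambda=\beta$, and is $0$ otherwise. Let $T$ be a characteristic tilting module, i.e. $T\cong\bigoplus_{\lambda\in\Lambda}T(\lambda)$ with $T(\lambda)\in\mathcal F(\tilde\Delta)\cap\mathcal F(\tilde\nabla)$ such that there are exact sequences $$0\to\Delta(\lambda)\to T(\lambda)\to X(\lambda)\to0,\qquad 0\to Y(\lambda)\to T(\lambda)\to\nabla(\lambda)\to0$$ with $X(\lambda)\in\mathcal F(\tilde\Delta_{\mu<\lambda})$ and $Y(\lambda)\in\mathcal F(\tilde\nabla_{\mu<\lambda})$.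 Then, as classes of modules in $A\text{-mod}$: (a) $\mathcal F(\tilde\Delta)=\{M\in A\text{-mod}\cap R\text{-proj} : \operatorname{Ext}^i_A(M,T)=0 \text{ for all } i>0\}$. (b) $\mathcal F(\tilde\Delta)$ is the class of all $M\in A\text{-mod}$ for which there is an exact sequence $0\to M\to C_0\to\cdots\to C_t\to0$ with $t\ge0$ and all $C_i\in\operatorname{add}T$. (c) $\mathcal F(\tilde\nabla)=\{N\in A\text{-mod}\cap R\text{-proj} : \operatorname{Ext}^i_A(T,N)=0 \text{ for all } i>0\}$. (d) $\mathcal F(\tilde\nabla)$ is the class of all $N\in A\text{-mod}\cap R\text{-proj}$ for which there is an exact sequence $0\to C_t\to\cdots\to C_0\to N\to0$ with $t\ge0$ and all $C_i\in\operatorname{add}T$. (e) $\operatorname{add}T=\mathcal F(\tilde\Delta)\cap\mathcal F(\tilde\nabla)$. Consequently, any two characteristic tilting modules $T,T'$ of $(A,\{\Delta(\lambda)\}_{\lambda\in\Lambda})$ satisfy $\operatorname{add}T=\operatorname{add}T'$. -/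

import Mathlib

open scoped TensorProduct

universe u v w

section AdditiveClosure

variable (A : Type u) [Ring A]

/-- `X` belongs to `add T`: `X` is a direct summand of a finite direct sum of copies of `T`. -/
def InAdd (T : Type v) [AddCommGroup T] [Module A T]
    (X : Type u) [AddCommGroup X] [Module A X] : Prop :=
  ∃ (n : ℕ) (i : X →ₗ[A] (Fin n → T)) (p : (Fin n → T) →ₗ[A] X), p ∘ₗ i = LinearMap.id

/-- There is an exact sequence `0 → C t → ⋯ → C 1 → C 0 → M → 0` with all `C i` in `add T`.
The sequence is continued to the left by zero modules. -/
def HasFiniteAddResolution (T : Type u) [AddCommGroup T] [Module A T]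
    (M : Type u) [AddCommGroup M] [Module A M] : Prop :=
  ∃ (t : ℕ) (C : ℕ → ModuleCat.{u} A) (d : ∀ i, C (i + 1) →ₗ[A] C i) (ε : C 0 →ₗ[A] M),
    (∀ i, i ≤ t → InAdd A T (C i)) ∧ (∀ i, t < i → Subsingleton (C i)) ∧
    Function.Surjective ε ∧ Function.Exact (d 0) ε ∧
    ∀ i, Function.Exact (d (i + 1)) (d i)

/-- There is an exact sequence `0 → M → C 0 → C 1 → ⋯ → C t → 0` with all `C i` in `add T`.
The sequence is continued to the right by zero modules. -/
def HasFiniteAddCoresolution (T : Type u) [AddCommGroup T] [Module A T]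
    (M : Type u) [AddCommGroup M] [Module A M] : Prop :=
  ∃ (t : ℕ) (C : ℕ → ModuleCat.{u} A) (d : ∀ i, C i →ₗ[A] C (i + 1)) (ε : M →ₗ[A] C 0),
    (∀ i, i ≤ t → InAdd A T (C i)) ∧ (∀ i, t < i → Subsingleton (C i)) ∧
    Function.Injective ε ∧ Function.Exact ε (d 0) ∧
    ∀ i, Function.Exact (d i) (d (i + 1))

/-- `Ext_A^i(M, N) = 0`. -/
def ExtVanishes (M : Type u) [AddCommGroup M] [Module A M]
    (N : Type u) [AddCommGroup N] [Module A N] (i : ℕ) : Prop :=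
  Subsingleton (CategoryTheory.Abelian.Ext (ModuleCat.of A M) (ModuleCat.of A N) i)

end AdditiveClosure

section StandardDuality

/-- The standard duality `D M = Hom_R(M, R)`, a right `A`-module when `M` is a left `A`-module. -/
def StandardDual (R : Type u) [CommRing R] (M : Type u) [AddCommGroup M] [Module R M] : Type u :=
  M →ₗ[R] R

variable (R : Type u) [CommRing R] (A : Type u) [Ring A] [Algebra R A]
  (M : Type u) [AddCommGroup M] [Module R M] [Module A M] [IsScalarTower R A M]

instance StandardDual.instAddCommGroup : AddCommGroup (StandardDual R M) :=
  inferInstanceAs (AddCommGroup (M →ₗ[R] R))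

instance StandardDual.instModule : Module R (StandardDual R M) :=
  inferInstanceAs (Module R (M →ₗ[R] R))

/-- Right `A`-modules are left modules over the opposite algebra; here `(f a)(m) = f (a m)`. -/
instance StandardDual.instModuleMulOpposite : Module Aᵐᵒᵖ (StandardDual R M) where
  smul a f := LinearMap.comp (f : M →ₗ[R] R) (Algebra.lsmul R R M a.unop)
  one_smul f := LinearMap.ext fun m => congrArg (DFunLike.coe (F := M →ₗ[R] R) f) (one_smul A m)
  mul_smul a b f := LinearMap.ext fun m =>
    congrArg (DFunLike.coe (F := M →ₗ[R] R) f) (mul_smul b.unop a.unop m)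
  smul_zero _ := rfl
  smul_add _ _ _ := rfl
  add_smul a b f := LinearMap.ext fun m =>
    (congrArg (DFunLike.coe (F := M →ₗ[R] R) f) (add_smul a.unop b.unop m)).trans (LinearMap.map_add (f : M →ₗ[R] R) _ _)
  zero_smul f := LinearMap.ext fun m =>
    (congrArg (DFunLike.coe (F := M →ₗ[R] R) f) (zero_smul A m)).trans (LinearMap.map_zero (f : M →ₗ[R] R))

instance StandardDual.instIsScalarTower : IsScalarTower R Aᵐᵒᵖ (StandardDual R M) where
  smul_assoc r a f := LinearMap.ext fun m =>
    (congrArg (DFunLike.coe (F := M →ₗ[R] R) f) (smul_assoc r a.unop m)).trans (LinearMap.map_smul (f : M →ₗ[R] R) r _)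

end StandardDuality

section QuasiHereditary

variable (R : Type u) [CommRing R] (A : Type u) [Ring A] [Algebra R A] {Λ : Type w}

/-- `M` has a finite filtration `0 = F 0 ⊆ F 1 ⊆ ⋯ ⊆ F t = M` by `A`-submodules, each of whose
successive quotients is isomorphic to `X l ⊗_R U` for some `l ∈ S` and some finitely generated
projective `R`-module `U`. For `S = Λ` this says that `M ∈ F(X̃)`. -/
def TildeFiltered (X : Λ → Type u) [∀ l, AddCommGroup (X l)] [∀ l, Module R (X l)]
    [∀ l, Module A (X l)] [∀ l, IsScalarTower R A (X l)] (S : Set Λ)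
    (M : Type u) [AddCommGroup M] [Module A M] : Prop :=
  ∃ (t : ℕ) (F : ℕ → Submodule A M), Monotone F ∧ F 0 = ⊥ ∧ F t = ⊤ ∧
    ∀ i, i < t → ∃ l ∈ S, ∃ U : ModuleCat.{u} R, Module.Finite R U ∧ Module.Projective R U ∧
      Nonempty ((F (i + 1) ⧸ (F i).submoduleOf (F (i + 1))) ≃ₗ[A] (X l ⊗[R] U))

/-- `(A, {Δ l})` is a split quasi-hereditary `R`-algebra. -/
structure IsSplitQuasiHereditary [PartialOrder Λ]
    (Δ : Λ → Type u) [∀ l, AddCommGroup (Δ l)] [∀ l, Module R (Δ l)]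
    [∀ l, Module A (Δ l)] [∀ l, IsScalarTower R A (Δ l)] : Prop where
  finite_algebra : Module.Finite R A
  projective_algebra : Module.Projective R A
  finite_standard : ∀ l, Module.Finite A (Δ l)
  projective_standard : ∀ l, Module.Projective R (Δ l)
  le_of_hom_ne_zero : ∀ l m, (∃ f : Δ l →ₗ[A] Δ m, f ≠ 0) → l ≤ m
  end_standard : ∀ l, Nonempty (Module.End A (Δ l) ≃ₐ[R] R)
  exists_projectives : ∃ P : Λ → ModuleCat.{u} A,
    (∀ l, Module.Finite A (P l) ∧ Module.Projective A (P l) ∧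
      ∃ π : P l →ₗ[A] Δ l, Function.Surjective π ∧
        TildeFiltered R A Δ (Set.Ioi l) (LinearMap.ker π)) ∧
    ∀ Q : ModuleCat.{u} A, InAdd A (DirectSum Λ fun l => P l) Q ↔
      Module.Finite A Q ∧ Module.Projective A Q

/-- The finitely generated `A`-modules `{N l}` are the costandard modules of `(A, {Δ l})`:
`(A^op, {D (N l)})` is split quasi-hereditary (for the same order on `Λ`), and
`Ext_A^i(Δ l, N m)` is `R` if `i = 0` and `l = m`, and zero otherwise. -/
structure IsCostandard [PartialOrder Λ]
    (Δ : Λ → Type u) [∀ l, AddCommGroup (Δ l)] [∀ l, Module R (Δ l)]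
    [∀ l, Module A (Δ l)] [∀ l, IsScalarTower R A (Δ l)]
    (N : Λ → Type u) [∀ l, AddCommGroup (N l)] [∀ l, Module R (N l)]
    [∀ l, Module A (N l)] [∀ l, IsScalarTower R A (N l)] : Prop where
  finite_costandard : ∀ l, Module.Finite A (N l)
  dual_quasiHereditary : IsSplitQuasiHereditary R Aᵐᵒᵖ (fun l => StandardDual R (N l))
  hom_self : ∀ l, Nonempty ((Δ l →ₗ[A] N l) ≃ₗ[R] R)
  hom_ne : ∀ l m, l ≠ m → ∀ f : Δ l →ₗ[A] N m, f = 0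
  ext_eq_zero : ∀ l m i, 0 < i → ExtVanishes A (Δ l) (N m) i

/-- `T` is (isomorphic to) a direct sum of modules `T l` in `F(Δ̃) ∩ F(Ñ)`, `l ∈ Λ`, which
fit into exact sequences `0 → Δ l → T l → X l → 0` and `0 → Y l → T l → N l → 0` with `X l`
filtered by modules `Δ m ⊗ U` with `m < l` and `Y l` filtered by modules `N m ⊗ U` with
`m < l`. Here `{N l}` are the costandard modules. -/
def IsCharacteristicTilting [PartialOrder Λ]
    (Δ : Λ → Type u) [∀ l, AddCommGroup (Δ l)] [∀ l, Module R (Δ l)]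
    [∀ l, Module A (Δ l)] [∀ l, IsScalarTower R A (Δ l)]
    (N : Λ → Type u) [∀ l, AddCommGroup (N l)] [∀ l, Module R (N l)]
    [∀ l, Module A (N l)] [∀ l, IsScalarTower R A (N l)]
    (T : Type u) [AddCommGroup T] [Module A T] : Prop :=
  ∃ T' : Λ → ModuleCat.{u} A, Nonempty (T ≃ₗ[A] DirectSum Λ fun l => T' l) ∧
    ∀ l, TildeFiltered R A Δ Set.univ (T' l) ∧ TildeFiltered R A N Set.univ (T' l) ∧
      (∃ j : Δ l →ₗ[A] T' l, Function.Injective j ∧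
        TildeFiltered R A Δ (Set.Iio l) (T' l ⧸ LinearMap.range j)) ∧
      (∃ π : T' l →ₗ[A] N l, Function.Surjective π ∧
        TildeFiltered R A N (Set.Iio l) (LinearMap.ker π))

end QuasiHereditary

/-!
The classes `F(Δ̃)` and `F(Ñ)` are orthogonal: `Ext^i(X, Y) = 0` for `X` in `F(Δ̃)`, `Y` in `F(Ñ)`
and `i > 0`. This and the approximation theorem `IsTiltingFamily.exists_approximations` carry the
proof. The latter says that every module `M` that is finitely generated projective over `R` fits
into exact sequences `0 → Y → X → M → 0` and `0 → M → Y' → X' → 0` with `X`, `X'` in `F(Δ̃)` and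
`Y`, `Y'` in `F(Ñ)`.

If `Ext^1(M, N l) = 0` for all `l`, the first sequence splits and `M` is a direct summand of `X`.
If `Ext^i(Δ l, M) = 0` for all `l` and `i > 0`, the second one splits and `M` is a direct summand
of `Y'`. The class `F(Δ̃)` is closed under direct summands, because for `l` maximal among the
weights of `X` the bottom layer of a filtration is the image of the evaluation map `Δ l ⊗ Hom(Δ l,
X) → X`, which is functorial in `X` (`IsSplitQuasiHereditary.filtered_of_retract`). For `F(Ñ)`
there is a substitute: it is closed under cokernels of monomorphisms, if these are projective over
`R` (`IsTiltingFamily.filtered_of_ses`), and a module of `F(Δ̃)` satisfying the `Ext` condition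
embeds as a direct summand into a tilting module with a complement of the same kind and of smaller
weights (`IsTiltingFamily.costandard_of_standard`).

The sequences `0 → Δ l → T l → X l → 0` and `0 → Y l → T l → N l → 0` together with the horseshoe
lemma embed every module of `F(Δ̃)` into a module of `add T` with cokernel in `F(Δ̃)` and make
every module of `F(Ñ)` a quotient of one with kernel in `F(Ñ)`, both times of smaller weights. As
`Λ` is finite, iterating this gives the finite (co)resolutions by `add T`. Along them,
orthogonality to `T` passes on to all of `F(Δ̃)` or `F(Ñ)`, which turns the two criteria above into
conditions on `T`. An `M` in both classes embeds into `add T` with cokernel in `F(Δ̃)`; this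
embedding splits, so `M` is in `add T`.

The approximations are found by induction on the weights of `M`. If `l` is a maximal weight, there
is a surjection `Q → M` with `Q` in `F(Δ̃)` whose kernel has fewer weights
(`VanishesOff.exists_relative_cover`); the approximations of the kernel are then pushed out. The
properties of the costandard modules needed for this, such as `Ext^1(N l, N m) = 0` unless `m < l`,
are read off from `T l` by dimension shifting. Each `T l` carries the `R`-module structure induced
by `R → A`; it is not part of the data.
-/

open CategoryTheory

/-! ### Short exact sequences and vanishing of Ext -/

section ShortExact

/-- The sequence `0 → M₁ → M₂ → M₃ → 0` given by `f` and `g` is exact. -/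
structure SES {A : Type*} [Ring A] {M₁ M₂ M₃ : Type*} [AddCommGroup M₁] [AddCommGroup M₂]
    [AddCommGroup M₃] [Module A M₁] [Module A M₂] [Module A M₃]
    (f : M₁ →ₗ[A] M₂) (g : M₂ →ₗ[A] M₃) : Prop where
  inj : Function.Injective f
  surj : Function.Surjective g
  exact : Function.Exact f g

variable {A : Type u} [Ring A]
  {M₁ M₂ M₃ : Type u} [AddCommGroup M₁] [AddCommGroup M₂]
  [AddCommGroup M₃] [Module A M₁] [Module A M₂] [Module A M₃]
  {f : M₁ →ₗ[A] M₂} {g : M₂ →ₗ[A] M₃}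

lemma SES.shortExact (h : SES f g) :
    (ShortComplex.mk (ModuleCat.ofHom f) (ModuleCat.ofHom g) (by
      ext x; exact h.exact.apply_apply_eq_zero x)).ShortExact where
  exact := by
    rw [ShortComplex.ShortExact.moduleCat_exact_iff_function_exact]
    exact h.exact
  mono_f := by
    rw [ModuleCat.mono_iff_injective]
    exact h.inj
  epi_g := by
    rw [ModuleCat.epi_iff_surjective]
    exact h.surj

variable {L : Type u} [AddCommGroup L] [Module A L]

lemma extVanishes_zero_iff {M N : Type u} [AddCommGroup M] [AddCommGroup N] [Module A M]
    [Module A N] : ExtVanishes A M N 0 ↔ ∀ f : M →ₗ[A] N, f = 0 := by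
  unfold ExtVanishes
  rw [Abelian.Ext.homEquiv₀.subsingleton_congr, ModuleCat.homEquiv.subsingleton_congr]
  exact ⟨fun h f => Subsingleton.elim _ _, fun h => ⟨fun a b => (h a).trans (h b).symm⟩⟩

/-- `Ext^i(M₁, L) = 0` and `Ext^i(M₃, L) = 0` imply `Ext^i(M₂, L) = 0`. -/
lemma SES.extVanishes_left (h : SES f g) {i : ℕ} (h₁ : ExtVanishes A M₁ L i)
    (h₃ : ExtVanishes A M₃ L i) : ExtVanishes A M₂ L i := by
  refine subsingleton_of_forall_eq 0 fun x => ?_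
  obtain ⟨y, rfl⟩ := Abelian.Ext.contravariant_sequence_exact₂ h.shortExact _ x
    (@Subsingleton.elim _ h₁ _ _)
  rw [@Subsingleton.elim _ h₃ y 0, Abelian.Ext.comp_zero]

lemma SES.extVanishes_left₁ (h : SES f g) {i : ℕ} (h₂ : ExtVanishes A M₂ L i)
    (h₃ : ExtVanishes A M₃ L (i + 1)) : ExtVanishes A M₁ L i := by
  refine subsingleton_of_forall_eq 0 fun x => ?_
  obtain ⟨y, rfl⟩ := Abelian.Ext.contravariant_sequence_exact₁ h.shortExact _ x
    (n₁ := i + 1) (by omega) (@Subsingleton.elim _ h₃ _ _)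
  rw [@Subsingleton.elim _ h₂ y 0, Abelian.Ext.comp_zero]

lemma SES.extVanishes_left₃ (h : SES f g) {i : ℕ} (h₁ : ExtVanishes A M₁ L i)
    (h₂ : ExtVanishes A M₂ L (i + 1)) : ExtVanishes A M₃ L (i + 1) := by
  refine subsingleton_of_forall_eq 0 fun x => ?_
  obtain ⟨y, rfl⟩ := Abelian.Ext.contravariant_sequence_exact₃ h.shortExact _ x
    (@Subsingleton.elim _ h₂ _ _) (n₀ := i) (by omega)
  rw [@Subsingleton.elim _ h₁ y 0, Abelian.Ext.comp_zero]

lemma SES.extVanishes_right (h : SES f g) {i : ℕ} (h₁ : ExtVanishes A L M₁ i)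
    (h₃ : ExtVanishes A L M₃ i) : ExtVanishes A L M₂ i := by
  refine subsingleton_of_forall_eq 0 fun x => ?_
  obtain ⟨y, rfl⟩ := Abelian.Ext.covariant_sequence_exact₂ _ h.shortExact x
    (@Subsingleton.elim _ h₃ _ _)
  rw [@Subsingleton.elim _ h₁ y 0, Abelian.Ext.zero_comp]

lemma SES.extVanishes_right₃ (h : SES f g) {i : ℕ} (h₁ : ExtVanishes A L M₁ (i + 1))
    (h₂ : ExtVanishes A L M₂ i) : ExtVanishes A L M₃ i := by
  refine subsingleton_of_forall_eq 0 fun x => ?_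
  obtain ⟨y, rfl⟩ := Abelian.Ext.covariant_sequence_exact₃ _ h.shortExact x
    (n₁ := i + 1) rfl (@Subsingleton.elim _ h₁ _ _)
  rw [@Subsingleton.elim _ h₂ y 0, Abelian.Ext.zero_comp]

lemma ExtVanishes.of_retract_left {M M' L : Type u} [AddCommGroup M] [AddCommGroup M']
    [AddCommGroup L] [Module A M] [Module A M'] [Module A L] {j : ℕ} (h : ExtVanishes A M' L j)
    (i : M →ₗ[A] M') (p : M' →ₗ[A] M) (hp : p ∘ₗ i = LinearMap.id) : ExtVanishes A M L j := by
  refine subsingleton_of_forall_eq 0 fun x => ?_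
  have : ModuleCat.ofHom i ≫ ModuleCat.ofHom p = 𝟙 _ := by
    rw [← ModuleCat.ofHom_comp, hp]; rfl
  rw [← Abelian.Ext.mk₀_id_comp x, ← this, ← Abelian.Ext.mk₀_comp_mk₀,
    Abelian.Ext.comp_assoc_of_second_deg_zero,
    @Subsingleton.elim _ h (Abelian.Ext.comp _ x _) 0, Abelian.Ext.comp_zero]

lemma ExtVanishes.of_retract_right {M M' L : Type u} [AddCommGroup M] [AddCommGroup M']
    [AddCommGroup L] [Module A M] [Module A M'] [Module A L] {j : ℕ} (h : ExtVanishes A L M' j)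
    (i : M →ₗ[A] M') (p : M' →ₗ[A] M) (hp : p ∘ₗ i = LinearMap.id) : ExtVanishes A L M j := by
  refine subsingleton_of_forall_eq 0 fun x => ?_
  have : ModuleCat.ofHom i ≫ ModuleCat.ofHom p = 𝟙 _ := by
    rw [← ModuleCat.ofHom_comp, hp]; rfl
  rw [← Abelian.Ext.comp_mk₀_id x, ← this, ← Abelian.Ext.mk₀_comp_mk₀,
    ← Abelian.Ext.comp_assoc_of_second_deg_zero,
    @Subsingleton.elim _ h (Abelian.Ext.comp x _ _) 0, Abelian.Ext.zero_comp]

lemma extVanishes_of_projective (P L : Type u) [AddCommGroup P] [AddCommGroup L] [Module A P]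
    [Module A L] [Module.Projective A P] (i : ℕ) : ExtVanishes A P L (i + 1) := by
  have : Projective (ModuleCat.of A P) :=
    (IsProjective.iff_projective P).mp inferInstance
  exact Abelian.Ext.subsingleton_of_projective _ _ _

lemma extVanishes_of_subsingleton_left (P L : Type u) [AddCommGroup P] [AddCommGroup L]
    [Module A P] [Module A L] [Subsingleton P] (i : ℕ) : ExtVanishes A P L i := by
  cases i with
  | zero =>
    refine extVanishes_zero_iff.2 fun f => LinearMap.ext fun x => ?_
    rw [Subsingleton.elim x 0, map_zero, map_zero]
  | succ i => exact extVanishes_of_projective P L i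

lemma extVanishes_of_subsingleton_right (P L : Type u) [AddCommGroup P] [AddCommGroup L]
    [Module A P] [Module A L] [Subsingleton L] (i : ℕ) : ExtVanishes A P L i := by
  refine subsingleton_of_forall_eq 0 fun x => ?_
  have : 𝟙 (ModuleCat.of A L) = 0 := by
    ext x; exact @Subsingleton.elim L _ _ _
  rw [← Abelian.Ext.comp_mk₀_id x, this, Abelian.Ext.mk₀_zero, Abelian.Ext.comp_zero]

/-- If `Ext^1(M₃, L) = 0`, then every map `M₁ → L` extends to `M₂`. -/
lemma SES.exists_extend (h : SES f g) (h₃ : ExtVanishes A M₃ L 1) (φ : M₁ →ₗ[A] L) :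
    ∃ ψ : M₂ →ₗ[A] L, ψ ∘ₗ f = φ := by
  obtain ⟨y, hy⟩ := Abelian.Ext.contravariant_sequence_exact₁ h.shortExact _
    (Abelian.Ext.mk₀ (ModuleCat.ofHom φ))
    (n₁ := 1) rfl (@Subsingleton.elim _ h₃ _ _)
  obtain ⟨ψ, rfl⟩ := (Abelian.Ext.mk₀_bijective _ _).2 y
  rw [Abelian.Ext.mk₀_comp_mk₀] at hy
  have := (Abelian.Ext.mk₀_bijective _ _).1 hy
  refine ⟨ψ.hom, ?_⟩
  exact congrArg ModuleCat.Hom.hom this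

/-- If `Ext^1(L, M₁) = 0`, then every map `L → M₃` lifts to `M₂`. -/
lemma SES.exists_lift (h : SES f g) (h₁ : ExtVanishes A L M₁ 1) (φ : L →ₗ[A] M₃) :
    ∃ ψ : L →ₗ[A] M₂, g ∘ₗ ψ = φ := by
  obtain ⟨y, hy⟩ := Abelian.Ext.covariant_sequence_exact₃ _ h.shortExact
    (Abelian.Ext.mk₀ (ModuleCat.ofHom φ))
    (n₁ := 1) rfl (@Subsingleton.elim _ h₁ _ _)
  obtain ⟨ψ, rfl⟩ := (Abelian.Ext.mk₀_bijective _ _).2 y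
  rw [Abelian.Ext.mk₀_comp_mk₀] at hy
  have := (Abelian.Ext.mk₀_bijective _ _).1 hy
  refine ⟨ψ.hom, ?_⟩
  exact congrArg ModuleCat.Hom.hom this

end ShortExact

/-! ### Elementary operations on short exact sequences -/

section Sequences

variable {A : Type*} [Ring A]
  {M₁ M₂ M₃ : Type*} [AddCommGroup M₁] [AddCommGroup M₂]
  [AddCommGroup M₃] [Module A M₁] [Module A M₂] [Module A M₃]
  {f : M₁ →ₗ[A] M₂} {g : M₂ →ₗ[A] M₃}
  {L : Type*} [AddCommGroup L] [Module A L]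

lemma SES.comp_eq_zero (h : SES f g) : g ∘ₗ f = 0 :=
  LinearMap.ext h.exact.apply_apply_eq_zero

lemma SES.factor_left (h : SES f g) (ψ : L →ₗ[A] M₂) (hψ : g ∘ₗ ψ = 0) :
    ∃ ψ' : L →ₗ[A] M₁, f ∘ₗ ψ' = ψ := by
  have hr : ∀ x, ψ x ∈ LinearMap.range f := fun x =>
    (h.exact (ψ x)).1 (LinearMap.congr_fun hψ x)
  refine ⟨(LinearEquiv.ofInjective f h.inj).symm.toLinearMap ∘ₗ ψ.codRestrict _ hr, ?_⟩
  ext x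
  have := LinearEquiv.apply_symm_apply (LinearEquiv.ofInjective f h.inj) ⟨ψ x, hr x⟩
  exact congrArg Subtype.val this

lemma SES.factor_right (h : SES f g) (ψ : M₂ →ₗ[A] L) (hψ : ψ ∘ₗ f = 0) :
    ∃ ψ' : M₃ →ₗ[A] L, ψ' ∘ₗ g = ψ := by
  have hk : LinearMap.ker g ≤ LinearMap.ker ψ := by
    intro x hx
    obtain ⟨y, rfl⟩ := (h.exact x).1 hx
    exact LinearMap.congr_fun hψ y
  refine ⟨(LinearMap.ker g).liftQ ψ hk ∘ₗ
    (g.quotKerEquivOfSurjective h.surj).symm.toLinearMap, ?_⟩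
  ext x
  have : (g.quotKerEquivOfSurjective h.surj).symm (g x) = Submodule.Quotient.mk x := by
    rw [LinearEquiv.symm_apply_eq]; rfl
  simp [this]

lemma SES.of_ker {g : M₂ →ₗ[A] M₃} (hg : Function.Surjective g) :
    SES (LinearMap.ker g).subtype g :=
  ⟨Subtype.val_injective, hg, fun x => by simp⟩

lemma SES.of_range {f : M₁ →ₗ[A] M₂} (hf : Function.Injective f) :
    SES f (LinearMap.range f).mkQ :=
  ⟨hf, Submodule.mkQ_surjective _, fun x => by simp⟩

lemma SES.inl_snd : SES (LinearMap.inl A M₁ M₂) (LinearMap.snd A M₁ M₂) :=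
  ⟨LinearMap.inl_injective, LinearMap.snd_surjective, .inl_snd⟩

lemma SES.comp_equiv (h : SES f g) (e : M₃ ≃ₗ[A] L) : SES f (e.toLinearMap ∘ₗ g) :=
  ⟨h.inj, e.surjective.comp h.surj, fun x => by simpa using h.exact x⟩

lemma SES.equiv_comp (h : SES f g) (e : L ≃ₗ[A] M₁) : SES (f ∘ₗ e.toLinearMap) g :=
  ⟨h.inj.comp e.injective, h.surj, fun x => by
    rw [h.exact x, LinearMap.coe_comp]
    exact (e.surjective.range_comp f ▸ Iff.rfl)⟩

lemma SES.restrictScalars (R : Type*) [CommRing R] [Algebra R A] [Module R M₁] [Module R M₂]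
    [Module R M₃] [IsScalarTower R A M₁] [IsScalarTower R A M₂] [IsScalarTower R A M₃]
    (h : SES f g) : SES (f.restrictScalars R) (g.restrictScalars R) :=
  ⟨h.inj, h.surj, h.exact⟩

/-- A section of `g` yields a retraction of `f`. -/
lemma SES.exists_retraction (h : SES f g) (s : M₃ →ₗ[A] M₂) (hs : g ∘ₗ s = LinearMap.id) :
    ∃ r : M₂ →ₗ[A] M₁, r ∘ₗ f = LinearMap.id ∧ f ∘ₗ r + s ∘ₗ g = LinearMap.id := by
  obtain ⟨r, hr⟩ := h.factor_left (LinearMap.id - s ∘ₗ g) (by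
    rw [LinearMap.comp_sub, ← LinearMap.comp_assoc, hs, LinearMap.comp_id,
      LinearMap.id_comp, sub_self])
  refine ⟨r, ?_, by rw [hr]; abel⟩
  ext x
  apply h.inj
  have := LinearMap.congr_fun hr (f x)
  simpa [h.exact.apply_apply_eq_zero] using this

end Sequences

/-! ### Finitely generated projective modules -/

section FP

/-- `M` is a finitely generated projective `R`-module. -/
structure FP (R : Type*) [CommRing R] (M : Type*) [AddCommGroup M] [Module R M] : Prop where
  finite : Module.Finite R M
  projective : Module.Projective R M

variable {R : Type*} [CommRing R] {M M₁ M₂ M₃ : Type*} [AddCommGroup M] [Module R M]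
  [AddCommGroup M₁] [Module R M₁] [AddCommGroup M₂] [Module R M₂] [AddCommGroup M₃] [Module R M₃]

lemma FP.of_retract (h : FP R M) (i : M₁ →ₗ[R] M) (p : M →ₗ[R] M₁) (hp : p ∘ₗ i = LinearMap.id) :
    FP R M₁ := by
  have := h.finite
  have := h.projective
  exact ⟨.of_surjective p fun x => ⟨i x, LinearMap.congr_fun hp x⟩, .of_split i p hp⟩

lemma FP.of_equiv (h : FP R M) (e : M ≃ₗ[R] M₁) : FP R M₁ :=
  h.of_retract e.symm.toLinearMap e.toLinearMap (by ext; simp)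

lemma FP.of_subsingleton [Subsingleton M] : FP R M :=
  ⟨inferInstance, inferInstance⟩

lemma FP.prod (h₁ : FP R M₁) (h₂ : FP R M₂) : FP R (M₁ × M₂) := by
  have := h₁.finite
  have := h₁.projective
  have := h₂.finite
  have := h₂.projective
  exact ⟨inferInstance, inferInstance⟩

lemma FP.pi {ι : Type*} [Finite ι] (h : FP R M) : FP R (ι → M) := by
  have := h.finite
  have := h.projective
  have := Fintype.ofFinite ι
  classical
  have := Module.Projective.of_equiv (DirectSum.linearEquivFunOnFintype R ι (fun _ => M))
  exact ⟨inferInstance, this⟩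

lemma FP.tensor (h₁ : FP R M₁) (h₂ : FP R M₂) : FP R (M₁ ⊗[R] M₂) := by
  have := h₁.finite
  have := h₁.projective
  have := h₂.finite
  have := h₂.projective
  exact ⟨inferInstance, inferInstance⟩

lemma FP.exists_section {g : M →ₗ[R] M₃} (hg : Function.Surjective g) (h₃ : FP R M₃) :
    ∃ s : M₃ →ₗ[R] M, g ∘ₗ s = LinearMap.id := by
  have := h₃.projective
  exact Module.projective_lifting_property g LinearMap.id hg

variable {A : Type*} [Ring A] [Algebra R A] [Module A M₁] [Module A M₂] [Module A M₃]
  [IsScalarTower R A M₁] [IsScalarTower R A M₂] [IsScalarTower R A M₃]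
  {f : M₁ →ₗ[A] M₂} {g : M₂ →ₗ[A] M₃}

lemma SES.fp₂ (h : SES f g) (h₁ : FP R M₁) (h₃ : FP R M₃) : FP R M₂ := by
  obtain ⟨s, hs⟩ := FP.exists_section (h.restrictScalars R).surj h₃
  obtain ⟨r, -, hr⟩ := (h.restrictScalars R).exists_retraction s hs
  exact (h₁.prod h₃).of_retract (r.prod (g.restrictScalars R))
    ((f.restrictScalars R).coprod s) (by rw [LinearMap.coprod_comp_prod, hr])

lemma SES.fp₁ (h : SES f g) (h₂ : FP R M₂) (h₃ : FP R M₃) : FP R M₁ := by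
  obtain ⟨s, hs⟩ := FP.exists_section (h.restrictScalars R).surj h₃
  obtain ⟨r, hr, -⟩ := (h.restrictScalars R).exists_retraction s hs
  exact h₂.of_retract _ r hr

end FP

/-! ### Pushouts of modules -/

section Pushout

variable {A : Type*} [Ring A] {B B' X C : Type*} [AddCommGroup B] [AddCommGroup B']
  [AddCommGroup X] [AddCommGroup C] [Module A B] [Module A B'] [Module A X] [Module A C]

/-- The pushout of `a : B → X` and `b : B → B'`. -/
abbrev Pushout (a : B →ₗ[A] X) (b : B →ₗ[A] B') : Type _ :=
  (B' × X) ⧸ LinearMap.range (b.prod (-a))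

namespace Pushout

variable (a : B →ₗ[A] X) (b : B →ₗ[A] B')

/-- The map from `B'` to the pushout. -/
def inl : B' →ₗ[A] Pushout a b := Submodule.mkQ _ ∘ₗ LinearMap.inl A B' X

/-- The map from `X` to the pushout. -/
def inr : X →ₗ[A] Pushout a b := Submodule.mkQ _ ∘ₗ LinearMap.inr A B' X

lemma mk_eq (y : B') (x : X) :
    (Submodule.Quotient.mk (y, x) : Pushout a b) = inl a b y + inr a b x := by
  have : (y, x) = (y, 0) + (0, x) := by simp
  rw [this]; rfl

lemma inl_add_inr_eq_zero_iff (y : B') (x : X) :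
    inl a b y + inr a b x = 0 ↔ ∃ z, b z = y ∧ - a z = x := by
  rw [← mk_eq, Submodule.Quotient.mk_eq_zero]
  simp [LinearMap.mem_range, Prod.ext_iff]

lemma exists_rep (q : Pushout a b) : ∃ y x, q = inl a b y + inr a b x := by
  obtain ⟨⟨y, x⟩, rfl⟩ := Submodule.Quotient.mk_surjective _ q
  exact ⟨y, x, mk_eq a b y x⟩

lemma condition (z : B) : inr a b (a z) = inl a b (b z) := by
  have := (inl_add_inr_eq_zero_iff a b (b (-z)) (a z)).2 ⟨-z, rfl, by simp⟩
  rw [map_neg, map_neg, neg_add_eq_zero] at this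
  exact this.symm

variable {a b} {Z : Type*} [AddCommGroup Z] [Module A Z]

lemma exists_desc (f : X →ₗ[A] Z) (g : B' →ₗ[A] Z) (h : f ∘ₗ a = g ∘ₗ b) :
    ∃ φ : Pushout a b →ₗ[A] Z, φ ∘ₗ inr a b = f ∧ φ ∘ₗ inl a b = g := by
  refine ⟨Submodule.liftQ _ (g.coprod f) ?_, ?_, ?_⟩
  · rintro _ ⟨z, rfl⟩
    have := LinearMap.congr_fun h z
    simp only [LinearMap.comp_apply] at this
    simp [this]
  · ext x; simp [inr]
  · ext x; simp [inl]

/-- The cokernel of `B' → Pushout a b` is that of `a`. -/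
lemma ses_inl {p : X →ₗ[A] C} (h : SES a p) :
    ∃ p' : Pushout a b →ₗ[A] C, SES (inl a b) p' ∧ p' ∘ₗ inr a b = p := by
  obtain ⟨p', h₁, h₂⟩ := exists_desc (a := a) (b := b) p 0 (by rw [h.comp_eq_zero]; simp)
  have h₁' : ∀ x, p' (inr a b x) = p x := LinearMap.congr_fun h₁
  have h₂' : ∀ x, p' (inl a b x) = 0 := LinearMap.congr_fun h₂
  refine ⟨p', ⟨?_, ?_, ?_⟩, h₁⟩
  · rw [← LinearMap.ker_eq_bot, LinearMap.ker_eq_bot']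
    intro y hy
    obtain ⟨z, rfl, hz⟩ := (inl_add_inr_eq_zero_iff a b y 0).1 (by simpa using hy)
    have : z = 0 := h.inj (by simpa using hz)
    simp [this]
  · intro c
    obtain ⟨x, rfl⟩ := h.surj c
    exact ⟨_, h₁' x⟩
  · intro q
    constructor
    · intro hq
      obtain ⟨y, x, rfl⟩ := exists_rep a b q
      rw [map_add, h₂', h₁', zero_add] at hq
      obtain ⟨z, rfl⟩ := (h.exact x).1 hq
      exact ⟨y + b z, by rw [condition, map_add]⟩
    · rintro ⟨y, rfl⟩
      exact h₂' y

/-- If `b` is injective, so is `X → Pushout a b`, with the same cokernel. -/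
lemma ses_inr {c : B' →ₗ[A] C} (h : SES b c) :
    ∃ c' : Pushout a b →ₗ[A] C, SES (inr a b) c' := by
  obtain ⟨p', h₁, h₂⟩ := exists_desc (a := a) (b := b) 0 c (by rw [h.comp_eq_zero]; simp)
  have h₁' : ∀ x, p' (inr a b x) = 0 := LinearMap.congr_fun h₁
  have h₂' : ∀ x, p' (inl a b x) = c x := LinearMap.congr_fun h₂
  refine ⟨p', ⟨?_, ?_, ?_⟩⟩
  · rw [← LinearMap.ker_eq_bot, LinearMap.ker_eq_bot']
    intro x hx
    obtain ⟨z, hz, rfl⟩ := (inl_add_inr_eq_zero_iff a b 0 x).1 (by simpa using hx)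
    have : z = 0 := h.inj (by simpa using hz)
    simp [this]
  · intro y
    obtain ⟨x, rfl⟩ := h.surj y
    exact ⟨_, h₂' x⟩
  · intro q
    constructor
    · intro hq
      obtain ⟨y, x, rfl⟩ := exists_rep a b q
      rw [map_add, h₂', h₁', add_zero] at hq
      obtain ⟨z, rfl⟩ := (h.exact y).1 hq
      exact ⟨a z + x, by rw [map_add, condition]⟩
    · rintro ⟨y, rfl⟩
      exact h₁' y

/-- If `b` is surjective, so is `X → Pushout a b`, with the same kernel. -/
lemma ses_inr' {K : Type*} [AddCommGroup K] [Module A K] {k : K →ₗ[A] B} (h : SES k b)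
    (ha : Function.Injective a) : SES (a ∘ₗ k) (inr a b) := by
  refine ⟨ha.comp h.inj, ?_, ?_⟩
  · intro q
    obtain ⟨y, x, rfl⟩ := exists_rep a b q
    obtain ⟨z, rfl⟩ := h.surj y
    exact ⟨a z + x, by rw [map_add, condition]⟩
  · intro x
    constructor
    · intro hx
      obtain ⟨z, hz, rfl⟩ := (inl_add_inr_eq_zero_iff a b 0 x).1 (by simpa using hx)
      obtain ⟨k', rfl⟩ := (h.exact z).1 hz
      exact ⟨-k', by simp⟩
    · rintro ⟨k', rfl⟩
      rw [LinearMap.comp_apply, condition, h.exact.apply_apply_eq_zero, map_zero]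

end Pushout

end Pushout

/-! ### Filtered modules -/

section Filtrations

variable {R : Type u} [CommRing R] {A : Type u} [Ring A] [Algebra R A] {Λ : Type w}
  {X : Λ → Type u} [∀ l, AddCommGroup (X l)] [∀ l, Module R (X l)]
  [∀ l, Module A (X l)] [∀ l, IsScalarTower R A (X l)] {S S' : Set Λ}

lemma TildeFiltered.mono {M : Type u} [AddCommGroup M] [Module A M]
    (h : TildeFiltered R A X S M) (hS : S ⊆ S') : TildeFiltered R A X S' M := by
  obtain ⟨t, F, hF, h0, ht, H⟩ := h
  refine ⟨t, F, hF, h0, ht, fun i hi => ?_⟩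
  obtain ⟨l, hl, h'⟩ := H i hi
  exact ⟨l, hS hl, h'⟩

lemma TildeFiltered.of_subsingleton {M : Type u} [AddCommGroup M] [Module A M] [Subsingleton M] :
    TildeFiltered R A X S M :=
  ⟨0, fun _ => ⊥, monotone_const, rfl, Subsingleton.elim _ _, fun i hi => by omega⟩

/-- A subquotient is described by the surjections from its numerator; this avoids computing in
iterated quotients. -/
lemma nonempty_quotient_equiv_iff {M Z : Type*} [AddCommGroup M] [Module A M] [AddCommGroup Z]
    [Module A Z] (P Q : Submodule A M) :
    Nonempty ((Q ⧸ P.submoduleOf Q) ≃ₗ[A] Z) ↔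
      ∃ q : Q →ₗ[A] Z, Function.Surjective q ∧ ∀ x, q x = 0 ↔ (x : M) ∈ P := by
  constructor
  · rintro ⟨e⟩
    refine ⟨e.toLinearMap ∘ₗ Submodule.mkQ _, e.surjective.comp (Submodule.mkQ_surjective _), ?_⟩
    intro x
    rw [LinearMap.comp_apply, LinearEquiv.coe_coe, e.map_eq_zero_iff, Submodule.mkQ_apply,
      Submodule.Quotient.mk_eq_zero]
    rfl
  · rintro ⟨q, hq, h⟩
    have : P.submoduleOf Q = LinearMap.ker q := by
      ext x; simp [Submodule.submoduleOf, h]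
    rw [this]
    exact ⟨q.quotKerEquivOfSurjective hq⟩

/-- A filtration of a submodule with quotient `X l ⊗ U` extends to a filtration of the module. -/
lemma TildeFiltered.snoc {M' M : Type u} [AddCommGroup M'] [Module A M'] [AddCommGroup M]
    [Module A M] {l : Λ} (hl : l ∈ S) {U : Type u} [AddCommGroup U] [Module R U] (hU : FP R U)
    {f : M' →ₗ[A] M} {g : M →ₗ[A] X l ⊗[R] U} (h : SES f g) (h' : TildeFiltered R A X S M') :
    TildeFiltered R A X S M := by
  obtain ⟨t, F, hF, h0, ht, H⟩ := h'
  refine ⟨t + 1, fun i => if i ≤ t then (F i).map f else ⊤, ?_, ?_, ?_, ?_⟩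
  · intro i j hij
    dsimp only
    split_ifs with h1 h2
    · exact Submodule.map_mono (hF hij)
    · exact le_top
    · omega
    · exact le_rfl
  · simp [h0]
  · simp
  · intro i hi
    rcases Nat.lt_succ_iff_lt_or_eq.1 hi with hi | rfl
    · obtain ⟨l', hl', U', hU₁, hU₂, e⟩ := H i hi
      refine ⟨l', hl', U', hU₁, hU₂, ?_⟩
      beta_reduce
      rw [if_pos (by omega), if_pos (by omega)]
      rw [nonempty_quotient_equiv_iff] at e ⊢
      obtain ⟨q, hq, hk⟩ := e
      refine ⟨q ∘ₗ (Submodule.equivMapOfInjective f h.inj (F (i + 1))).symm.toLinearMap,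
        hq.comp (LinearEquiv.surjective _), fun x => ?_⟩
      obtain ⟨y, rfl⟩ := (Submodule.equivMapOfInjective f h.inj (F (i + 1))).surjective x
      simp only [LinearMap.comp_apply, LinearEquiv.coe_coe, LinearEquiv.symm_apply_apply, hk,
        Submodule.coe_equivMapOfInjective_apply]
      exact (Function.Injective.mem_set_image h.inj).symm
    · refine ⟨l, hl, ModuleCat.of R U, hU.finite, hU.projective, ?_⟩
      beta_reduce
      rw [if_pos le_rfl, if_neg (by omega), nonempty_quotient_equiv_iff]
      refine ⟨g ∘ₗ Submodule.subtype ⊤, h.surj.comp fun x => ⟨⟨x, trivial⟩, rfl⟩, fun x => ?_⟩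
      rw [ht, Submodule.map_top]
      exact h.exact x

/-- Induction along the filtration of a module in `F(X̃_S)`. -/
theorem TildeFiltered.induction
    {motive : ∀ (M : Type u) [AddCommGroup M] [Module R M] [Module A M] [IsScalarTower R A M],
      Prop}
    (zero : ∀ (M : Type u) [AddCommGroup M] [Module R M] [Module A M] [IsScalarTower R A M]
      [Subsingleton M], motive M)
    (snoc : ∀ (M' M : Type u) [AddCommGroup M'] [Module R M'] [Module A M'] [IsScalarTower R A M']
      [AddCommGroup M] [Module R M] [Module A M] [IsScalarTower R A M] (l : Λ)
      (U : Type u) [AddCommGroup U] [Module R U] (f : M' →ₗ[A] M) (g : M →ₗ[A] X l ⊗[R] U),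
      l ∈ S → FP R U → SES f g → TildeFiltered R A X S M' → motive M' → motive M)
    {M : Type u} [AddCommGroup M] [Module R M] [Module A M] [IsScalarTower R A M]
    (h : TildeFiltered R A X S M) : motive M := by
  obtain ⟨t, F, hF, h0, ht, H⟩ := h
  induction t generalizing M with
  | zero =>
    have : Subsingleton M := (Submodule.subsingleton_iff A).1
      (subsingleton_of_bot_eq_top (h0.symm.trans ht))
    exact zero M
  | succ t ih =>
    have H' : ∀ i < t, ∃ l ∈ S, ∃ U : ModuleCat.{u} R, Module.Finite R U ∧ Module.Projective R U ∧
        Nonempty (((F (i + 1)).submoduleOf (F t) ⧸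
          ((F i).submoduleOf (F t)).submoduleOf ((F (i + 1)).submoduleOf (F t)))
            ≃ₗ[A] (X l ⊗[R] U)) := by
      intro i hi
      obtain ⟨l, hl, U, hU₁, hU₂, e⟩ := H i (by omega)
      refine ⟨l, hl, U, hU₁, hU₂, ?_⟩
      rw [nonempty_quotient_equiv_iff] at e ⊢
      obtain ⟨q, hq, hk⟩ := e
      refine ⟨q ∘ₗ (Submodule.submoduleOfEquivOfLe (hF (by omega : i + 1 ≤ t))).toLinearMap,
        hq.comp (LinearEquiv.surjective _), fun x => hk _⟩
    have hmono : Monotone fun i => (F i).submoduleOf (F t) := fun i j hij =>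
      Submodule.comap_mono (hF hij)
    have h0' : (F 0).submoduleOf (F t) = ⊥ := by
      rw [h0]; exact Submodule.ker_subtype _
    have ht' : (F t).submoduleOf (F t) = ⊤ := Submodule.submoduleOf_self _
    obtain ⟨l, hl, U, hU₁, hU₂, e⟩ := H t (by omega)
    rw [nonempty_quotient_equiv_iff] at e
    obtain ⟨q, hq, hk⟩ := e
    let e : M ≃ₗ[A] F (t + 1) := (LinearEquiv.ofTop _ ht).symm
    refine snoc (F t) M l U (F t).subtype (q ∘ₗ e.toLinearMap) hl ⟨hU₁, hU₂⟩
      ⟨Subtype.val_injective, hq.comp e.surjective, fun x => ?_⟩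
      ⟨t, fun i => (F i).submoduleOf (F t), hmono, h0', ht', H'⟩
      (ih _ hmono h0' ht' H')
    simp only [LinearMap.comp_apply, LinearEquiv.coe_coe, hk]
    simp [e]

variable {M M₁ M₂ M₃ : Type u} [AddCommGroup M] [Module R M] [Module A M] [IsScalarTower R A M]
  [AddCommGroup M₁] [Module A M₁]
  [AddCommGroup M₂] [Module R M₂] [Module A M₂] [IsScalarTower R A M₂]
  [AddCommGroup M₃] [Module R M₃] [Module A M₃] [IsScalarTower R A M₃]

lemma TildeFiltered.of_linearEquiv {M N : Type u} [AddCommGroup M] [Module A M] [AddCommGroup N]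
    [Module A N] (h : TildeFiltered R A X S M) (e : M ≃ₗ[A] N) : TildeFiltered R A X S N := by
  obtain ⟨t, F, hF, h0, ht, H⟩ := h
  refine ⟨t, fun i => (F i).map e.toLinearMap, fun i j hij => Submodule.map_mono (hF hij),
    by simp [h0], by simp [ht], fun i hi => ?_⟩
  obtain ⟨l, hl, U, hU₁, hU₂, e'⟩ := H i hi
  refine ⟨l, hl, U, hU₁, hU₂, ?_⟩
  rw [nonempty_quotient_equiv_iff] at e' ⊢
  obtain ⟨q, hq, hk⟩ := e'
  refine ⟨q ∘ₗ
    (Submodule.equivMapOfInjective e.toLinearMap e.injective (F (i + 1))).symm.toLinearMap,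
    hq.comp (LinearEquiv.surjective _), fun x => ?_⟩
  obtain ⟨y, rfl⟩ :=
    (Submodule.equivMapOfInjective e.toLinearMap e.injective (F (i + 1))).surjective x
  simp only [LinearMap.comp_apply, LinearEquiv.coe_coe, LinearEquiv.symm_apply_apply, hk,
    Submodule.coe_equivMapOfInjective_apply]
  exact (Function.Injective.mem_set_image e.injective).symm

/-- `F(X̃_S)` is closed under extensions. -/
lemma TildeFiltered.extension {f : M₁ →ₗ[A] M₂} {g : M₂ →ₗ[A] M₃} (h : SES f g)
    (h₁ : TildeFiltered R A X S M₁) (h₃ : TildeFiltered R A X S M₃) :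
    TildeFiltered R A X S M₂ := by
  refine TildeFiltered.induction (S := S) (motive := fun M₃ _ _ _ _ => ∀ (M₂ : Type u)
    [AddCommGroup M₂] [Module R M₂] [Module A M₂] [IsScalarTower R A M₂] (f : M₁ →ₗ[A] M₂)
    (g : M₂ →ₗ[A] M₃), SES f g → TildeFiltered R A X S M₂) ?_ ?_ h₃ M₂ f g h
  · intro M₃ _ _ _ _ _ M₂ _ _ _ _ f g h
    exact h₁.of_linearEquiv (LinearEquiv.ofBijective f
      ⟨h.inj, fun x => (h.exact x).1 (Subsingleton.elim _ _)⟩)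
  · intro M₃' M₃ _ _ _ _ _ _ _ _ l U _ _ f' g' hl hU h' h₃' ih M₂ _ _ _ _ f g h
    have hs : SES (LinearMap.ker (g' ∘ₗ g)).subtype (g' ∘ₗ g) :=
      .of_ker (h'.surj.comp h.surj)
    refine TildeFiltered.snoc hl hU hs ?_
    obtain ⟨g₀, hg₀⟩ := h'.factor_left (g ∘ₗ (LinearMap.ker (g' ∘ₗ g)).subtype) (by
      rw [← LinearMap.comp_assoc, hs.comp_eq_zero])
    obtain ⟨f₀, hf₀⟩ := hs.factor_left f (by
      rw [LinearMap.comp_assoc, h.comp_eq_zero, LinearMap.comp_zero])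
    have hg₀' := LinearMap.congr_fun hg₀
    have hf₀' := LinearMap.congr_fun hf₀
    simp only [LinearMap.comp_apply, Submodule.subtype_apply] at hg₀' hf₀'
    refine ih _ f₀ g₀ ⟨?_, ?_, ?_⟩
    · exact Function.Injective.of_comp (f := Subtype.val)
        (by rw [show Subtype.val ∘ f₀ = f from funext hf₀']; exact h.inj)
    · intro y
      obtain ⟨x, hx⟩ := h.surj (f' y)
      refine ⟨⟨x, by simp [hx, h'.exact.apply_apply_eq_zero]⟩, h'.inj ?_⟩
      rw [hg₀', hx]
    · intro x
      rw [← h'.inj.eq_iff, hg₀', map_zero, h.exact]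
      constructor
      · rintro ⟨y, hy⟩
        exact ⟨y, Subtype.ext ((hf₀' y).trans hy)⟩
      · rintro ⟨y, rfl⟩
        exact ⟨y, (hf₀' y).symm⟩

lemma TildeFiltered.prod {M₁ : Type u} [AddCommGroup M₁] [Module R M₁] [Module A M₁]
    [IsScalarTower R A M₁] (h₁ : TildeFiltered R A X S M₁) (h₂ : TildeFiltered R A X S M₂) :
    TildeFiltered R A X S (M₁ × M₂) := h₁.extension .inl_snd h₂

lemma TildeFiltered.standard_tensor {l : Λ} (hl : l ∈ S) {U : Type u} [AddCommGroup U] [Module R U]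
    (hU : FP R U) : TildeFiltered R A X S (X l ⊗[R] U) :=
  .snoc (f := (0 : PUnit.{u + 1} →ₗ[A] _)) (g := LinearMap.id) hl hU
    ⟨fun _ _ _ => Subsingleton.elim _ _, Function.surjective_id, fun x => by
      simp [eq_comm]⟩ .of_subsingleton

lemma TildeFiltered.standard {l : Λ} (hl : l ∈ S) : TildeFiltered R A X S (X l) :=
  (TildeFiltered.standard_tensor (U := R) hl ⟨inferInstance, inferInstance⟩).of_linearEquiv
    (TensorProduct.AlgebraTensorModule.rid R A (X l))

lemma TildeFiltered.subsingleton (h : TildeFiltered R A X ∅ M) : Subsingleton M := by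
  refine TildeFiltered.induction (S := ∅) (X := X) (motive := fun M _ _ _ _ => Subsingleton M)
    (fun M => inferInstance) ?_ h
  intro M' M _ _ _ _ _ _ _ _ l U _ _ f g hl
  exact absurd hl (Set.notMem_empty l)

lemma TildeFiltered.fp (hX : ∀ l ∈ S, FP R (X l)) (h : TildeFiltered R A X S M) : FP R M := by
  refine TildeFiltered.induction (X := X) (S := S) (motive := fun M _ _ _ _ => FP R M)
    (fun M => .of_subsingleton) ?_ h
  intro M' M _ _ _ _ _ _ _ _ l U _ _ f g hl hU h _ ih
  exact h.fp₂ ih ((hX l hl).tensor hU)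

end Filtrations

/-! ### Tensor products with finitely generated projective modules -/

section Tensor

variable {R : Type*} [CommRing R] {A : Type*} [Ring A] [Algebra R A]

/-- The dual basis lemma. -/
lemma FP.exists_dualBasis {U : Type*} [AddCommGroup U] [Module R U] (hU : FP R U) :
    ∃ (n : ℕ) (u : Fin n → U) (φ : Fin n → U →ₗ[R] R), ∀ y, ∑ k, φ k y • u k = y := by
  have := hU.finite
  obtain ⟨n, f, hf⟩ := Module.Finite.exists_fin' R U
  obtain ⟨s, hs⟩ := FP.exists_section hf hU
  refine ⟨n, fun k => f (Pi.single k 1), fun k => LinearMap.proj k ∘ₗ s, fun y => ?_⟩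
  have h3 : ∑ k, s y k • Pi.single (M := fun _ => R) k 1 = s y := by
    ext j; simp [Finset.sum_apply, Pi.single_apply]
  have h4 : f (s y) = y := LinearMap.congr_fun hs y
  rw [← h3] at h4
  simp only [map_sum, map_smul] at h4
  exact h4

/-- The map `M ⊗ U → M` given by a linear form on `U`. -/
def contract (A M : Type*) [Ring A] [Algebra R A] [AddCommGroup M] [Module R M] [Module A M]
    [IsScalarTower R A M] {U : Type*} [AddCommGroup U] [Module R U] (φ : U →ₗ[R] R) :
    M ⊗[R] U →ₗ[A] M :=
  (TensorProduct.AlgebraTensorModule.rid R A M).toLinearMap ∘ₗ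
    TensorProduct.AlgebraTensorModule.lTensor A M φ

@[simp]
lemma contract_tmul {M : Type*} [AddCommGroup M] [Module R M] [Module A M]
    [IsScalarTower R A M] {U : Type*} [AddCommGroup U] [Module R U] (φ : U →ₗ[R] R) (x : M)
    (y : U) : contract A M φ (x ⊗ₜ y) = φ y • x := by
  simp [contract]

lemma sum_contract_tmul {M : Type*} [AddCommGroup M] [Module R M] [Module A M]
    [IsScalarTower R A M] {U : Type*} [AddCommGroup U] [Module R U] {n : ℕ} {u : Fin n → U}
    {φ : Fin n → U →ₗ[R] R} (h : ∀ y, ∑ k, φ k y • u k = y) (z : M ⊗[R] U) :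
    ∑ k, contract A M (φ k) z ⊗ₜ[R] u k = z := by
  induction z with
  | zero => simp
  | tmul x y =>
    simp only [contract_tmul, TensorProduct.smul_tmul]
    rw [← TensorProduct.tmul_sum, h]
  | add z w hz hw =>
    simp only [map_add, TensorProduct.add_tmul, Finset.sum_add_distrib, hz, hw]

/-- For a finitely generated projective `R`-module `U`, the module `M ⊗ U` is a direct summand of
a finite power of `M`. -/
lemma exists_retract_tensor (M : Type*) [AddCommGroup M] [Module R M] [Module A M]
    [IsScalarTower R A M] {U : Type*} [AddCommGroup U] [Module R U] (hU : FP R U) :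
    ∃ (n : ℕ) (i : M ⊗[R] U →ₗ[A] (Fin n → M)) (p : (Fin n → M) →ₗ[A] M ⊗[R] U),
      p ∘ₗ i = LinearMap.id := by
  obtain ⟨n, u, φ, h⟩ := hU.exists_dualBasis
  refine ⟨n, LinearMap.pi fun k => contract A M (φ k),
    ∑ k, (((TensorProduct.AlgebraTensorModule.mk R A M U).flip (u k)) ∘ₗ LinearMap.proj k), ?_⟩
  refine LinearMap.ext fun z => ?_
  rw [LinearMap.comp_apply, LinearMap.sum_apply]
  exact sum_contract_tmul h z

variable {M₁ M₂ M₃ : Type*} [AddCommGroup M₁] [Module R M₁] [Module A M₁] [IsScalarTower R A M₁]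
  [AddCommGroup M₂] [Module R M₂] [Module A M₂] [IsScalarTower R A M₂]
  [AddCommGroup M₃] [Module R M₃] [Module A M₃] [IsScalarTower R A M₃]

lemma SES.tensor {f : M₁ →ₗ[A] M₂} {g : M₂ →ₗ[A] M₃} (h : SES f g) {U : Type*} [AddCommGroup U]
    [Module R U] (hU : FP R U) :
    SES (TensorProduct.AlgebraTensorModule.rTensor R U f)
      (TensorProduct.AlgebraTensorModule.rTensor R U g) := by
  have := hU.projective
  refine ⟨?_, ?_, ?_⟩
  · exact Module.Flat.rTensor_preserves_injective_linearMap (M := U) (f.restrictScalars R) h.inj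
  · exact LinearMap.rTensor_surjective U (g := g.restrictScalars R) h.surj
  · exact rTensor_exact (f := f.restrictScalars R) (g := g.restrictScalars R) U h.exact h.surj

lemma SES.fin_cons {A : Type*} [Ring A] {n : ℕ} (M : Fin (n + 1) → Type*)
    [∀ k, AddCommGroup (M k)] [∀ k, Module A (M k)] :
    SES (LinearMap.single A M 0)
      (LinearMap.pi fun k : Fin n => LinearMap.proj (φ := M) k.succ) := by
  refine ⟨Pi.single_injective _, fun x => ⟨Fin.cons 0 x, ?_⟩, fun x => ⟨fun h => ⟨x 0, ?_⟩, ?_⟩⟩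
  · ext k; simp
  · ext k
    refine Fin.cases ?_ (fun k => ?_) k
    · simp
    · simpa using (congrFun h k).symm
  · rintro ⟨y, rfl⟩
    ext k
    simp

end Tensor

/-! ### Permanence properties of filtered modules -/

section FiltrationsTensor

variable {R : Type u} [CommRing R] {A : Type u} [Ring A] [Algebra R A] {Λ : Type w}
  {X : Λ → Type u} [∀ l, AddCommGroup (X l)] [∀ l, Module R (X l)]
  [∀ l, Module A (X l)] [∀ l, IsScalarTower R A (X l)] {S : Set Λ}

lemma TildeFiltered.tensor {M : Type u} [AddCommGroup M] [Module R M] [Module A M]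
    [IsScalarTower R A M] (h : TildeFiltered R A X S M) {V : Type u} [AddCommGroup V] [Module R V]
    (hV : FP R V) : TildeFiltered R A X S (M ⊗[R] V) := by
  refine TildeFiltered.induction (X := X) (S := S)
    (motive := fun M _ _ _ _ => TildeFiltered R A X S (M ⊗[R] V)) ?_ ?_ h
  · intro M _ _ _ _ _
    have : Subsingleton (M ⊗[R] V) := inferInstance
    exact .of_subsingleton
  · intro M' M _ _ _ _ _ _ _ _ l U _ _ f g hl hU h _ ih
    exact .snoc hl (hU.tensor hV)
      ((h.tensor hV).comp_equiv (TensorProduct.AlgebraTensorModule.assoc R R A (X l) U V)) ih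

lemma TildeFiltered.pi {n : ℕ} (M : Fin n → Type u) [∀ k, AddCommGroup (M k)]
    [∀ k, Module R (M k)] [∀ k, Module A (M k)] [∀ k, IsScalarTower R A (M k)]
    (h : ∀ k, TildeFiltered R A X S (M k)) : TildeFiltered R A X S (∀ k, M k) := by
  induction n with
  | zero => exact .of_subsingleton
  | succ n ih => exact (h 0).extension (.fin_cons M) (ih _ fun k => h k.succ)

lemma ExtVanishes.pi_left {n : ℕ} {M L : Type u} [AddCommGroup M] [Module A M] [AddCommGroup L]
    [Module A L] {i : ℕ} (h : ExtVanishes A M L i) : ExtVanishes A (Fin n → M) L i := by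
  induction n with
  | zero => exact extVanishes_of_subsingleton_left _ _ _
  | succ n ih => exact (SES.fin_cons fun _ => M).extVanishes_left h ih

lemma ExtVanishes.pi_right {n : ℕ} {M L : Type u} [AddCommGroup M] [Module A M] [AddCommGroup L]
    [Module A L] {i : ℕ} (h : ExtVanishes A L M i) : ExtVanishes A L (Fin n → M) i := by
  induction n with
  | zero => exact extVanishes_of_subsingleton_right _ _ _
  | succ n ih => exact (SES.fin_cons fun _ => M).extVanishes_right h ih

lemma ExtVanishes.tensor_left {M L : Type u} [AddCommGroup M] [Module R M] [Module A M]
    [IsScalarTower R A M] [AddCommGroup L] [Module A L] {i : ℕ} (h : ExtVanishes A M L i)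
    {U : Type u} [AddCommGroup U] [Module R U] (hU : FP R U) :
    ExtVanishes A (M ⊗[R] U) L i := by
  obtain ⟨n, j, p, hp⟩ := exists_retract_tensor (A := A) M hU
  exact ExtVanishes.of_retract_left h.pi_left j p hp

lemma ExtVanishes.tensor_right {M L : Type u} [AddCommGroup M] [Module R M] [Module A M]
    [IsScalarTower R A M] [AddCommGroup L] [Module A L] {i : ℕ} (h : ExtVanishes A L M i)
    {U : Type u} [AddCommGroup U] [Module R U] (hU : FP R U) :
    ExtVanishes A L (M ⊗[R] U) i := by
  obtain ⟨n, j, p, hp⟩ := exists_retract_tensor (A := A) M hU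
  exact ExtVanishes.of_retract_right h.pi_right j p hp

lemma TildeFiltered.extVanishes_left {M L : Type u} [AddCommGroup M] [Module R M] [Module A M]
    [IsScalarTower R A M] [AddCommGroup L] [Module A L] {i : ℕ} (h : TildeFiltered R A X S M)
    (hX : ∀ l ∈ S, ExtVanishes A (X l) L i) : ExtVanishes A M L i := by
  refine TildeFiltered.induction (X := X) (S := S)
    (motive := fun M _ _ _ _ => ExtVanishes A M L i) ?_ ?_ h
  · intro M _ _ _ _ _
    exact extVanishes_of_subsingleton_left _ _ _
  · intro M' M _ _ _ _ _ _ _ _ l U _ _ f g hl hU h _ ih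
    exact h.extVanishes_left ih ((hX l hl).tensor_left hU)

lemma TildeFiltered.extVanishes_right {M L : Type u} [AddCommGroup M] [Module R M] [Module A M]
    [IsScalarTower R A M] [AddCommGroup L] [Module A L] {i : ℕ} (h : TildeFiltered R A X S M)
    (hX : ∀ l ∈ S, ExtVanishes A L (X l) i) : ExtVanishes A L M i := by
  refine TildeFiltered.induction (X := X) (S := S)
    (motive := fun M _ _ _ _ => ExtVanishes A L M i) ?_ ?_ h
  · intro M _ _ _ _ _
    exact extVanishes_of_subsingleton_right _ _ _
  · intro M' M _ _ _ _ _ _ _ _ l U _ _ f g hl hU h _ ih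
    exact h.extVanishes_right ih ((hX l hl).tensor_right hU)

lemma exists_directSum_equiv_pi {A : Type*} [Ring A] [Finite Λ] (M : Λ → Type*)
    [∀ l, AddCommGroup (M l)] [∀ l, Module A (M l)] :
    ∃ (n : ℕ) (e : Fin n ≃ Λ), Nonempty ((DirectSum Λ fun l => M l) ≃ₗ[A] ∀ k, M (e k)) := by
  classical
  have := Fintype.ofFinite Λ
  obtain ⟨n, ⟨e⟩⟩ := Finite.exists_equiv_fin Λ
  exact ⟨n, e.symm, ⟨DirectSum.linearEquivFunOnFintype A Λ M ≪≫ₗ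
    (LinearEquiv.piCongrLeft A M e.symm).symm⟩⟩

end FiltrationsTensor

/-! ### Extensions of extensions and the horseshoe lemma -/

section Splicing

variable {A : Type u} [Ring A]

lemma SES.apply_apply {M₁ M₂ M₃ : Type*} [AddCommGroup M₁] [AddCommGroup M₂]
    [AddCommGroup M₃] [Module A M₁] [Module A M₂] [Module A M₃]
    {f : M₁ →ₗ[A] M₂} {g : M₂ →ₗ[A] M₃} (h : SES f g) (x : M₁) : g (f x) = 0 :=
  h.exact.apply_apply_eq_zero x

variable {X' X Z B C B' C' B'' C'' L : Type*}
  [AddCommGroup X'] [AddCommGroup X] [AddCommGroup Z] [AddCommGroup B] [AddCommGroup C]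
  [AddCommGroup B'] [AddCommGroup C'] [AddCommGroup B''] [AddCommGroup C''] [AddCommGroup L]
  [Module A X'] [Module A X] [Module A Z] [Module A B] [Module A C] [Module A B'] [Module A C']
  [Module A B''] [Module A C''] [Module A L]
  {f : X' →ₗ[A] X} {g : X →ₗ[A] Z}

/-- If `X = X' ⊕ Z` and `X'` is an extension of `C` by `B`, then `X` is an extension of `C` by
`B ⊕ Z`. -/
lemma SES.coprod_section (h : SES f g) {s : Z →ₗ[A] X} (hs : g ∘ₗ s = LinearMap.id)
    {j : B →ₗ[A] X'} {q : X' →ₗ[A] C} (h' : SES j q) :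
    ∃ q' : X →ₗ[A] C, SES ((f ∘ₗ j).coprod s) q' := by
  obtain ⟨r, hrf, hr⟩ := h.exists_retraction s hs
  have hs' : ∀ z, g (s z) = z := LinearMap.congr_fun hs
  have hrf' : ∀ z, r (f z) = z := LinearMap.congr_fun hrf
  have hr' : ∀ x, f (r x) + s (g x) = x := LinearMap.congr_fun hr
  have hrs : ∀ z, r (s z) = 0 := fun z => h.inj (by
    have := hr' (s z)
    rwa [hs', add_eq_right, ← map_zero f] at this)
  refine ⟨q ∘ₗ r, ?_, ?_, ?_⟩
  · rw [← LinearMap.ker_eq_bot, LinearMap.ker_eq_bot']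
    rintro ⟨b, z⟩ hbz
    simp only [LinearMap.coprod_apply, LinearMap.comp_apply] at hbz
    have hz : z = 0 := by
      have := congrArg g hbz
      simpa [h.apply_apply, hs'] using this
    subst hz
    have hb : b = 0 := h'.inj (h.inj (by simpa using hbz))
    simp [hb]
  · exact h'.surj.comp fun x => ⟨f x, hrf' x⟩
  · intro x
    constructor
    · intro hx
      obtain ⟨b, hb⟩ := (h'.exact _).1 hx
      exact ⟨(b, g x), by simp [hb, hr']⟩
    · rintro ⟨⟨b, z⟩, rfl⟩
      simp [hrf', hrs, h'.apply_apply]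

/-- A map `P` on `X` which is onto already on `X'` has a kernel that is an extension of `Z` by
the kernel of its restriction. -/
lemma SES.ker_extension (h : SES f g) {k : B →ₗ[A] X'} {p : X' →ₗ[A] C} (h' : SES k p)
    {P : X →ₗ[A] C} (hP : P ∘ₗ f = p) :
    Function.Surjective P ∧
      ∃ α : B →ₗ[A] LinearMap.ker P, SES α (g ∘ₗ (LinearMap.ker P).subtype) := by
  have hP' : ∀ x, P (f x) = p x := LinearMap.congr_fun hP
  refine ⟨fun c => ?_, ?_⟩
  · obtain ⟨x, rfl⟩ := h'.surj c
    exact ⟨f x, hP' x⟩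
  refine ⟨(f ∘ₗ k).codRestrict _ fun b => by simp [hP', h'.apply_apply], ?_, ?_, ?_⟩
  · intro a b hab
    exact h'.inj (h.inj (congrArg Subtype.val hab))
  · intro z
    obtain ⟨x, rfl⟩ := h.surj z
    obtain ⟨x', hx'⟩ := h'.surj (P x)
    exact ⟨⟨x - f x', by simp [hP', hx']⟩, by simp [h.apply_apply]⟩
  · rintro ⟨x, hx⟩
    constructor
    · intro hgx
      obtain ⟨x', rfl⟩ := (h.exact x).1 hgx
      obtain ⟨b, rfl⟩ := (h'.exact x').1 (by rw [← hP']; exact hx)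
      exact ⟨b, rfl⟩
    · rintro ⟨b, hb⟩
      have : x = f (k b) := (congrArg Subtype.val hb).symm
      simp [this, h.apply_apply]

/-- In the situation of `SES.ker_extension`, `(P, g)` maps `X` onto `C × Z`. -/
lemma SES.prod_extension (h : SES f g) {k : B →ₗ[A] X'} {p : X' →ₗ[A] C} (h' : SES k p)
    {P : X →ₗ[A] C} (hP : P ∘ₗ f = p) : SES (f ∘ₗ k) (P.prod g) := by
  have hP' : ∀ x, P (f x) = p x := LinearMap.congr_fun hP
  refine ⟨h.inj.comp h'.inj, ?_, ?_⟩
  · rintro ⟨c, z⟩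
    obtain ⟨x, rfl⟩ := h.surj z
    obtain ⟨x', hx'⟩ := h'.surj (c - P x)
    exact ⟨x + f x', by simp [hP', hx', h.apply_apply]⟩
  · intro x
    constructor
    · intro hx
      have hx₁ : P x = 0 := congrArg Prod.fst hx
      have hx₂ : g x = 0 := congrArg Prod.snd hx
      obtain ⟨x', rfl⟩ := (h.exact x).1 hx₂
      obtain ⟨b, rfl⟩ := (h'.exact x').1 (by rw [← hP']; exact hx₁)
      exact ⟨b, rfl⟩
    · rintro ⟨b, rfl⟩
      simp [hP', h.apply_apply, h'.apply_apply]

/-- Horseshoe lemma for embeddings: the embeddings `X' → B'` and `Z → B''` give an embedding of `X`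
into `B' × B''`, if the former one extends to `X`. -/
lemma SES.horseshoe_embedding (h : SES f g) {j' : X' →ₗ[A] B'} {c' : B' →ₗ[A] C'} (h' : SES j' c')
    {j'' : Z →ₗ[A] B''} {c'' : B'' →ₗ[A] C''} (h'' : SES j'' c'') {s : X →ₗ[A] B'}
    (hs : s ∘ₗ f = j') :
    Function.Injective (s.prod (j'' ∘ₗ g)) ∧
      ∃ (α : C' →ₗ[A] (B' × B'') ⧸ LinearMap.range (s.prod (j'' ∘ₗ g)))
        (β : ((B' × B'') ⧸ LinearMap.range (s.prod (j'' ∘ₗ g))) →ₗ[A] C''), SES α β := by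
  have hs' : ∀ x, s (f x) = j' x := LinearMap.congr_fun hs
  have hinj : Function.Injective (s.prod (j'' ∘ₗ g)) := by
    rw [← LinearMap.ker_eq_bot, LinearMap.ker_eq_bot']
    intro x hx
    have hx₁ : s x = 0 := congrArg Prod.fst hx
    have hx₂ : j'' (g x) = 0 := congrArg Prod.snd hx
    obtain ⟨x', rfl⟩ := (h.exact x).1 (h''.inj (by rw [hx₂, map_zero]))
    have : x' = 0 := h'.inj (by rw [← hs', hx₁, map_zero])
    rw [this, map_zero]
  refine ⟨hinj, ?_⟩
  have hJ := SES.of_range hinj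
  set J := s.prod (j'' ∘ₗ g)
  set q := (LinearMap.range J).mkQ
  have hJa : ∀ x, J x = (s x, j'' (g x)) := fun x => rfl
  obtain ⟨α, hα⟩ := h'.factor_right (q ∘ₗ LinearMap.inl A B' B'') (by
    ext x
    have : LinearMap.inl A B' B'' (j' x) = J (f x) := by simp [hJa, hs', h.apply_apply]
    simp only [LinearMap.comp_apply, this, hJ.apply_apply, LinearMap.zero_apply])
  obtain ⟨β, hβ⟩ := hJ.factor_right (c'' ∘ₗ LinearMap.snd A B' B'') (by
    ext x
    simp [hJa, h''.apply_apply])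
  have hα' : ∀ t, α (c' t) = q (t, 0) := LinearMap.congr_fun hα
  have hβ' : ∀ t, β (q t) = c'' t.2 := LinearMap.congr_fun hβ
  refine ⟨α, β, ?_, ?_, ?_⟩
  · rw [← LinearMap.ker_eq_bot, LinearMap.ker_eq_bot']
    intro c hc
    obtain ⟨t, rfl⟩ := h'.surj c
    rw [hα'] at hc
    obtain ⟨x, hx⟩ := (hJ.exact _).1 hc
    rw [hJa, Prod.mk.injEq] at hx
    obtain ⟨x', rfl⟩ := (h.exact x).1 (h''.inj (by rw [hx.2, map_zero]))
    rw [← hx.1, hs', h'.apply_apply]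
  · intro c
    obtain ⟨t, rfl⟩ := h''.surj c
    exact ⟨q (0, t), hβ' _⟩
  · intro y
    obtain ⟨⟨t, t''⟩, rfl⟩ := hJ.surj y
    constructor
    · intro hy
      rw [hβ'] at hy
      obtain ⟨z, hz⟩ := (h''.exact _).1 hy
      obtain ⟨x, rfl⟩ := h.surj z
      refine ⟨c' (t - s x), ?_⟩
      rw [hα', ← sub_eq_zero, ← map_sub]
      refine (hJ.exact _).2 ⟨-x, ?_⟩
      simp only at hz
      simp [hJa, hz]
    · rintro ⟨c, hc⟩
      obtain ⟨b, rfl⟩ := h'.surj c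
      rw [← hc, hα', hβ']
      simp

/-- Horseshoe lemma for surjections: the surjections `B' → X'` and `B'' → Z` give a surjection of
`B' × B''` onto `X`, if the latter one lifts to `X`. -/
lemma SES.horseshoe_surjection (h : SES f g) {k' : C' →ₗ[A] B'} {t' : B' →ₗ[A] X'}
    (h' : SES k' t') {k'' : C'' →ₗ[A] B''} {t'' : B'' →ₗ[A] Z} (h'' : SES k'' t'')
    {s : B'' →ₗ[A] X} (hs : g ∘ₗ s = t'') :
    Function.Surjective ((f ∘ₗ t').coprod s) ∧
      ∃ (α : C' →ₗ[A] LinearMap.ker ((f ∘ₗ t').coprod s))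
        (β : LinearMap.ker ((f ∘ₗ t').coprod s) →ₗ[A] C''), SES α β := by
  have hs' : ∀ x, g (s x) = t'' x := LinearMap.congr_fun hs
  have hsurj : Function.Surjective ((f ∘ₗ t').coprod s) := by
    intro x
    obtain ⟨b, hb⟩ := h''.surj (g x)
    obtain ⟨x', hx'⟩ := (h.exact (x - s b)).1 (by rw [map_sub, hs', hb, sub_self])
    obtain ⟨b', rfl⟩ := h'.surj x'
    exact ⟨(b', b), by simp [hx']⟩
  refine ⟨hsurj, ?_⟩
  set J := (f ∘ₗ t').coprod s
  have hJa : ∀ x, J x = f (t' x.1) + s x.2 := fun x => rfl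
  obtain ⟨β, hβ⟩ := h''.factor_left (LinearMap.snd A B' B'' ∘ₗ (LinearMap.ker J).subtype) (by
    ext ⟨x, hx⟩
    have : g (J x) = 0 := by rw [LinearMap.mem_ker.1 hx, map_zero]
    rw [hJa, map_add, h.apply_apply, zero_add, hs'] at this
    exact this)
  have hβ' : ∀ x : LinearMap.ker J, k'' (β x) = x.1.2 := LinearMap.congr_fun hβ
  refine ⟨(LinearMap.inl A B' B'' ∘ₗ k').codRestrict _ fun b => by
    simp [hJa, h'.apply_apply], β, ?_, ?_, ?_⟩
  · intro a b hab
    exact h'.inj (congrArg (fun x => x.1.1) hab)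
  · intro c
    obtain ⟨x', hx'⟩ := (h.exact (s (k'' c))).1 (by rw [hs', h''.apply_apply])
    obtain ⟨b', rfl⟩ := h'.surj x'
    exact ⟨⟨(-b', k'' c), by simp [hJa, hx']⟩, h''.inj (hβ' _)⟩
  · intro x
    rw [← h''.inj.eq_iff, hβ', map_zero]
    obtain ⟨⟨b', b''⟩, hx⟩ := x
    constructor
    · rintro rfl
      obtain ⟨c, rfl⟩ := (h'.exact b').1 (h.inj (by simpa [hJa] using hx))
      exact ⟨c, rfl⟩
    · rintro ⟨c, hc⟩
      exact congrArg (fun x => x.1.2) hc.symm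

end Splicing

/-! ### Modules of homomorphisms and the evaluation map -/

section Hom

variable {R : Type*} [CommRing R] {A : Type*} [Ring A] [Algebra R A]

variable {P D D' M M' : Type*} [AddCommGroup P] [Module A P]
  [AddCommGroup D] [Module R D] [Module A D] [IsScalarTower R A D]
  [AddCommGroup D'] [Module R D'] [Module A D'] [IsScalarTower R A D']
  [AddCommGroup M] [Module R M] [Module A M] [IsScalarTower R A M]
  [AddCommGroup M'] [Module R M'] [Module A M'] [IsScalarTower R A M']

/-- For a retract `P` of `Q`, `Hom(P, M)` is a retract of `Hom(Q, M)`. -/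
lemma FP.hom_of_retract {Q : Type*} [AddCommGroup Q] [Module A Q] (i : P →ₗ[A] Q) (p : Q →ₗ[A] P)
    (hp : p ∘ₗ i = LinearMap.id) (h : FP R (Q →ₗ[A] M)) : FP R (P →ₗ[A] M) :=
  h.of_retract (LinearMap.lcomp R M p) (LinearMap.lcomp R M i) (by
    ext φ x
    have : p (i x) = x := LinearMap.congr_fun hp x
    simp [this])

lemma FP.hom_of_retract_right (i : M' →ₗ[A] M) (p : M →ₗ[A] M')
    (hp : p ∘ₗ i = LinearMap.id) (h : FP R (P →ₗ[A] M)) : FP R (P →ₗ[A] M') :=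
  h.of_retract (LinearMap.compRight R i) (LinearMap.compRight R p) (by
    ext φ x
    exact LinearMap.congr_fun hp (φ x))

lemma FP.hom_pi {n : ℕ} (h : FP R (P →ₗ[A] M)) : FP R ((Fin n → P) →ₗ[A] M) :=
  (FP.pi (ι := Fin n) h).of_equiv (LinearMap.lsum A (fun _ => P) R)

lemma FP.hom_of_projective [Module.Finite A P] [Module.Projective A P] (hM : FP R M) :
    FP R (P →ₗ[A] M) := by
  obtain ⟨n, f, hf⟩ := Module.Finite.exists_fin' A P
  obtain ⟨s, hs⟩ := Module.projective_lifting_property f LinearMap.id hf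
  exact FP.hom_of_retract s f hs
    (FP.hom_pi (hM.of_equiv (LinearMap.ringLmapEquivSelf A R M).symm))

/-- The map `H → Hom(D, D' ⊗ H)` induced by `γ : D → D'`. -/
def tensorHom (R : Type*) [CommRing R] {A : Type*} [Ring A] [Algebra R A] {D D' : Type*}
    [AddCommGroup D] [Module R D] [Module A D] [IsScalarTower R A D]
    [AddCommGroup D'] [Module R D'] [Module A D'] [IsScalarTower R A D']
    (γ : D →ₗ[A] D') (H : Type*) [AddCommGroup H] [Module R H] :
    H →ₗ[R] (D →ₗ[A] D' ⊗[R] H) where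
  toFun h := (TensorProduct.AlgebraTensorModule.mk R A D' H).flip h ∘ₗ γ
  map_add' a b := by ext x; simp
  map_smul' r a := by ext x; simp

@[simp]
lemma tensorHom_apply (γ : D →ₗ[A] D') {H : Type*} [AddCommGroup H] [Module R H] (h : H) (x : D) :
    tensorHom R γ H h x = γ x ⊗ₜ h := rfl

/-- If `γ` is a basis of the `R`-module `Hom(D, D')`, then `H ≅ Hom(D, D' ⊗ H)`. -/
lemma tensorHom_bijective {γ : D →ₗ[A] D'} (hγ : Function.Bijective fun r : R => r • γ)
    {H : Type*} [AddCommGroup H] [Module R H] (hH : FP R H) :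
    Function.Bijective (tensorHom R γ H) := by
  obtain ⟨n, u, φ, hu⟩ := hH.exists_dualBasis
  constructor
  · rw [← LinearMap.ker_eq_bot, LinearMap.ker_eq_bot']
    intro h hh
    have : ∀ k, φ k h = 0 := fun k => hγ.1 (by
      ext x
      have := congrArg (contract A D' (φ k)) (LinearMap.congr_fun hh x)
      rw [tensorHom_apply, contract_tmul, LinearMap.zero_apply, map_zero] at this
      simpa using this)
    rw [← hu h]
    simp [this]
  · intro ψ
    have : ∀ k, ∃ r : R, r • γ = contract A D' (φ k) ∘ₗ ψ := fun k => hγ.2 _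
    choose r hr using this
    refine ⟨∑ k, r k • u k, ?_⟩
    ext x
    rw [← sum_contract_tmul (A := A) hu (ψ x)]
    have hr' : ∀ k, contract A D' (φ k) (ψ x) = r k • γ x := fun k =>
      (LinearMap.congr_fun (hr k) x).symm
    simp only [hr', tensorHom_apply, TensorProduct.tmul_sum, TensorProduct.smul_tmul]

/-- The evaluation map `D ⊗ Hom(D, M) → M`. -/
def traceMap (R : Type*) [CommRing R] (A : Type*) [Ring A] [Algebra R A] (D M : Type*)
    [AddCommGroup D] [Module R D] [Module A D] [IsScalarTower R A D]
    [AddCommGroup M] [Module R M] [Module A M] [IsScalarTower R A M] :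
    D ⊗[R] (D →ₗ[A] M) →ₗ[A] M :=
  TensorProduct.AlgebraTensorModule.lift
    { toFun := fun x =>
        { toFun := fun f => f x
          map_add' := fun _ _ => rfl
          map_smul' := fun _ _ => rfl }
      map_add' := fun x y => by ext f; simp
      map_smul' := fun a x => by ext f; simp }

@[simp]
lemma traceMap_tmul (x : D) (f : D →ₗ[A] M) : traceMap R A D M (x ⊗ₜ f) = f x := rfl

lemma traceMap_natural (f : M →ₗ[A] M') :
    f ∘ₗ traceMap R A D M = traceMap R A D M' ∘ₗ
      TensorProduct.AlgebraTensorModule.lTensor A D (LinearMap.compRight R f) := by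
  apply TensorProduct.AlgebraTensorModule.curry_injective
  ext x φ
  simp

lemma AlgebraTensorModule_hom_ext {H : Type*} [AddCommGroup H] [Module R H]
    {f g : D ⊗[R] H →ₗ[A] M} (h : ∀ x y, f (x ⊗ₜ y) = g (x ⊗ₜ y)) : f = g := by
  apply TensorProduct.AlgebraTensorModule.curry_injective
  ext x y
  exact h x y

lemma lTensor_injective_of_leftInverse {H H' : Type*} [AddCommGroup H] [Module R H]
    [AddCommGroup H'] [Module R H'] {s : H →ₗ[R] H'} {r : H' →ₗ[R] H}
    (h : r ∘ₗ s = LinearMap.id) :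
    Function.Injective (TensorProduct.AlgebraTensorModule.lTensor A D s) := by
  refine Function.LeftInverse.injective (g := LinearMap.lTensor D r) fun x => ?_
  change LinearMap.lTensor D r (LinearMap.lTensor D s x) = x
  rw [← LinearMap.comp_apply, ← LinearMap.lTensor_comp, h, LinearMap.lTensor_id, LinearMap.id_apply]

end Hom

/-! ### Standard modules, costandard modules and tilting families -/

section HighestWeight

variable {R : Type u} [CommRing R] {A : Type u} [Ring A] [Algebra R A] {Λ : Type w}
  [PartialOrder Λ]
  {Δ : Λ → Type u} [∀ l, AddCommGroup (Δ l)] [∀ l, Module R (Δ l)]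
  [∀ l, Module A (Δ l)] [∀ l, IsScalarTower R A (Δ l)]
  {N : Λ → Type u} [∀ l, AddCommGroup (N l)] [∀ l, Module R (N l)]
  [∀ l, Module A (N l)] [∀ l, IsScalarTower R A (N l)]
  {T : Λ → Type u} [∀ l, AddCommGroup (T l)] [∀ l, Module R (T l)]
  [∀ l, Module A (T l)] [∀ l, IsScalarTower R A (T l)]
  {M : Type u} [AddCommGroup M] [Module R M] [Module A M] [IsScalarTower R A M]
  {S : Set Λ} {l m : Λ}

variable (A Δ) in
/-- `Hom(Δ m, M) = 0` for all `m` outside `S`. -/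
def VanishesOff (S : Set Λ) (M : Type u) [AddCommGroup M] [Module A M] : Prop :=
  ∀ m ∉ S, ExtVanishes A (Δ m) M 0

lemma IsSplitQuasiHereditary.fp_standard (hΔ : IsSplitQuasiHereditary R A Δ) (l : Λ) :
    FP R (Δ l) := by
  have := hΔ.finite_algebra
  have := hΔ.finite_standard l
  exact ⟨Module.Finite.trans A (Δ l), hΔ.projective_standard l⟩

lemma IsSplitQuasiHereditary.standard_hom_vanishes (hΔ : IsSplitQuasiHereditary R A Δ)
    (h : ¬ l ≤ m) : ExtVanishes A (Δ l) (Δ m) 0 :=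
  extVanishes_zero_iff.2 fun f => by_contra fun hf => h (hΔ.le_of_hom_ne_zero l m ⟨f, hf⟩)

lemma IsSplitQuasiHereditary.exists_projective (hΔ : IsSplitQuasiHereditary R A Δ) (l : Λ) :
    ∃ (P : Type u) (_ : AddCommGroup P) (_ : Module R P) (_ : Module A P)
      (_ : IsScalarTower R A P) (π : P →ₗ[A] Δ l), Module.Finite A P ∧ Module.Projective A P ∧
      Function.Surjective π ∧ TildeFiltered R A Δ (Set.Ioi l) (LinearMap.ker π) := by
  obtain ⟨P, hP, -⟩ := hΔ.exists_projectives
  obtain ⟨h₁, h₂, π, h₃, h₄⟩ := hP l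
  exact ⟨P l, inferInstance, Module.compHom (P l) (algebraMap R A), inferInstance,
    .of_compHom R A _, π, h₁, h₂, h₃, h₄⟩

/-- If the weights of `M` do not exceed `l`, then `Δ l` is projective relative to `M`. -/
lemma VanishesOff.extVanishes_one {M : Type u} [AddCommGroup M] [Module A M]
    (hΔ : IsSplitQuasiHereditary R A Δ) (hM : VanishesOff A Δ S M)
    (hS : ∀ m, l < m → m ∉ S) : ExtVanishes A (Δ l) M 1 := by
  obtain ⟨P, _, _, _, _, π, h₁, h₂, h₃, h₄⟩ := hΔ.exists_projective l
  exact (SES.of_ker h₃).extVanishes_left₃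
    (h₄.extVanishes_left fun m hm => hM m (hS m hm)) (extVanishes_of_projective _ _ _)

/-- If the weights of `M` do not exceed `l`, then `Hom(Δ l, M) ≅ Hom(P l, M)`. -/
lemma VanishesOff.fp_hom (hΔ : IsSplitQuasiHereditary R A Δ) (hM : VanishesOff A Δ S M)
    (hM' : FP R M) (hS : ∀ m, l < m → m ∉ S) : FP R (Δ l →ₗ[A] M) := by
  obtain ⟨P, _, _, _, _, π, h₁, h₂, h₃, h₄⟩ := hΔ.exists_projective l
  have hP : FP R (P →ₗ[A] M) := .hom_of_projective hM'
  have h := SES.of_ker h₃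
  have h0 : ExtVanishes A (LinearMap.ker π) M 0 :=
    h₄.extVanishes_left fun m hm => hM m (hS m hm)
  refine hP.of_equiv (LinearEquiv.ofBijective (LinearMap.lcomp R M π) ⟨?_, ?_⟩).symm
  · intro f g hfg
    ext x
    obtain ⟨x, rfl⟩ := h₃ x
    exact LinearMap.congr_fun hfg x
  · intro f
    exact h.factor_right f (extVanishes_zero_iff.1 h0 _)

lemma IsSplitQuasiHereditary.standard_vanishesOff (hΔ : IsSplitQuasiHereditary R A Δ) (l : Λ) :
    VanishesOff A Δ (Set.Iic l) (Δ l) := fun _ hm => hΔ.standard_hom_vanishes hm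

lemma IsSplitQuasiHereditary.standard_ext_one_vanishes (hΔ : IsSplitQuasiHereditary R A Δ)
    (h : ¬ l < m) : ExtVanishes A (Δ l) (Δ m) 1 :=
  (hΔ.standard_vanishesOff m).extVanishes_one hΔ fun _ hk hkm => h (lt_of_lt_of_le hk hkm)

lemma IsSplitQuasiHereditary.vanishesOff (hΔ : IsSplitQuasiHereditary R A Δ)
    (hM : TildeFiltered R A Δ S M) (hS : IsLowerSet S) : VanishesOff A Δ S M := fun _ hm =>
  hM.extVanishes_right fun _ hl => hΔ.standard_hom_vanishes fun h => hm (hS h hl)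

lemma IsSplitQuasiHereditary.smul_id_bijective (hΔ : IsSplitQuasiHereditary R A Δ) (l : Λ) :
    Function.Bijective fun r : R => r • (LinearMap.id : Δ l →ₗ[A] Δ l) := by
  obtain ⟨e⟩ := hΔ.end_standard l
  have : (fun r : R => r • (LinearMap.id : Δ l →ₗ[A] Δ l)) = e.symm := by
    ext r x
    rw [← mul_one r, ← smul_eq_mul, map_smul e.symm r 1, map_one, smul_eq_mul, mul_one]
    rfl
  rw [this]
  exact e.symm.bijective

lemma IsCostandard.extVanishes_of_ne (hN : IsCostandard R A Δ N) (h : l ≠ m) (i : ℕ) :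
    ExtVanishes A (Δ l) (N m) i := by
  rcases Nat.eq_zero_or_pos i with rfl | hi
  · exact extVanishes_zero_iff.2 (hN.hom_ne l m h)
  · exact hN.ext_eq_zero l m i hi

lemma IsCostandard.vanishesOff (hN : IsCostandard R A Δ N) (hM : TildeFiltered R A N S M) :
    VanishesOff A Δ S M := fun _ hm =>
  hM.extVanishes_right fun _ hl => hN.extVanishes_of_ne (by rintro rfl; exact hm hl) 0

/-- `Ext^i(F(Δ̃), F(Ñ)) = 0` for `i > 0`. -/
lemma IsCostandard.ext_filtered_vanishes (hN : IsCostandard R A Δ N)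
    {X Y : Type u} [AddCommGroup X] [Module R X] [Module A X] [IsScalarTower R A X]
    [AddCommGroup Y] [Module R Y] [Module A Y] [IsScalarTower R A Y] {S S' : Set Λ}
    (hX : TildeFiltered R A Δ S X) (hY : TildeFiltered R A N S' Y) {i : ℕ} (hi : 0 < i) :
    ExtVanishes A X Y i :=
  hX.extVanishes_left fun l _ => hY.extVanishes_right fun m _ => hN.ext_eq_zero l m i hi

/-- Every finitely generated module is a quotient of a module in `F(Δ̃)`. -/
lemma IsSplitQuasiHereditary.exists_cover [Finite Λ] (hΔ : IsSplitQuasiHereditary R A Δ)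
    (M : Type u) [AddCommGroup M] [Module A M] [Module.Finite A M] :
    ∃ (X : Type u) (_ : AddCommGroup X) (_ : Module R X) (_ : Module A X)
      (_ : IsScalarTower R A X) (f : X →ₗ[A] M), Function.Surjective f ∧
      TildeFiltered R A Δ Set.univ X := by
  obtain ⟨P, hP, hP'⟩ := hΔ.exists_projectives
  let : ∀ l, Module R (P l) := fun l => Module.compHom (P l) (algebraMap R A)
  have : ∀ l, IsScalarTower R A (P l) := fun l => .of_compHom R A _
  have hPf : ∀ l, TildeFiltered R A Δ Set.univ (P l) := fun l => by
    obtain ⟨-, -, π, h₃, h₄⟩ := hP l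
    exact .extension (.of_ker h₃) (h₄.mono (Set.subset_univ _)) (.standard (Set.mem_univ l))
  obtain ⟨k, f, hf⟩ := Module.Finite.exists_fin' A M
  obtain ⟨n, i, p, hp⟩ := (hP' (ModuleCat.of A (Fin k → A))).2
    ⟨inferInstanceAs (Module.Finite A (Fin k → A)),
      inferInstanceAs (Module.Projective A (Fin k → A))⟩
  obtain ⟨t, e, ⟨e'⟩⟩ := exists_directSum_equiv_pi (A := A) (fun l => P l)
  let E : (Fin n → ∀ k, P (e k)) ≃ₗ[A] (Fin n → DirectSum Λ fun l => P l) :=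
    LinearEquiv.piCongrRight fun _ => e'.symm
  refine ⟨Fin n → ∀ k, P (e k), inferInstance, inferInstance, inferInstance, inferInstance,
    f ∘ₗ p ∘ₗ E.toLinearMap, ?_, .pi _ fun _ => .pi _ fun _ => hPf _⟩
  have hps : Function.Surjective p := fun x => ⟨i x, LinearMap.congr_fun hp x⟩
  exact hf.comp (hps.comp E.surjective)

lemma SES.lcomp {X' X Z L : Type u} [AddCommGroup X'] [Module A X'] [AddCommGroup X] [Module A X]
    [AddCommGroup Z] [Module A Z] [AddCommGroup L] [Module R L] [Module A L] [IsScalarTower R A L]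
    {f : X' →ₗ[A] X} {g : X →ₗ[A] Z} (h : SES f g) (hZ : ExtVanishes A Z L 1) :
    SES (LinearMap.lcomp R L g) (LinearMap.lcomp R L f) := by
  refine ⟨fun a b hab => ?_, fun φ => h.exists_extend hZ φ, fun φ => ⟨h.factor_right φ, ?_⟩⟩
  · ext x
    obtain ⟨x, rfl⟩ := h.surj x
    exact LinearMap.congr_fun hab x
  · rintro ⟨ψ, rfl⟩
    ext x
    simp [h.apply_apply]

lemma IsCostandard.fp_hom (hN : IsCostandard R A Δ N)
    (hM : TildeFiltered R A Δ S M) (l : Λ) : FP R (M →ₗ[A] N l) := by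
  refine TildeFiltered.induction (X := Δ) (S := S)
    (motive := fun M _ _ _ _ => FP R (M →ₗ[A] N l)) ?_ ?_ hM
  · intro M _ _ _ _ _
    have : Subsingleton (M →ₗ[A] N l) := inferInstance
    exact .of_subsingleton
  · intro M' M _ _ _ _ _ _ _ _ m U _ _ f g hm hU h _ ih
    have h1 : FP R (Δ m →ₗ[A] N l) := by
      by_cases hml : m = l
      · subst hml
        obtain ⟨e⟩ := hN.hom_self m
        exact FP.of_equiv ⟨inferInstance, inferInstance⟩ e.symm
      · have := subsingleton_of_forall_eq _ (hN.hom_ne m l hml)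
        exact .of_subsingleton
    obtain ⟨n, i, p, hp⟩ := exists_retract_tensor (A := A) (Δ m) hU
    exact (h.lcomp (R := R) ((hN.ext_eq_zero m l 1 one_pos).tensor_left hU)).fp₂
      (h1.hom_pi.hom_of_retract i p hp) ih

/-- The costandard modules are projective over `R`: `A` is a summand of a module `X` in `F(Δ̃)`, so
`N l ≅ Hom(A, N l)` is a summand of `Hom(X, N l)`. -/
lemma IsCostandard.fp_costandard [Finite Λ] (hN : IsCostandard R A Δ N)
    (hΔ : IsSplitQuasiHereditary R A Δ) (l : Λ) : FP R (N l) := by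
  obtain ⟨X, _, _, _, _, f, hf, hX⟩ := hΔ.exists_cover (R := R) A
  obtain ⟨s, hs⟩ := Module.projective_lifting_property f LinearMap.id hf
  have h : FP R (A →ₗ[A] N l) := (hN.fp_hom hX l).hom_of_retract s f hs
  exact h.of_equiv (LinearMap.ringLmapEquivSelf A R (N l))

variable (R A Δ N T) in
/-- The summands `T l` of a characteristic tilting module. -/
structure IsTiltingFamily : Prop where
  standard : ∀ l, TildeFiltered R A Δ Set.univ (T l)
  costandard : ∀ l, TildeFiltered R A N Set.univ (T l)
  exists_sub : ∀ l, ∃ j : Δ l →ₗ[A] T l, Function.Injective j ∧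
    TildeFiltered R A Δ (Set.Iio l) (T l ⧸ LinearMap.range j)
  exists_quot : ∀ l, ∃ π : T l →ₗ[A] N l, Function.Surjective π ∧
    TildeFiltered R A N (Set.Iio l) (LinearMap.ker π)

lemma IsTiltingFamily.hom_vanishes (hT : IsTiltingFamily R A Δ N T) (hN : IsCostandard R A Δ N)
    (h : ¬ m ≤ l) : ExtVanishes A (T l) (N m) 0 := by
  obtain ⟨j, hj, hX⟩ := hT.exists_sub l
  refine (SES.of_range hj).extVanishes_left (hN.extVanishes_of_ne ?_ 0)
    (hX.extVanishes_left fun k hk => hN.extVanishes_of_ne ?_ 0)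
  · rintro rfl
    exact h le_rfl
  · rintro rfl
    exact h (le_of_lt hk)

/-- A map `N l → N m` is determined by its composite with `T l → N l`, and `T l` has weights at most
`l`. -/
lemma IsTiltingFamily.costandard_hom_vanishes (hT : IsTiltingFamily R A Δ N T)
    (hN : IsCostandard R A Δ N) (h : ¬ m ≤ l) : ExtVanishes A (N l) (N m) 0 := by
  obtain ⟨π, hπ, -⟩ := hT.exists_quot l
  refine extVanishes_zero_iff.2 fun f => ?_
  have := extVanishes_zero_iff.1 (hT.hom_vanishes hN h) (f ∘ₗ π)
  ext x
  obtain ⟨x, rfl⟩ := hπ x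
  exact LinearMap.congr_fun this x

lemma IsTiltingFamily.ker_hom_vanishes (hT : IsTiltingFamily R A Δ N T)
    (hN : IsCostandard R A Δ N) (h : ¬ m < l) {Y : Type u} [AddCommGroup Y] [Module R Y]
    [Module A Y] [IsScalarTower R A Y] (hY : TildeFiltered R A N (Set.Iio l) Y) :
    ExtVanishes A Y (N m) 0 :=
  hY.extVanishes_left fun _ hk => hT.costandard_hom_vanishes hN fun hmk => h (lt_of_le_of_lt hmk hk)

/-- Dimension shifting along `T l → N l` reduces `Ext^1(N l, N m)` to maps from the kernel, whose
weights are smaller than `l`. -/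
lemma IsTiltingFamily.costandard_ext_one_vanishes (hT : IsTiltingFamily R A Δ N T)
    (hN : IsCostandard R A Δ N) (h : ¬ m < l) : ExtVanishes A (N l) (N m) 1 := by
  obtain ⟨π, hπ, hY⟩ := hT.exists_quot l
  exact (SES.of_ker hπ).extVanishes_left₃ (hT.ker_hom_vanishes hN h hY)
    ((hT.standard l).extVanishes_left fun k _ => hN.ext_eq_zero k m 1 one_pos)

/-- The composite `Δ l → T l → N l` is a basis of `Hom(Δ l, N l)`, and precomposition with it is
injective on maps from `N l` to sums of copies of `N l`. -/
lemma IsTiltingFamily.exists_generator (hT : IsTiltingFamily R A Δ N T)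
    (hN : IsCostandard R A Δ N) (l : Λ) : ∃ γ : Δ l →ₗ[A] N l,
      Function.Bijective (fun r : R => r • γ) ∧
      ∀ (H : Type u) [AddCommGroup H] [Module R H], FP R H →
        ∀ f : N l →ₗ[A] N l ⊗[R] H, f ∘ₗ γ = 0 → f = 0 := by
  obtain ⟨j, hj, hX⟩ := hT.exists_sub l
  obtain ⟨π, hπ, hY⟩ := hT.exists_quot l
  obtain ⟨e⟩ := hN.hom_self l
  have hjs := SES.of_range hj
  have hπs := SES.of_ker hπ
  -- every map `Δ l → N l` factors through `π ∘ j`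
  have hfac : ∀ f : Δ l →ₗ[A] N l, ∃ g : N l →ₗ[A] N l, g ∘ₗ (π ∘ₗ j) = f := by
    intro f
    obtain ⟨f', hf'⟩ := hjs.exists_extend
      (hX.extVanishes_left fun k _ => hN.ext_eq_zero k l 1 one_pos) f
    obtain ⟨g, hg⟩ := hπs.factor_right f'
      (extVanishes_zero_iff.1 (hT.ker_hom_vanishes hN (lt_irrefl l) hY) _)
    exact ⟨g, by rw [← LinearMap.comp_assoc, hg, hf']⟩
  refine ⟨π ∘ₗ j, ?_, ?_⟩
  · -- `f₀` generates, `π ∘ j = r f₀` and `f₀ = g ∘ π ∘ j`; hence `r` is a unit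
    set f₀ := e.symm 1
    have hgen : ∀ f : Δ l →ₗ[A] N l, ∃ r : R, f = r • f₀ := fun f =>
      ⟨e f, by rw [← map_smul, smul_eq_mul, mul_one, LinearEquiv.symm_apply_apply]⟩
    have hfree : ∀ r : R, r • f₀ = 0 → r = 0 := fun r hr => by
      have := congrArg e hr
      rwa [map_smul, LinearEquiv.apply_symm_apply, smul_eq_mul, mul_one, map_zero] at this
    obtain ⟨r, hr⟩ := hgen (π ∘ₗ j)
    obtain ⟨g, hg⟩ := hfac f₀
    obtain ⟨s, hs⟩ := hgen (g ∘ₗ f₀)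
    have hrs : r * s = 1 := by
      refine sub_eq_zero.1 (hfree _ ?_)
      rw [sub_smul, one_smul, mul_smul, ← hs, sub_eq_zero]
      nth_rw 2 [← hg]
      rw [hr, LinearMap.comp_smul]
    constructor
    · intro a b hab
      have hab' : a • π ∘ₗ j = b • π ∘ₗ j := hab
      rw [hr, smul_smul, smul_smul, ← sub_eq_zero, ← sub_smul] at hab'
      have := hfree _ hab'
      calc a = a * r * s := by rw [mul_assoc, hrs, mul_one]
        _ = b * r * s := by rw [sub_eq_zero.1 this]
        _ = b := by rw [mul_assoc, hrs, mul_one]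
    · intro f
      obtain ⟨t, ht⟩ := hgen f
      refine ⟨t * s, ?_⟩
      change (t * s) • π ∘ₗ j = f
      rw [hr, smul_smul, mul_assoc, mul_comm s, hrs, mul_one, ht]
  · intro H _ _ hH f hf
    have hXH : ExtVanishes A (T l ⧸ LinearMap.range j) (N l ⊗[R] H) 0 :=
      hX.extVanishes_left fun k hk => (hN.extVanishes_of_ne (ne_of_lt hk) 0).tensor_right hH
    obtain ⟨g, hg⟩ := hjs.factor_right (f ∘ₗ π) (by rw [LinearMap.comp_assoc, hf])
    rw [extVanishes_zero_iff.1 hXH g, LinearMap.zero_comp] at hg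
    ext x
    obtain ⟨x, rfl⟩ := hπ x
    exact (LinearMap.congr_fun hg x).symm

end HighestWeight

/-! ### Induction over lower sets -/

section LowerSets

variable {Λ : Type w} [PartialOrder Λ] [Finite Λ]

lemma exists_maximal_of_nonempty {S : Set Λ} (hS : S.Nonempty) : ∃ l ∈ S, ∀ m ∈ S, ¬ l < m := by
  obtain ⟨l, hl⟩ := S.toFinite.exists_maximal hS
  exact ⟨l, hl.1, fun m hm hlm => hlm.not_ge (hl.2 hm hlm.le)⟩

/-- Induction over the lower sets of a finite poset, adding one maximal element at a time. -/
lemma IsLowerSet.induction_insert {p : Set Λ → Prop} (empty : p ∅)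
    (step : ∀ (S : Set Λ) (l : Λ), IsLowerSet S → l ∈ S → (∀ m ∈ S, ¬ l < m) → p (S \ {l}) → p S)
    {S : Set Λ} (hS : IsLowerSet S) : p S := by
  induction hn : S.ncard using Nat.strong_induction_on generalizing S with
  | _ n ih =>
    subst hn
    rcases S.eq_empty_or_nonempty with rfl | hne
    · exact empty
    · obtain ⟨l, hl, hmax⟩ := exists_maximal_of_nonempty hne
      refine step S l hS hl hmax (ih _ (Set.ncard_sdiff_singleton_lt_of_mem hl) ?_ rfl)
      intro a b hba ha
      refine ⟨hS hba ha.1, ?_⟩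
      rintro rfl
      exact hmax a ha.1 (lt_of_le_of_ne hba (Ne.symm ha.2))

/-- Induction over the lower sets of a finite poset, removing one maximal element at a time. -/
lemma IsLowerSet.induction_erase {p : Set Λ → Prop} (univ : p Set.univ)
    (step : ∀ (S : Set Λ) (l : Λ), (∀ m ∈ S, ¬ l < m) → p S → p (S \ {l}))
    {S : Set Λ} (hS : IsLowerSet S) : p S := by
  induction hn : Sᶜ.ncard using Nat.strong_induction_on generalizing S with
  | _ n ih =>
    subst hn
    rcases Sᶜ.eq_empty_or_nonempty with h | hne
    · rw [Set.compl_empty_iff.1 h]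
      exact univ
    · obtain ⟨l, hl⟩ := Sᶜ.toFinite.exists_minimal hne
      have hlt : ∀ m, m < l → m ∈ S := fun m hm => by
        by_contra hm'
        exact hm.not_ge (hl.2 hm' hm.le)
      have h1 : IsLowerSet (insert l S) := by
        intro a b hba ha
        rcases ha with rfl | ha
        · rcases hba.eq_or_lt with rfl | hba
          · exact Set.mem_insert _ _
          · exact Set.mem_insert_of_mem _ (hlt b hba)
        · exact Set.mem_insert_of_mem _ (hS hba ha)
      have h2 : (insert l S)ᶜ.ncard < Sᶜ.ncard := by
        refine Set.ncard_lt_ncard ⟨Set.compl_subset_compl.2 (Set.subset_insert _ _), fun h => ?_⟩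
        exact h hl.1 (Set.mem_insert _ _)
      have h3 : insert l S \ {l} = S := by
        simpa using hl.1
      rw [← h3]
      refine step _ l ?_ (ih _ h2 h1 rfl)
      rintro m (rfl | hm) hlm
      · exact lt_irrefl _ hlm
      · exact hl.1 (hS hlm.le hm)

end LowerSets

/-! ### The structure of `F(Δ̃)` -/

section Standard

variable {R : Type u} [CommRing R] {A : Type u} [Ring A] [Algebra R A] {Λ : Type w}
  [PartialOrder Λ]
  {Δ : Λ → Type u} [∀ l, AddCommGroup (Δ l)] [∀ l, Module R (Δ l)]
  [∀ l, Module A (Δ l)] [∀ l, IsScalarTower R A (Δ l)]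
  {S : Set Λ} {l m : Λ}
  {M X : Type u} [AddCommGroup M] [Module R M] [Module A M] [IsScalarTower R A M]
  [AddCommGroup X] [Module R X] [Module A X] [IsScalarTower R A X]

/-- The standard modules of maximal weight `l` in `S` can be moved to the bottom of a filtration. -/
lemma IsSplitQuasiHereditary.exists_top_sub (hΔ : IsSplitQuasiHereditary R A Δ)
    (hX : TildeFiltered R A Δ S X) (hmax : ∀ m ∈ S, ¬ l < m) :
    ∃ (H : Type u) (_ : AddCommGroup H) (_ : Module R H) (X₁ : Type u) (_ : AddCommGroup X₁)
      (_ : Module R X₁) (_ : Module A X₁) (_ : IsScalarTower R A X₁) (j : Δ l ⊗[R] H →ₗ[A] X)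
      (q : X →ₗ[A] X₁), FP R H ∧ SES j q ∧ TildeFiltered R A Δ (S \ {l}) X₁ := by
  refine TildeFiltered.induction (X := Δ) (S := S)
    (motive := fun X _ _ _ _ => ∃ (H : Type u) (_ : AddCommGroup H) (_ : Module R H) (X₁ : Type u)
      (_ : AddCommGroup X₁) (_ : Module R X₁) (_ : Module A X₁) (_ : IsScalarTower R A X₁)
      (j : Δ l ⊗[R] H →ₗ[A] X)
      (q : X →ₗ[A] X₁), FP R H ∧ SES j q ∧ TildeFiltered R A Δ (S \ {l}) X₁) ?_ ?_ hX
  · intro M _ _ _ _ _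
    have : Subsingleton (Δ l ⊗[R] PUnit.{u + 1}) := inferInstance
    exact ⟨PUnit, inferInstance, inferInstance, M, inferInstance, inferInstance, inferInstance,
      inferInstance, 0, LinearMap.id, .of_subsingleton,
      ⟨fun _ _ _ => Subsingleton.elim _ _, Function.surjective_id, fun x =>
        ⟨fun _ => ⟨0, Subsingleton.elim _ _⟩, fun _ => Subsingleton.elim _ _⟩⟩, .of_subsingleton⟩
  · rintro M' M _ _ _ _ _ _ _ _ m U _ _ f g hm hU h hM'
      ⟨H, _, _, X₁, _, _, _, _, j, q, hH, hjq, hX₁⟩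
    by_cases hml : m = l
    · subst hml
      -- `Ext^1(Δ l, M') = 0`, so that `Δ l ⊗ U` splits off `M` and joins the bottom layer
      obtain ⟨s, hs⟩ := h.exists_lift ((hM'.extVanishes_right fun k hk =>
        hΔ.standard_ext_one_vanishes (hmax k hk)).tensor_left hU) LinearMap.id
      obtain ⟨q', hq'⟩ := h.coprod_section hs hjq
      exact ⟨H × U, inferInstance, inferInstance, X₁, inferInstance, inferInstance, inferInstance,
        inferInstance, _, q', hH.prod hU,
        hq'.equiv_comp (TensorProduct.prodRight R A (Δ m) H U), hX₁⟩
    · -- dividing `M` by `Δ l ⊗ H` is the pushout along the quotient map of `M'`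
      obtain ⟨p', hp', -⟩ := Pushout.ses_inl (b := q) h
      exact ⟨H, inferInstance, inferInstance, Pushout f q, inferInstance, inferInstance,
        inferInstance, inferInstance, _, _, hH, Pushout.ses_inr' hjq h.inj,
        .snoc ⟨hm, hml⟩ hU hp' hX₁⟩

/-- For `l` maximal in `S` and `X` in `F(Δ̃_S)`, the evaluation map `Δ l ⊗ Hom(Δ l, X) → X` is the
first step of a filtration of `X`. In contrast to the filtration, it is functorial in `X`. -/
lemma IsSplitQuasiHereditary.traceMap_ses (hΔ : IsSplitQuasiHereditary R A Δ)
    (hX : TildeFiltered R A Δ S X) (hmax : ∀ m ∈ S, ¬ l < m) :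
    FP R (Δ l →ₗ[A] X) ∧ ∃ (X₁ : Type u) (_ : AddCommGroup X₁)
      (_ : Module R X₁) (_ : Module A X₁) (_ : IsScalarTower R A X₁)
      (q : X →ₗ[A] X₁), SES (traceMap R A (Δ l) X) q ∧ TildeFiltered R A Δ (S \ {l}) X₁ := by
  obtain ⟨H, _, _, X₁, _, _, _, _, j, q, hH, hjq, hX₁⟩ := hΔ.exists_top_sub hX hmax
  have h0 : ExtVanishes A (Δ l) X₁ 0 := hX₁.extVanishes_right fun m hm =>
    hΔ.standard_hom_vanishes fun hlm => hmax m hm.1 (lt_of_le_of_ne hlm (Ne.symm hm.2))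
  have hb := tensorHom_bijective (hΔ.smul_id_bijective l) hH
  let θ : H ≃ₗ[R] (Δ l →ₗ[A] X) := LinearEquiv.ofBijective
    (LinearMap.compRight R j ∘ₗ tensorHom R LinearMap.id H) (by
      constructor
      · intro a b hab
        refine hb.1 (LinearMap.ext fun x => hjq.inj ?_)
        exact LinearMap.congr_fun hab x
      · intro f
        obtain ⟨f', rfl⟩ := hjq.factor_left f (extVanishes_zero_iff.1 h0 _)
        obtain ⟨a, rfl⟩ := hb.2 f'
        exact ⟨a, rfl⟩)
  let E := TensorProduct.AlgebraTensorModule.congr (LinearEquiv.refl A (Δ l)) θ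
  have hE : traceMap R A (Δ l) X = j ∘ₗ E.symm.toLinearMap := by
    rw [LinearEquiv.eq_comp_toLinearMap_symm]
    exact AlgebraTensorModule_hom_ext fun x y => rfl
  refine ⟨hH.of_equiv θ, X₁, inferInstance, inferInstance, inferInstance, inferInstance, q, ?_, hX₁⟩
  rw [hE]
  exact hjq.equiv_comp E.symm

/-- `F(Δ̃_S)` is closed under direct summands. -/
lemma IsSplitQuasiHereditary.filtered_of_retract [Finite Λ] (hΔ : IsSplitQuasiHereditary R A Δ)
    (hS : IsLowerSet S) (hX : TildeFiltered R A Δ S X) (i : M →ₗ[A] X) (p : X →ₗ[A] M)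
    (hp : p ∘ₗ i = LinearMap.id) : TildeFiltered R A Δ S M := by
  refine IsLowerSet.induction_insert (p := fun S => ∀ (M X : Type u) [AddCommGroup M] [Module R M]
    [Module A M] [IsScalarTower R A M] [AddCommGroup X] [Module R X] [Module A X]
    [IsScalarTower R A X] (i : M →ₗ[A] X) (p : X →ₗ[A] M), p ∘ₗ i = LinearMap.id →
    TildeFiltered R A Δ S X → TildeFiltered R A Δ S M) ?_ ?_ hS M X i p hp hX
  · intro M X _ _ _ _ _ _ _ _ i p hp hX
    have := hX.subsingleton
    have : Subsingleton M := (Function.LeftInverse.injective (f := i) (g := p)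
      (LinearMap.congr_fun hp)).subsingleton
    exact .of_subsingleton
  · intro S l hS hl hmax ih M X _ _ _ _ _ _ _ _ i p hp hX
    obtain ⟨hH, X₁, _, _, _, _, q, hq, hX₁⟩ := hΔ.traceMap_ses hX hmax
    have hHM : FP R (Δ l →ₗ[A] M) := hH.hom_of_retract_right i p hp
    have hinj : Function.Injective (traceMap R A (Δ l) M) := by
      have h1 : Function.Injective (i ∘ₗ traceMap R A (Δ l) M) := by
        rw [traceMap_natural]
        exact hq.inj.comp (lTensor_injective_of_leftInverse (r := LinearMap.compRight R p) (by
          ext f x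
          exact LinearMap.congr_fun hp (f x)))
      exact Function.Injective.of_comp (f := i) h1
    have hM := SES.of_range hinj
    -- the cokernel of the evaluation map of `M` is a retract of that of `X`
    have hnat : ∀ {M X : Type u} [AddCommGroup M] [Module R M] [Module A M] [IsScalarTower R A M]
        [AddCommGroup X] [Module R X] [Module A X] [IsScalarTower R A X] {C : Type u}
        [AddCommGroup C] [Module A C] (i : M →ₗ[A] X) (q : X →ₗ[A] C),
        q ∘ₗ traceMap R A (Δ l) X = 0 → (q ∘ₗ i) ∘ₗ traceMap R A (Δ l) M = 0 := by
      intro M X _ _ _ _ _ _ _ _ C _ _ i q h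
      rw [LinearMap.comp_assoc, traceMap_natural, ← LinearMap.comp_assoc, h, LinearMap.zero_comp]
    obtain ⟨i', hi'⟩ := hM.factor_right _ (hnat i q hq.comp_eq_zero)
    obtain ⟨p', hp'⟩ := hq.factor_right _ (hnat p _ hM.comp_eq_zero)
    refine .extension hM (.standard_tensor hl hHM)
      ((ih _ X₁ i' p' ?_ hX₁).mono Set.sdiff_subset)
    refine LinearMap.ext fun x => ?_
    obtain ⟨x, rfl⟩ := hM.surj x
    have h1 := LinearMap.congr_fun hi' x
    have h2 := LinearMap.congr_fun hp' (i x)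
    have h3 : p (i x) = x := LinearMap.congr_fun hp x
    simp only [LinearMap.comp_apply] at h1 h2
    simp only [LinearMap.comp_apply, LinearMap.id_apply, h1, h2, h3]

/-- A finitely generated module whose weights lie in `S` is a quotient of a module in `F(Δ̃_S)`. -/
lemma VanishesOff.exists_cover [Finite Λ] (hΔ : IsSplitQuasiHereditary R A Δ) (hS : IsLowerSet S)
    {M : Type u} [AddCommGroup M] [Module A M] [Module.Finite A M]
    (hM : VanishesOff A Δ S M) :
    ∃ (X : Type u) (_ : AddCommGroup X) (_ : Module R X) (_ : Module A X)
      (_ : IsScalarTower R A X) (f : X →ₗ[A] M), Function.Surjective f ∧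
      TildeFiltered R A Δ S X := by
  revert hM
  refine IsLowerSet.induction_erase (p := fun S => VanishesOff A Δ S M → ∃ (X : Type u)
    (_ : AddCommGroup X) (_ : Module R X) (_ : Module A X) (_ : IsScalarTower R A X)
    (f : X →ₗ[A] M), Function.Surjective f ∧ TildeFiltered R A Δ S X) ?_ ?_ hS
  · intro _
    exact hΔ.exists_cover M
  · intro S l hmax ih hM
    obtain ⟨X, _, _, _, _, f, hf, hX⟩ := ih fun m hm => hM m fun h => hm h.1
    obtain ⟨hH, X₁, _, _, _, _, q, hq, hX₁⟩ := hΔ.traceMap_ses hX hmax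
    obtain ⟨f', hf'⟩ := hq.factor_right f (extVanishes_zero_iff.1
      ((hM l fun h => h.2 rfl).tensor_left hH) _)
    refine ⟨X₁, inferInstance, inferInstance, inferInstance, inferInstance, f', ?_, hX₁⟩
    rw [← hf'] at hf
    exact Function.Surjective.of_comp hf

end Standard

/-! ### The structure of `F(Ñ)` -/

section Costandard

/-- If `γ : D → C` has the properties given by `IsTiltingFamily.exists_generator`, then every map
`C ⊗ H → C ⊗ H'` comes from an `R`-linear map. -/
lemma exists_eq_lTensor {R : Type u} [CommRing R] {A : Type u} [Ring A] [Algebra R A]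
    {D C : Type u} [AddCommGroup D] [Module R D] [Module A D] [IsScalarTower R A D]
    [AddCommGroup C] [Module R C] [Module A C] [IsScalarTower R A C]
    {γ : D →ₗ[A] C} (hγ : Function.Bijective (fun r : R => r • γ))
    (hγ' : ∀ (H : Type u) [AddCommGroup H] [Module R H], FP R H →
        ∀ f : C →ₗ[A] C ⊗[R] H, f ∘ₗ γ = 0 → f = 0)
    {H H' : Type u} [AddCommGroup H] [Module R H] [AddCommGroup H'] [Module R H'] (hH' : FP R H')
    (g : C ⊗[R] H →ₗ[A] C ⊗[R] H') :
    ∃ φ : H →ₗ[R] H', g = TensorProduct.AlgebraTensorModule.lTensor A C φ := by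
  have hb := tensorHom_bijective hγ hH'
  let e := LinearEquiv.ofBijective _ hb
  let φ : H →ₗ[R] H' := e.symm.toLinearMap ∘ₗ LinearMap.compRight R g ∘ₗ tensorHom R γ H
  have hφ : ∀ h x, γ x ⊗ₜ[R] φ h = g (γ x ⊗ₜ h) := fun h x =>
    LinearMap.congr_fun (e.apply_symm_apply (g ∘ₗ tensorHom R γ H h)) x
  refine ⟨φ, AlgebraTensorModule_hom_ext fun x h => ?_⟩
  have := hγ' H' hH' (g ∘ₗ tensorHom R LinearMap.id H h - tensorHom R LinearMap.id H' (φ h)) (by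
    ext x
    simp [hφ])
  exact sub_eq_zero.1 (LinearMap.congr_fun this x)

variable {R : Type u} [CommRing R] {A : Type u} [Ring A] [Algebra R A] {Λ : Type w}
  [PartialOrder Λ]
  {Δ : Λ → Type u} [∀ l, AddCommGroup (Δ l)] [∀ l, Module R (Δ l)]
  [∀ l, Module A (Δ l)] [∀ l, IsScalarTower R A (Δ l)]
  {N : Λ → Type u} [∀ l, AddCommGroup (N l)] [∀ l, Module R (N l)]
  [∀ l, Module A (N l)] [∀ l, IsScalarTower R A (N l)]
  {T : Λ → Type u} [∀ l, AddCommGroup (T l)] [∀ l, Module R (T l)]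
  [∀ l, Module A (T l)] [∀ l, IsScalarTower R A (T l)]
  {S : Set Λ} {l m : Λ}
  {K Y E : Type u} [AddCommGroup K] [Module R K] [Module A K] [IsScalarTower R A K]
  [AddCommGroup Y] [Module R Y] [Module A Y] [IsScalarTower R A Y]
  [AddCommGroup E] [Module R E] [Module A E] [IsScalarTower R A E]

/-- The costandard modules of maximal weight `l` in `S` can be moved to the top of a filtration. -/
lemma IsTiltingFamily.exists_top_quot (hT : IsTiltingFamily R A Δ N T) (hN : IsCostandard R A Δ N)
    (hY : TildeFiltered R A N S Y) (hmax : ∀ m ∈ S, ¬ l < m) :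
    ∃ (H : Type u) (_ : AddCommGroup H) (_ : Module R H) (Y₁ : Type u) (_ : AddCommGroup Y₁)
      (_ : Module R Y₁) (_ : Module A Y₁) (_ : IsScalarTower R A Y₁) (k : Y₁ →ₗ[A] Y)
      (p : Y →ₗ[A] N l ⊗[R] H), FP R H ∧ SES k p ∧ TildeFiltered R A N (S \ {l}) Y₁ := by
  refine TildeFiltered.induction (X := N) (S := S)
    (motive := fun Y _ _ _ _ => ∃ (H : Type u) (_ : AddCommGroup H) (_ : Module R H) (Y₁ : Type u)
      (_ : AddCommGroup Y₁) (_ : Module R Y₁) (_ : Module A Y₁) (_ : IsScalarTower R A Y₁)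
      (k : Y₁ →ₗ[A] Y) (p : Y →ₗ[A] N l ⊗[R] H),
      FP R H ∧ SES k p ∧ TildeFiltered R A N (S \ {l}) Y₁) ?_ ?_ hY
  · intro M _ _ _ _ _
    have : Subsingleton (N l ⊗[R] PUnit.{u + 1}) := inferInstance
    exact ⟨PUnit, inferInstance, inferInstance, M, inferInstance, inferInstance, inferInstance,
      inferInstance, LinearMap.id, 0, .of_subsingleton,
      ⟨fun _ _ _ => Subsingleton.elim _ _, fun x => ⟨0, Subsingleton.elim _ _⟩, fun x =>
        ⟨fun _ => ⟨0, Subsingleton.elim _ _⟩, fun _ => Subsingleton.elim _ _⟩⟩, .of_subsingleton⟩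
  · rintro M' M _ _ _ _ _ _ _ _ m U _ _ f g hm hU h hM'
      ⟨H, _, _, Y₁, _, _, _, _, k, p, hH, hkp, hY₁⟩
    -- `Ext^1(N m, N l) = 0`, so that `p` extends to `M`
    obtain ⟨P, hP⟩ := h.exists_extend (((hT.costandard_ext_one_vanishes hN
      (hmax m hm)).tensor_left hU).tensor_right hH) p
    by_cases hml : m = l
    · subst hml
      exact ⟨H × U, inferInstance, inferInstance, Y₁, inferInstance, inferInstance, inferInstance,
        inferInstance, _, _, hH.prod hU,
        (h.prod_extension hkp hP).comp_equiv (TensorProduct.prodRight R A (N m) H U).symm, hY₁⟩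
    · obtain ⟨hP', α, hα⟩ := h.ker_extension hkp hP
      exact ⟨H, inferInstance, inferInstance, LinearMap.ker P, inferInstance, inferInstance,
        inferInstance, inferInstance, _, _, hH, .of_ker hP', .snoc ⟨hm, hml⟩ hU hα hY₁⟩

/-- `F(Ñ_S)` is closed under cokernels of monomorphisms, if the cokernel is projective over `R`. -/
lemma IsTiltingFamily.filtered_of_ses [Finite Λ] (hT : IsTiltingFamily R A Δ N T)
    (hN : IsCostandard R A Δ N) (hΔ : IsSplitQuasiHereditary R A Δ) (hS : IsLowerSet S)
    {ι : K →ₗ[A] Y} {π : Y →ₗ[A] E} (h : SES ι π) (hK : TildeFiltered R A N S K)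
    (hY : TildeFiltered R A N S Y) (hE : FP R E) : TildeFiltered R A N S E := by
  refine IsLowerSet.induction_insert (p := fun S => ∀ (K Y E : Type u) [AddCommGroup K] [Module R K]
    [Module A K] [IsScalarTower R A K] [AddCommGroup Y] [Module R Y] [Module A Y]
    [IsScalarTower R A Y] [AddCommGroup E] [Module R E] [Module A E] [IsScalarTower R A E]
    (ι : K →ₗ[A] Y) (π : Y →ₗ[A] E), SES ι π → TildeFiltered R A N S K →
    TildeFiltered R A N S Y → FP R E → TildeFiltered R A N S E) ?_ ?_ hS K Y E ι π h hK hY hE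
  · intro K Y E _ _ _ _ _ _ _ _ _ _ _ _ ι π h _ hY _
    have := hY.subsingleton
    have := h.surj.subsingleton
    exact .of_subsingleton
  intro S l hS hl hmax ih K Y E _ _ _ _ _ _ _ _ _ _ _ _ ι π h hK hY hE
  obtain ⟨γ, hγ, hγ'⟩ := hT.exists_generator hN l
  obtain ⟨HK, _, _, K₁, _, _, _, _, kK, pK, hHK, hsK, hK₁⟩ := hT.exists_top_quot hN hK hmax
  obtain ⟨HY, _, _, Y₁, _, _, _, _, kY, pY, hHY, hsY, hY₁⟩ := hT.exists_top_quot hN hY hmax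
  -- `ι` induces a map `N l ⊗ HK → N l ⊗ HY`, which is `1 ⊗ φ`
  have hK₁0 : ExtVanishes A K₁ (N l ⊗[R] HY) 0 := hK₁.extVanishes_left fun m hm =>
    (hT.costandard_hom_vanishes hN fun hlm =>
      hmax m hm.1 (lt_of_le_of_ne hlm (Ne.symm hm.2))).tensor_right hHY
  obtain ⟨g, hg⟩ := hsK.factor_right (pY ∘ₗ ι) (extVanishes_zero_iff.1 hK₁0 _)
  obtain ⟨φ, rfl⟩ := exists_eq_lTensor hγ hγ' hHY g
  have hg' : ∀ x, TensorProduct.AlgebraTensorModule.lTensor A (N l) φ (pK x) = pY (ι x) :=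
    LinearMap.congr_fun hg
  -- `φ` is the map `Hom(Δ l, K) → Hom(Δ l, Y)`, whose cokernel is `Hom(Δ l, E)`
  have hout : ∀ {Y₁ : Type u} [AddCommGroup Y₁] [Module R Y₁] [Module A Y₁] [IsScalarTower R A Y₁],
      TildeFiltered R A N (S \ {l}) Y₁ → ∀ i, ExtVanishes A (Δ l) Y₁ i := fun h i =>
    h.extVanishes_right fun m hm => hN.extVanishes_of_ne (Ne.symm hm.2) i
  have hlift : ∀ {Y Y₁ H : Type u} [AddCommGroup H] [Module R H] [AddCommGroup Y] [Module R Y]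
      [Module A Y] [IsScalarTower R A Y] [AddCommGroup Y₁] [Module R Y₁]
      [Module A Y₁] [IsScalarTower R A Y₁] {k : Y₁ →ₗ[A] Y} {p : Y →ₗ[A] N l ⊗[R] H}, FP R H →
      TildeFiltered R A N (S \ {l}) Y₁ → SES k p → ∃ e : (Δ l →ₗ[A] Y) ≃ₗ[R] H, ∀ f x,
        p (f x) = γ x ⊗ₜ e f := by
    intro Y Y₁ H _ _ _ _ _ _ _ _ _ _ k p hH hY₁ hs
    let e₁ := LinearEquiv.ofBijective _ (tensorHom_bijective hγ hH)
    let e₂ : (Δ l →ₗ[A] Y) ≃ₗ[R] (Δ l →ₗ[A] N l ⊗[R] H) :=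
      LinearEquiv.ofBijective (LinearMap.compRight R p) (by
        constructor
        · rw [← LinearMap.ker_eq_bot, LinearMap.ker_eq_bot']
          intro f hf
          obtain ⟨f', rfl⟩ := hs.factor_left f hf
          rw [extVanishes_zero_iff.1 (hout hY₁ 0) f', LinearMap.comp_zero]
        · intro f
          exact hs.exists_lift (hout hY₁ 1) f)
    refine ⟨e₂ ≪≫ₗ e₁.symm, fun f x => ?_⟩
    exact (LinearMap.congr_fun (e₁.apply_symm_apply (e₂ f)) x).symm
  obtain ⟨eK, heK⟩ := hlift hHK hK₁ hsK
  obtain ⟨eY, heY⟩ := hlift hHY hY₁ hsY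
  have hφ : ∀ f, φ (eK f) = eY (ι ∘ₗ f) := fun f =>
    (tensorHom_bijective hγ hHY).1 (LinearMap.ext fun x => by
      rw [tensorHom_apply, tensorHom_apply, ← heY, LinearMap.comp_apply, ← hg', heK]
      rfl)
  have hφinj : Function.Injective φ := by
    rw [← LinearMap.ker_eq_bot, LinearMap.ker_eq_bot']
    intro a ha
    obtain ⟨f, rfl⟩ := eK.surjective a
    rw [hφ, eY.map_eq_zero_iff] at ha
    have : f = 0 := LinearMap.ext fun x => h.inj (by
      rw [LinearMap.zero_apply, map_zero]
      exact LinearMap.congr_fun ha x)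
    rw [this, map_zero]
  have hVE : VanishesOff A Δ S E := fun m hm => h.extVanishes_right₃
    (hK.extVanishes_right fun k hk => hN.extVanishes_of_ne (by rintro rfl; exact hm hk) _)
    (hN.vanishesOff hY m hm)
  have hHom : FP R (Δ l →ₗ[A] E) := hVE.fp_hom hΔ hE fun m hlm hm => hmax m hm hlm
  have hΔK : ExtVanishes A (Δ l) K 1 := hK.extVanishes_right fun m _ => hN.ext_eq_zero l m 1 one_pos
  let ψ : HY →ₗ[R] (Δ l →ₗ[A] E) := LinearMap.compRight R π ∘ₗ eY.symm.toLinearMap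
  have hs : SES φ ψ := by
    refine ⟨hφinj, fun f => ?_, fun a => ?_⟩
    · obtain ⟨f', rfl⟩ := h.exists_lift hΔK f
      exact ⟨eY f', by simp [ψ]⟩
    · obtain ⟨f, rfl⟩ := eY.surjective a
      simp only [ψ, LinearMap.comp_apply, LinearEquiv.coe_coe, LinearEquiv.symm_apply_apply,
        LinearMap.compRight_apply]
      constructor
      · intro hf
        obtain ⟨f', rfl⟩ := h.factor_left f hf
        exact ⟨eK f', hφ f'⟩
      · rintro ⟨b, hb⟩
        obtain ⟨f', rfl⟩ := eK.surjective b
        rw [hφ] at hb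
        rw [← eY.injective hb, ← LinearMap.comp_assoc, h.comp_eq_zero, LinearMap.zero_comp]
  set HE := Δ l →ₗ[A] E
  have hsN : SES (TensorProduct.AlgebraTensorModule.lTensor A (N l) φ)
      (TensorProduct.AlgebraTensorModule.lTensor A (N l) ψ) := by
    obtain ⟨s, hs'⟩ := FP.exists_section hs.surj hHom
    obtain ⟨r, hr, -⟩ := hs.exists_retraction s hs'
    exact ⟨lTensor_injective_of_leftInverse hr, LinearMap.lTensor_surjective (N l) hs.surj,
      lTensor_exact (N l) hs.exact hs.surj⟩
  -- hence `E` maps onto `N l ⊗ HE`, with a kernel that is the quotient of `Y₁` by `K₁`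
  obtain ⟨q, hq⟩ := h.factor_right
    (TensorProduct.AlgebraTensorModule.lTensor A (N l) ψ ∘ₗ pY) (by
      rw [LinearMap.comp_assoc, ← hg, ← LinearMap.comp_assoc, hsN.comp_eq_zero,
        LinearMap.zero_comp])
  have hq' : ∀ y, q (π y) = TensorProduct.AlgebraTensorModule.lTensor A (N l) ψ (pY y) :=
    LinearMap.congr_fun hq
  have hqs : Function.Surjective q := by
    have : Function.Surjective (q ∘ₗ π) := by
      rw [hq]
      exact hsN.surj.comp hsY.surj
    exact Function.Surjective.of_comp this
  have hsE := SES.of_ker hqs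
  obtain ⟨ι₁, hι₁⟩ := hsY.factor_left (ι ∘ₗ kK) (by
    rw [← LinearMap.comp_assoc, ← hg, LinearMap.comp_assoc, hsK.comp_eq_zero, LinearMap.comp_zero])
  obtain ⟨π₁, hπ₁⟩ := hsE.factor_left (π ∘ₗ kY) (by
    rw [← LinearMap.comp_assoc, hq, LinearMap.comp_assoc, hsY.comp_eq_zero, LinearMap.comp_zero])
  have hι₁' : ∀ x, kY (ι₁ x) = ι (kK x) := LinearMap.congr_fun hι₁
  have hπ₁' : ∀ x, (π₁ x : E) = π (kY x) := LinearMap.congr_fun hπ₁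
  have h₁ : SES ι₁ π₁ := by
    refine ⟨fun a b hab => ?_, fun e => ?_, fun y => ?_⟩
    · apply hsK.inj
      apply h.inj
      rw [← hι₁', ← hι₁', hab]
    · obtain ⟨y, hy⟩ := h.surj e
      have h1 : TensorProduct.AlgebraTensorModule.lTensor A (N l) ψ (pY y) = 0 := by
        rw [← hq', hy]
        exact e.2
      obtain ⟨z, hz⟩ := (hsN.exact _).1 h1
      obtain ⟨x, rfl⟩ := hsK.surj z
      obtain ⟨y₁, hy₁⟩ := (hsY.exact (y - ι x)).1 (by rw [map_sub, ← hg', hz, sub_self])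
      refine ⟨y₁, Subtype.ext ?_⟩
      rw [hπ₁', hy₁, map_sub, h.apply_apply, sub_zero, hy]
    · constructor
      · intro hy
        have h1 : π (kY y) = 0 := by rw [← hπ₁', hy]; rfl
        obtain ⟨x, hx⟩ := (h.exact _).1 h1
        obtain ⟨x₁, rfl⟩ := (hsK.exact x).1 (hsN.inj (by
          rw [hg', hx, hsY.apply_apply, map_zero]))
        exact ⟨x₁, hsY.inj (by rw [hι₁', hx])⟩
      · rintro ⟨x, rfl⟩
        apply Subtype.ext
        rw [hπ₁', hι₁', h.apply_apply]
        rfl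
  have hE₁ : FP R (LinearMap.ker q) := hsE.fp₁ hE ((hN.fp_costandard hΔ l).tensor hHom)
  exact .snoc hl hHom hsE ((ih K₁ Y₁ _ ι₁ π₁ h₁ hK₁ hY₁ hE₁).mono Set.sdiff_subset)

end Costandard

/-! ### The additive closure of a module -/

section AddClosure

variable {R : Type*} [CommRing R] {A : Type u} [Ring A] [Algebra R A]
  {T : Type v} [AddCommGroup T] [Module A T]
  {X Y : Type u} [AddCommGroup X] [Module A X] [AddCommGroup Y] [Module A Y]

lemma InAdd.of_retract (h : InAdd A T Y) (i : X →ₗ[A] Y) (p : Y →ₗ[A] X)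
    (hp : p ∘ₗ i = LinearMap.id) : InAdd A T X := by
  obtain ⟨n, i', p', h'⟩ := h
  exact ⟨n, i' ∘ₗ i, p ∘ₗ p', by
    rw [LinearMap.comp_assoc, ← LinearMap.comp_assoc i, h', LinearMap.id_comp, hp]⟩

lemma InAdd.prod (hX : InAdd A T X) (hY : InAdd A T Y) : InAdd A T (X × Y) := by
  obtain ⟨n, i, p, hp⟩ := hX
  obtain ⟨m, i', p', hp'⟩ := hY
  let e : (Fin (n + m) → T) ≃ₗ[A] (Fin n → T) × (Fin m → T) :=
    LinearEquiv.funCongrLeft A T finSumFinEquiv ≪≫ₗ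
      LinearEquiv.sumArrowLequivProdArrow (Fin n) (Fin m) A T
  refine ⟨n + m, e.symm.toLinearMap ∘ₗ i.prodMap i', p.prodMap p' ∘ₗ e.toLinearMap, ?_⟩
  refine LinearMap.ext fun x => Prod.ext ?_ ?_
  · simpa using LinearMap.congr_fun hp x.1
  · simpa using LinearMap.congr_fun hp' x.2

lemma InAdd.of_subsingleton [Subsingleton X] : InAdd A T X :=
  ⟨0, 0, 0, LinearMap.ext fun _ => Subsingleton.elim _ _⟩

lemma InAdd.pi {n : ℕ} (hX : InAdd A T X) : InAdd A T (Fin n → X) := by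
  induction n with
  | zero => exact .of_subsingleton
  | succ n ih =>
    refine (hX.prod ih).of_retract (Fin.consLinearEquiv A (fun _ => X)).symm.toLinearMap
      (Fin.consLinearEquiv A (fun _ => X)).toLinearMap ?_
    ext; simp

lemma InAdd.tensor [Module R X] [IsScalarTower R A X] (hX : InAdd A T X) {U : Type u}
    [AddCommGroup U] [Module R U] (hU : FP R U) : InAdd A T (X ⊗[R] U) := by
  obtain ⟨n, i, p, hp⟩ := exists_retract_tensor (A := A) X hU
  exact hX.pi.of_retract i p hp

end AddClosure

section Below

variable {Λ : Type w} [PartialOrder Λ]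

/-- The elements that are smaller than some element of `S`. -/
def below (S : Set Λ) : Set Λ := {m | ∃ l ∈ S, m < l}

lemma isLowerSet_below (S : Set Λ) : IsLowerSet (below S) := fun _ _ hba ⟨l, hl, h⟩ =>
  ⟨l, hl, lt_of_le_of_lt hba h⟩

/-- Induction over the lower sets of a finite poset, removing all maximal elements at a time. -/
lemma IsLowerSet.induction_below [Finite Λ] {p : Set Λ → Prop} (empty : p ∅)
    (step : ∀ S, IsLowerSet S → p (below S) → p S) {S : Set Λ} (hS : IsLowerSet S) : p S := by
  induction hn : S.ncard using Nat.strong_induction_on generalizing S with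
  | _ n ih =>
    subst hn
    rcases S.eq_empty_or_nonempty with rfl | hne
    · exact empty
    · obtain ⟨l, hl, hmax⟩ := exists_maximal_of_nonempty hne
      refine step S hS (ih _ (Set.ncard_lt_ncard ⟨?_, fun h => ?_⟩) (isLowerSet_below S) rfl)
      · rintro m ⟨k, hk, hmk⟩
        exact hS hmk.le hk
      · obtain ⟨k, hk, hlk⟩ := h hl
        exact hmax k hk hlk

end Below

lemma SES.of_subsingleton {A M₁ M₂ M₃ : Type*} [Ring A] [AddCommGroup M₁] [AddCommGroup M₂]
    [AddCommGroup M₃] [Module A M₁] [Module A M₂] [Module A M₃] [Subsingleton M₁] [Subsingleton M₂]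
    [Subsingleton M₃] (f : M₁ →ₗ[A] M₂) (g : M₂ →ₗ[A] M₃) : SES f g :=
  ⟨fun _ _ _ => Subsingleton.elim _ _, fun _ => ⟨0, Subsingleton.elim _ _⟩, fun _ =>
    ⟨fun _ => ⟨0, Subsingleton.elim _ _⟩, fun _ => Subsingleton.elim _ _⟩⟩

/-- A split short exact sequence can be turned around. -/
lemma SES.flip {A M₁ M₂ M₃ : Type*} [Ring A] [AddCommGroup M₁] [AddCommGroup M₂]
    [AddCommGroup M₃] [Module A M₁] [Module A M₂] [Module A M₃]
    {f : M₁ →ₗ[A] M₂} {g : M₂ →ₗ[A] M₃} (h : SES f g) {s : M₃ →ₗ[A] M₂}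
    (hs : g ∘ₗ s = LinearMap.id) : ∃ r : M₂ →ₗ[A] M₁, SES s r ∧ r ∘ₗ f = LinearMap.id := by
  obtain ⟨r, hrf, hr⟩ := h.exists_retraction s hs
  have hr' : ∀ x, f (r x) + s (g x) = x := LinearMap.congr_fun hr
  have hs' : ∀ x, g (s x) = x := LinearMap.congr_fun hs
  refine ⟨r, ⟨Function.LeftInverse.injective hs',
    Function.RightInverse.surjective (LinearMap.congr_fun hrf), fun x => ⟨fun hx => ?_, ?_⟩⟩, hrf⟩
  · have := hr' x
    rw [hx, map_zero, zero_add] at this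
    exact ⟨_, this⟩
  · rintro ⟨y, rfl⟩
    have := hr' (s y)
    rw [hs', add_eq_right] at this
    exact h.inj (this.trans (map_zero f).symm)

/-! ### Tilting modules and approximations -/

section Approximation

variable {R : Type u} [CommRing R] {A : Type u} [Ring A] [Algebra R A] {Λ : Type w}
  [PartialOrder Λ]
  {Δ : Λ → Type u} [∀ l, AddCommGroup (Δ l)] [∀ l, Module R (Δ l)]
  [∀ l, Module A (Δ l)] [∀ l, IsScalarTower R A (Δ l)]
  {N : Λ → Type u} [∀ l, AddCommGroup (N l)] [∀ l, Module R (N l)]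
  [∀ l, Module A (N l)] [∀ l, IsScalarTower R A (N l)]
  {T : Λ → Type u} [∀ l, AddCommGroup (T l)] [∀ l, Module R (T l)]
  [∀ l, Module A (T l)] [∀ l, IsScalarTower R A (T l)]
  {T₀ : Type u} [AddCommGroup T₀] [Module A T₀]
  {S : Set Λ} {l m : Λ}
  {M X Y : Type u} [AddCommGroup M] [Module R M] [Module A M] [IsScalarTower R A M]
  [AddCommGroup X] [Module R X] [Module A X] [IsScalarTower R A X]
  [AddCommGroup Y] [Module R Y] [Module A Y] [IsScalarTower R A Y]

variable (R A Δ N T₀) in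
/-- `C` belongs to `add T₀` and has both filtrations; the filtrations are recorded because
`F(Δ̃)` and `F(Ñ)` are only later seen to be closed under direct summands. -/
structure IsTiltingSum (C : Type u) [AddCommGroup C] [Module A C] : Prop where
  inAdd : InAdd A T₀ C
  standard : TildeFiltered R A Δ Set.univ C
  costandard : TildeFiltered R A N Set.univ C

omit [PartialOrder Λ] in
lemma IsTiltingSum.of_subsingleton {C : Type u} [AddCommGroup C] [Module A C] [Subsingleton C] :
    IsTiltingSum R A Δ N T₀ C :=
  ⟨.of_subsingleton, .of_subsingleton, .of_subsingleton⟩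

omit [PartialOrder Λ] in
lemma IsTiltingSum.prod (hX : IsTiltingSum R A Δ N T₀ X) (hY : IsTiltingSum R A Δ N T₀ Y) :
    IsTiltingSum R A Δ N T₀ (X × Y) :=
  ⟨hX.inAdd.prod hY.inAdd, hX.standard.prod hY.standard, hX.costandard.prod hY.costandard⟩

lemma IsTiltingFamily.isTiltingSum (hT : IsTiltingFamily R A Δ N T) (hT₀ : ∀ l, InAdd A T₀ (T l))
    (l : Λ) {U : Type u} [AddCommGroup U] [Module R U] (hU : FP R U) :
    IsTiltingSum R A Δ N T₀ (T l ⊗[R] U) :=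
  ⟨(hT₀ l).tensor hU, (hT.standard l).tensor hU, (hT.costandard l).tensor hU⟩

/-- A module in `F(Δ̃_S)` embeds into a tilting module; the cokernel is again in `F(Δ̃)`, with
smaller weights. -/
lemma IsTiltingFamily.exists_embedding (hT : IsTiltingFamily R A Δ N T)
    (hN : IsCostandard R A Δ N) (hT₀ : ∀ l, InAdd A T₀ (T l)) (hX : TildeFiltered R A Δ S X) :
    ∃ (C : Type u) (_ : AddCommGroup C) (_ : Module R C) (_ : Module A C) (_ : IsScalarTower R A C)
      (X₁ : Type u) (_ : AddCommGroup X₁) (_ : Module R X₁) (_ : Module A X₁)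
      (_ : IsScalarTower R A X₁) (j : X →ₗ[A] C) (c : C →ₗ[A] X₁),
      SES j c ∧ IsTiltingSum R A Δ N T₀ C ∧ TildeFiltered R A Δ (below S) X₁ := by
  refine TildeFiltered.induction (X := Δ) (S := S) (motive := fun X _ _ _ _ =>
    ∃ (C : Type u) (_ : AddCommGroup C) (_ : Module R C) (_ : Module A C) (_ : IsScalarTower R A C)
      (X₁ : Type u) (_ : AddCommGroup X₁) (_ : Module R X₁) (_ : Module A X₁)
      (_ : IsScalarTower R A X₁) (j : X →ₗ[A] C) (c : C →ₗ[A] X₁),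
      SES j c ∧ IsTiltingSum R A Δ N T₀ C ∧ TildeFiltered R A Δ (below S) X₁) ?_ ?_ hX
  · intro M _ _ _ _ _
    exact ⟨M, inferInstance, inferInstance, inferInstance, inferInstance, M, inferInstance,
      inferInstance, inferInstance, inferInstance, 0, 0, .of_subsingleton _ _, .of_subsingleton,
      .of_subsingleton⟩
  · rintro M' M _ _ _ _ _ _ _ _ m U _ _ f g hm hU h hM'
      ⟨C, _, _, _, _, X₁, _, _, _, _, j, c, hjc, hC, hX₁⟩
    obtain ⟨i, hi, hTm⟩ := hT.exists_sub m
    have hs := (SES.of_range hi).tensor hU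
    obtain ⟨s, hs'⟩ := h.exists_extend ((hC.costandard.extVanishes_right fun k _ =>
      hN.ext_eq_zero m k 1 one_pos).tensor_left hU) j
    obtain ⟨hJ, α, β, hαβ⟩ := h.horseshoe_embedding hjc hs hs'
    exact ⟨C × T m ⊗[R] U, inferInstance, inferInstance, inferInstance, inferInstance, _,
      inferInstance, inferInstance, inferInstance, inferInstance, _, _, .of_range hJ,
      hC.prod (hT.isTiltingSum hT₀ m hU),
      hX₁.extension hαβ ((hTm.tensor hU).mono fun k hk => ⟨m, hm, hk⟩)⟩

/-- A module in `F(Ñ_S)` is a quotient of a tilting module; the kernel is again in `F(Ñ)`, with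
smaller weights. -/
lemma IsTiltingFamily.exists_tilting_cover (hT : IsTiltingFamily R A Δ N T)
    (hN : IsCostandard R A Δ N) (hT₀ : ∀ l, InAdd A T₀ (T l)) (hY : TildeFiltered R A N S Y) :
    ∃ (C : Type u) (_ : AddCommGroup C) (_ : Module R C) (_ : Module A C) (_ : IsScalarTower R A C)
      (Y₁ : Type u) (_ : AddCommGroup Y₁) (_ : Module R Y₁) (_ : Module A Y₁)
      (_ : IsScalarTower R A Y₁) (k : Y₁ →ₗ[A] C) (t : C →ₗ[A] Y),
      SES k t ∧ IsTiltingSum R A Δ N T₀ C ∧ TildeFiltered R A N (below S) Y₁ := by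
  refine TildeFiltered.induction (X := N) (S := S) (motive := fun Y _ _ _ _ =>
    ∃ (C : Type u) (_ : AddCommGroup C) (_ : Module R C) (_ : Module A C) (_ : IsScalarTower R A C)
      (Y₁ : Type u) (_ : AddCommGroup Y₁) (_ : Module R Y₁) (_ : Module A Y₁)
      (_ : IsScalarTower R A Y₁) (k : Y₁ →ₗ[A] C) (t : C →ₗ[A] Y),
      SES k t ∧ IsTiltingSum R A Δ N T₀ C ∧ TildeFiltered R A N (below S) Y₁) ?_ ?_ hY
  · intro M _ _ _ _ _
    exact ⟨M, inferInstance, inferInstance, inferInstance, inferInstance, M, inferInstance,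
      inferInstance, inferInstance, inferInstance, 0, 0, .of_subsingleton _ _, .of_subsingleton,
      .of_subsingleton⟩
  · rintro M' M _ _ _ _ _ _ _ _ m U _ _ f g hm hU h hM'
      ⟨C, _, _, _, _, Y₁, _, _, _, _, k, t, hkt, hC, hY₁⟩
    obtain ⟨π, hπ, hTm⟩ := hT.exists_quot m
    have hs := (SES.of_ker hπ).tensor hU
    obtain ⟨s, hs'⟩ := h.exists_lift ((hN.ext_filtered_vanishes (hT.standard m) hM'
      one_pos).tensor_left hU) (TensorProduct.AlgebraTensorModule.rTensor R U π)
    obtain ⟨hJ, α, β, hαβ⟩ := h.horseshoe_surjection hkt hs hs'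
    exact ⟨C × T m ⊗[R] U, inferInstance, inferInstance, inferInstance, inferInstance, _,
      inferInstance, inferInstance, inferInstance, inferInstance, _, _, .of_ker hJ,
      hC.prod (hT.isTiltingSum hT₀ m hU),
      hY₁.extension hαβ ((hTm.tensor hU).mono fun k hk => ⟨m, hm, hk⟩)⟩

/-- A module with weights in `S` is a quotient of a module in `F(Δ̃_S)` such that the weight `l`,
maximal in `S`, does not occur in the kernel. -/
lemma VanishesOff.exists_relative_cover [Finite Λ] (hΔ : IsSplitQuasiHereditary R A Δ)
    (hS : IsLowerSet S) (hl : l ∈ S) (hmax : ∀ m ∈ S, ¬ l < m)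
    (hM : VanishesOff A Δ S M) (hM' : FP R M) :
    ∃ (Q : Type u) (_ : AddCommGroup Q) (_ : Module R Q) (_ : Module A Q)
      (_ : IsScalarTower R A Q) (f : Q →ₗ[A] M), Function.Surjective f ∧
      TildeFiltered R A Δ S Q ∧ VanishesOff A Δ (S \ {l}) (LinearMap.ker f) := by
  have := hM'.finite
  have := Module.Finite.of_restrictScalars_finite R A M
  obtain ⟨X, _, _, _, _, f, hf, hX⟩ := hM.exists_cover hΔ hS
  obtain ⟨-, X₁, _, _, _, _, q, hq, hX₁⟩ := hΔ.traceMap_ses hX hmax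
  have hH : FP R (Δ l →ₗ[A] M) := hM.fp_hom hΔ hM' fun m hlm hm => hmax m hm hlm
  -- enlarge the bottom layer `Δ l ⊗ Hom(Δ l, X)` of `X` to `Δ l ⊗ Hom(Δ l, M)`
  let b := TensorProduct.AlgebraTensorModule.lTensor A (Δ l)
    (LinearMap.compRight R f : (Δ l →ₗ[A] X) →ₗ[R] (Δ l →ₗ[A] M))
  obtain ⟨p, hp, -⟩ := Pushout.ses_inl (b := b) hq
  obtain ⟨φ, hφ₁, hφ₂⟩ := Pushout.exists_desc f (traceMap R A (Δ l) M)
    (a := traceMap R A (Δ l) X) (b := b) (traceMap_natural f)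
  have hQ : TildeFiltered R A Δ S (Pushout (traceMap R A (Δ l) X) b) :=
    (TildeFiltered.standard_tensor hl hH).extension hp (hX₁.mono Set.sdiff_subset)
  refine ⟨Pushout (traceMap R A (Δ l) X) b, inferInstance, inferInstance, inferInstance,
    inferInstance, φ, ?_, hQ, ?_⟩
  · rw [← hφ₁] at hf
    exact Function.Surjective.of_comp hf
  · intro m hm
    refine extVanishes_zero_iff.2 fun g => ?_
    have hsub : (LinearMap.ker φ).subtype ∘ₗ g = 0 := by
      by_cases hmS : m ∈ S
      · have hml : m = l := by
          by_contra hml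
          exact hm ⟨hmS, hml⟩
        subst hml
        have h0 : ExtVanishes A (Δ m) X₁ 0 := hX₁.extVanishes_right fun k hk =>
          hΔ.standard_hom_vanishes fun hlk => hmax k hk.1 (lt_of_le_of_ne hlk (Ne.symm hk.2))
        obtain ⟨g', hg'⟩ := hp.factor_left ((LinearMap.ker φ).subtype ∘ₗ g)
          (extVanishes_zero_iff.1 h0 _)
        obtain ⟨h, rfl⟩ := (tensorHom_bijective (hΔ.smul_id_bijective m) hH).2 g'
        have hh : h = 0 := by
          ext x
          have h1 : φ (Pushout.inl _ b (x ⊗ₜ h)) = h x := LinearMap.congr_fun hφ₂ (x ⊗ₜ h)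
          have h2 : Pushout.inl _ b (x ⊗ₜ h) = (g x : Pushout (traceMap R A (Δ m) X) b) :=
            LinearMap.congr_fun hg' x
          rw [← h1, h2]
          exact (g x).2
        rw [← hg', hh, map_zero, LinearMap.comp_zero]
      · exact extVanishes_zero_iff.1 (hΔ.vanishesOff hQ hS m hmS) _
    ext x
    exact LinearMap.congr_fun hsub x

/-- Approximation: every finitely generated `R`-projective module `M` is a quotient of a module in
`F(Δ̃)` by one in `F(Ñ)`, and embeds into a module in `F(Ñ)` with quotient in `F(Δ̃)`. -/
theorem IsTiltingFamily.exists_approximations [Finite Λ] (hT : IsTiltingFamily R A Δ N T)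
    (hN : IsCostandard R A Δ N) (hΔ : IsSplitQuasiHereditary R A Δ)
    (hT₀ : ∀ l, InAdd A T₀ (T l)) (hM : FP R M) :
    (∃ (X : Type u) (_ : AddCommGroup X) (_ : Module R X) (_ : Module A X)
      (_ : IsScalarTower R A X) (Y : Type u) (_ : AddCommGroup Y) (_ : Module R Y) (_ : Module A Y)
      (_ : IsScalarTower R A Y) (f : Y →ₗ[A] X) (g : X →ₗ[A] M), SES f g ∧
      TildeFiltered R A Δ Set.univ X ∧ TildeFiltered R A N Set.univ Y) ∧
    (∃ (Y : Type u) (_ : AddCommGroup Y) (_ : Module R Y) (_ : Module A Y)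
      (_ : IsScalarTower R A Y) (X : Type u) (_ : AddCommGroup X) (_ : Module R X) (_ : Module A X)
      (_ : IsScalarTower R A X) (f : M →ₗ[A] Y) (g : Y →ₗ[A] X), SES f g ∧
      TildeFiltered R A Δ Set.univ X ∧ TildeFiltered R A N Set.univ Y) := by
  refine isLowerSet_univ.induction_insert (p := fun S => ∀ (M : Type u) [AddCommGroup M]
    [Module R M] [Module A M] [IsScalarTower R A M], FP R M → VanishesOff A Δ S M →
    (∃ (X : Type u) (_ : AddCommGroup X) (_ : Module R X) (_ : Module A X)
      (_ : IsScalarTower R A X) (Y : Type u) (_ : AddCommGroup Y) (_ : Module R Y) (_ : Module A Y)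
      (_ : IsScalarTower R A Y) (f : Y →ₗ[A] X) (g : X →ₗ[A] M), SES f g ∧
      TildeFiltered R A Δ Set.univ X ∧ TildeFiltered R A N Set.univ Y) ∧
    (∃ (Y : Type u) (_ : AddCommGroup Y) (_ : Module R Y) (_ : Module A Y)
      (_ : IsScalarTower R A Y) (X : Type u) (_ : AddCommGroup X) (_ : Module R X) (_ : Module A X)
      (_ : IsScalarTower R A X) (f : M →ₗ[A] Y) (g : Y →ₗ[A] X), SES f g ∧
      TildeFiltered R A Δ Set.univ X ∧ TildeFiltered R A N Set.univ Y)) ?_ ?_ M hM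
      fun m hm => absurd (Set.mem_univ m) hm
  · intro M _ _ _ _ hM hV
    have := hM.finite
    have := Module.Finite.of_restrictScalars_finite R A M
    obtain ⟨X, _, _, _, _, f, hf, hX⟩ := hV.exists_cover hΔ fun _ _ _ h => h
    have := hX.subsingleton
    have := hf.subsingleton
    exact ⟨⟨M, inferInstance, inferInstance, inferInstance, inferInstance, M, inferInstance,
      inferInstance, inferInstance, inferInstance, 0, 0, .of_subsingleton _ _, .of_subsingleton,
      .of_subsingleton⟩, ⟨M, inferInstance, inferInstance, inferInstance, inferInstance, M,
      inferInstance, inferInstance, inferInstance, inferInstance, 0, 0, .of_subsingleton _ _,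
      .of_subsingleton, .of_subsingleton⟩⟩
  · intro S l hS hl hmax ih M _ _ _ _ hM hV
    obtain ⟨Q, _, _, _, _, φ, hφ, hQ, hK⟩ := hV.exists_relative_cover hΔ hS hl hmax hM
    have hφs := SES.of_ker hφ
    have hfp : ∀ {S : Set Λ} {X : Type u} [AddCommGroup X] [Module R X] [Module A X]
        [IsScalarTower R A X], TildeFiltered R A Δ S X → FP R X := fun h =>
      h.fp fun l _ => hΔ.fp_standard l
    -- push out `Q` along an embedding of `ker φ`, whose weights do not include `l`, into `F(Ñ)`
    obtain ⟨-, Y, _, _, _, _, X₁, _, _, _, _, α, c, hαc, hX₁, hY⟩ :=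
      ih (LinearMap.ker φ) (hφs.fp₁ (hfp hQ) hM) hK
    obtain ⟨p, hp, -⟩ := Pushout.ses_inl (b := α) hφs
    obtain ⟨p', hp'⟩ := Pushout.ses_inr (a := (LinearMap.ker φ).subtype) hαc
    have hX : TildeFiltered R A Δ Set.univ (Pushout (LinearMap.ker φ).subtype α) :=
      (hQ.mono (Set.subset_univ _)).extension hp' hX₁
    refine ⟨⟨_, inferInstance, inferInstance, inferInstance, inferInstance, Y, inferInstance,
      inferInstance, inferInstance, inferInstance, _, _, hp, hX, hY⟩, ?_⟩
    -- push out `M` along an embedding of the resulting module of `F(Δ̃)` into a tilting module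
    obtain ⟨C, _, _, _, _, X₂, _, _, _, _, j, q, hjq, hC, hX₂⟩ :=
      hT.exists_embedding hN hT₀ hX
    obtain ⟨q', hq', -⟩ := Pushout.ses_inl (b := p) hjq
    have hY' := Pushout.ses_inr' hp hjq.inj
    exact ⟨_, inferInstance, inferInstance, inferInstance, inferInstance, X₂, inferInstance,
      inferInstance, inferInstance, inferInstance, _, _, hq', hX₂.mono (Set.subset_univ _),
      hT.filtered_of_ses hN hΔ isLowerSet_univ hY' hY hC.costandard (hq'.fp₂ hM (hfp hX₂))⟩

end Approximation

/-! ### Characterizations by Ext -/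

section Characterizations

variable {R : Type u} [CommRing R] {A : Type u} [Ring A] [Algebra R A] {Λ : Type w}
  [PartialOrder Λ] [Finite Λ]
  {Δ : Λ → Type u} [∀ l, AddCommGroup (Δ l)] [∀ l, Module R (Δ l)]
  [∀ l, Module A (Δ l)] [∀ l, IsScalarTower R A (Δ l)]
  {N : Λ → Type u} [∀ l, AddCommGroup (N l)] [∀ l, Module R (N l)]
  [∀ l, Module A (N l)] [∀ l, IsScalarTower R A (N l)]
  {T : Λ → Type u} [∀ l, AddCommGroup (T l)] [∀ l, Module R (T l)]
  [∀ l, Module A (T l)] [∀ l, IsScalarTower R A (T l)]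
  {T₀ : Type u} [AddCommGroup T₀] [Module A T₀]
  {S : Set Λ}
  {M L : Type u} [AddCommGroup M] [Module R M] [Module A M] [IsScalarTower R A M]
  [AddCommGroup L] [Module A L]

/-- `F(Δ̃)` consists of the modules `M` with `Ext^1(M, N l) = 0` for all `l`. -/
theorem IsTiltingFamily.standard_filtered_of_ext (hT : IsTiltingFamily R A Δ N T)
    (hN : IsCostandard R A Δ N) (hΔ : IsSplitQuasiHereditary R A Δ)
    (hT₀ : ∀ l, InAdd A T₀ (T l)) (hM : FP R M) (h : ∀ l, ExtVanishes A M (N l) 1) :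
    TildeFiltered R A Δ Set.univ M := by
  obtain ⟨⟨X, _, _, _, _, Y, _, _, _, _, f, g, hfg, hX, hY⟩, -⟩ :=
    hT.exists_approximations hN hΔ hT₀ hM
  obtain ⟨s, hs⟩ := hfg.exists_lift (hY.extVanishes_right fun l _ => h l) LinearMap.id
  exact hΔ.filtered_of_retract isLowerSet_univ hX s g hs

/-- A module in `F(Δ̃)` that is `Ext`-orthogonal to the standard modules belongs to `F(Ñ)`: it is a
direct summand of a tilting module, and so is the complement, whose weights are smaller. -/
lemma IsTiltingFamily.costandard_of_standard (hT : IsTiltingFamily R A Δ N T)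
    (hN : IsCostandard R A Δ N) (hΔ : IsSplitQuasiHereditary R A Δ)
    (hT₀ : ∀ l, InAdd A T₀ (T l)) (hS : IsLowerSet S) (hM : TildeFiltered R A Δ S M)
    (h : ∀ l i, 0 < i → ExtVanishes A (Δ l) M i) : TildeFiltered R A N Set.univ M := by
  refine hS.induction_below (p := fun S => ∀ (M : Type u) [AddCommGroup M] [Module R M] [Module A M]
    [IsScalarTower R A M], TildeFiltered R A Δ S M → (∀ l i, 0 < i → ExtVanishes A (Δ l) M i) →
    TildeFiltered R A N Set.univ M) ?_ ?_ M hM h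
  · intro M _ _ _ _ hM _
    have := hM.subsingleton
    exact .of_subsingleton
  · intro S hS ih M _ _ _ _ hM h
    obtain ⟨C, _, _, _, _, X₁, _, _, _, _, j, c, hjc, hC, hX₁⟩ := hT.exists_embedding hN hT₀ hM
    have h₁ : ∀ l i, 0 < i → ExtVanishes A (Δ l) X₁ i := fun l i hi =>
      hjc.extVanishes_right₃ (h l _ i.succ_pos)
        (hC.costandard.extVanishes_right fun m _ => hN.ext_eq_zero l m i hi)
    obtain ⟨s, hs⟩ := hjc.exists_lift (hX₁.extVanishes_left fun l _ => h l 1 one_pos) LinearMap.id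
    obtain ⟨r, hr, -⟩ := hjc.flip hs
    exact hT.filtered_of_ses hN hΔ isLowerSet_univ hr (ih X₁ hX₁ h₁) hC.costandard
      (hM.fp fun l _ => hΔ.fp_standard l)

/-- `F(Ñ)` consists of the modules `M` with `Ext^i(Δ l, M) = 0` for all `l` and all `i > 0`. -/
theorem IsTiltingFamily.costandard_filtered_of_ext (hT : IsTiltingFamily R A Δ N T)
    (hN : IsCostandard R A Δ N) (hΔ : IsSplitQuasiHereditary R A Δ)
    (hT₀ : ∀ l, InAdd A T₀ (T l)) (hM : FP R M) (h : ∀ l i, 0 < i → ExtVanishes A (Δ l) M i) :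
    TildeFiltered R A N Set.univ M := by
  obtain ⟨-, Y, _, _, _, _, X, _, _, _, _, f, g, hfg, hX, hY⟩ :=
    hT.exists_approximations hN hΔ hT₀ hM
  obtain ⟨s, hs⟩ := hfg.exists_lift (hX.extVanishes_left fun l _ => h l 1 one_pos) LinearMap.id
  obtain ⟨r, hr, -⟩ := hfg.flip hs
  refine hT.filtered_of_ses hN hΔ isLowerSet_univ hr
    (hT.costandard_of_standard hN hΔ hT₀ isLowerSet_univ hX fun l i hi => ?_) hY hM
  exact ExtVanishes.of_retract_right
    (hY.extVanishes_right fun m _ => hN.ext_eq_zero l m i hi) s g hs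

lemma InAdd.extVanishes_right {C : Type u} [AddCommGroup C] [Module A C] (hC : InAdd A T₀ C)
    {i : ℕ} (h : ExtVanishes A L T₀ i) : ExtVanishes A L C i := by
  obtain ⟨n, j, p, hp⟩ := hC
  exact ExtVanishes.of_retract_right h.pi_right j p hp

lemma InAdd.extVanishes_left {C : Type u} [AddCommGroup C] [Module A C] (hC : InAdd A T₀ C)
    {i : ℕ} (h : ExtVanishes A T₀ L i) : ExtVanishes A C L i := by
  obtain ⟨n, j, p, hp⟩ := hC
  exact ExtVanishes.of_retract_left h.pi_left j p hp

/-- If `L` is `Ext`-orthogonal to `T₀`, it is so to all of `F(Ñ)`, whose modules have finite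
resolutions by `add T₀`. -/
lemma IsTiltingFamily.ext_costandard_vanishes (hT : IsTiltingFamily R A Δ N T)
    (hN : IsCostandard R A Δ N) (hT₀ : ∀ l, InAdd A T₀ (T l)) (hS : IsLowerSet S)
    (hM : TildeFiltered R A N S M) (h : ∀ i, 0 < i → ExtVanishes A L T₀ i) {i : ℕ} (hi : 0 < i) :
    ExtVanishes A L M i := by
  refine hS.induction_below (p := fun S => ∀ (M : Type u) [AddCommGroup M] [Module R M] [Module A M]
    [IsScalarTower R A M], TildeFiltered R A N S M → ∀ i, 0 < i → ExtVanishes A L M i) ?_ ?_ M hM i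
    hi
  · intro M _ _ _ _ hM i _
    have := hM.subsingleton
    exact extVanishes_of_subsingleton_right _ _ _
  · intro S hS ih M _ _ _ _ hM i hi
    obtain ⟨C, _, _, _, _, Y₁, _, _, _, _, k, t, hkt, hC, hY₁⟩ :=
      hT.exists_tilting_cover hN hT₀ hM
    exact hkt.extVanishes_right₃ (ih Y₁ hY₁ _ i.succ_pos) (hC.inAdd.extVanishes_right (h i hi))

/-- If `L` is `Ext`-orthogonal to `T₀`, it is so to all of `F(Δ̃)`, whose modules have finite
coresolutions by `add T₀`. -/
lemma IsTiltingFamily.ext_standard_vanishes (hT : IsTiltingFamily R A Δ N T)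
    (hN : IsCostandard R A Δ N) (hT₀ : ∀ l, InAdd A T₀ (T l)) (hS : IsLowerSet S)
    (hM : TildeFiltered R A Δ S M) (h : ∀ i, 0 < i → ExtVanishes A T₀ L i) {i : ℕ} (hi : 0 < i) :
    ExtVanishes A M L i := by
  refine hS.induction_below (p := fun S => ∀ (M : Type u) [AddCommGroup M] [Module R M] [Module A M]
    [IsScalarTower R A M], TildeFiltered R A Δ S M → ∀ i, 0 < i → ExtVanishes A M L i) ?_ ?_ M hM i
    hi
  · intro M _ _ _ _ hM i _
    have := hM.subsingleton
    exact extVanishes_of_subsingleton_left _ _ _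
  · intro S hS ih M _ _ _ _ hM i hi
    obtain ⟨C, _, _, _, _, X₁, _, _, _, _, j, c, hjc, hC, hX₁⟩ := hT.exists_embedding hN hT₀ hM
    exact hjc.extVanishes_left₁ (hC.inAdd.extVanishes_left (h i hi)) (ih X₁ hX₁ _ i.succ_pos)

end Characterizations

/-! ### Finite resolutions and coresolutions -/

section Resolutions

variable {A : Type u} [Ring A] {T : Type u} [AddCommGroup T] [Module A T]

/-- The sequence of modules `C, D 0, D 1, …`. -/
def consSeq (C : ModuleCat.{u} A) (D : ℕ → ModuleCat.{u} A) : ℕ → ModuleCat.{u} A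
  | 0 => C
  | i + 1 => D i

lemma HasFiniteAddCoresolution.of_subsingleton {M : Type u} [AddCommGroup M] [Module A M]
    [Subsingleton M] : HasFiniteAddCoresolution A T M := by
  refine ⟨0, fun _ => ModuleCat.of A PUnit, fun _ => 0, 0, fun _ _ => ?_, fun _ _ => ?_, ?_, ?_, ?_⟩
  · exact InAdd.of_subsingleton (X := PUnit)
  · exact inferInstanceAs (Subsingleton PUnit)
  · exact fun _ _ _ => Subsingleton.elim _ _
  · exact fun _ => ⟨fun _ => ⟨0, rfl⟩, fun _ => rfl⟩
  · exact fun _ _ => ⟨fun _ => ⟨0, rfl⟩, fun _ => rfl⟩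

lemma HasFiniteAddCoresolution.cons {M C M₁ : Type u} [AddCommGroup M] [Module A M]
    [AddCommGroup C] [Module A C] [AddCommGroup M₁] [Module A M₁] {f : M →ₗ[A] C} {g : C →ₗ[A] M₁}
    (h : SES f g) (hC : InAdd A T C) (hM₁ : HasFiniteAddCoresolution A T M₁) :
    HasFiniteAddCoresolution A T M := by
  obtain ⟨t, D, d, ε, hD, hD', hε, h0, hd⟩ := hM₁
  have h₀ : Function.Exact f (ε ∘ₗ g) := fun x => (map_eq_zero_iff ε hε).trans (h.exact x)
  have h₁ : Function.Exact (ε ∘ₗ g) (d 0) := fun x => (h0 x).trans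
    ⟨fun ⟨y, hy⟩ => (h.surj y).imp fun z hz => (congrArg ε hz).trans hy, fun ⟨y, hy⟩ => ⟨g y, hy⟩⟩
  let d' : ∀ i, consSeq (.of A C) D i →ₗ[A] consSeq (.of A C) D (i + 1) := fun i => match i with
    | 0 => (ε ∘ₗ g : C →ₗ[A] D 0)
    | i + 1 => d i
  refine ⟨t + 1, consSeq (.of A C) D, d', f, ?_, ?_, h.inj, ?_, ?_⟩
  · rintro (_ | i) hi
    · exact hC
    · exact hD i (by omega)
  · rintro (_ | i) hi
    · omega
    · exact hD' i (by omega)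
  · exact h₀
  · rintro (_ | i)
    · exact h₁
    · exact hd i

/-- Induction along a finite coresolution. -/
lemma HasFiniteAddCoresolution.induction
    {motive : ∀ (M : Type u) [AddCommGroup M] [Module A M], Prop}
    (zero : ∀ (M : Type u) [AddCommGroup M] [Module A M] [Subsingleton M], motive M)
    (cons : ∀ (M C M₁ : Type u) [AddCommGroup M] [Module A M] [AddCommGroup C] [Module A C]
      [AddCommGroup M₁] [Module A M₁] (f : M →ₗ[A] C) (g : C →ₗ[A] M₁), SES f g → InAdd A T C →
      motive M₁ → motive M)
    {M : Type u} [AddCommGroup M] [Module A M] (h : HasFiniteAddCoresolution A T M) :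
    motive M := by
  obtain ⟨t, D, d, ε, hD, hD', hε, h0, hd⟩ := h
  have key : ∀ (n : ℕ) (M : Type u) [AddCommGroup M] [Module A M] (D : ℕ → ModuleCat.{u} A)
      (d : ∀ i, D i →ₗ[A] D (i + 1)) (ε : M →ₗ[A] D 0), (∀ i, i < n → InAdd A T (D i)) →
      (∀ i, n ≤ i → Subsingleton (D i)) → Function.Injective ε → Function.Exact ε (d 0) →
      (∀ i, Function.Exact (d i) (d (i + 1))) → motive M := by
    intro n
    induction n with
    | zero =>
      intro M _ _ D d ε _ hD' hε _ _
      have := hD' 0 le_rfl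
      have := hε.subsingleton
      exact zero M
    | succ n ih =>
      intro M _ _ D d ε hD hD' hε h0 hd
      have hker : LinearMap.range ε = LinearMap.ker (d 0) := (LinearMap.exact_iff.1 h0).symm
      refine cons M (D 0) (D 0 ⧸ LinearMap.range ε) ε _ (.of_range hε) (hD 0 n.succ_pos) ?_
      refine ih _ (fun i => D (i + 1)) (fun i => d (i + 1))
        ((LinearMap.range ε).liftQ (d 0) hker.le) (fun i hi => hD _ (by omega))
        (fun i hi => hD' _ (by omega)) ?_ ?_ fun i => hd (i + 1)
      · rw [← LinearMap.ker_eq_bot]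
        exact Submodule.ker_liftQ_eq_bot _ _ _ hker.ge
      · intro x
        rw [hd 0 x]
        constructor
        · rintro ⟨y, rfl⟩
          exact ⟨Submodule.Quotient.mk y, rfl⟩
        · rintro ⟨y, rfl⟩
          obtain ⟨y, rfl⟩ := Submodule.Quotient.mk_surjective _ y
          exact ⟨y, rfl⟩
  exact key (t + 1) M D d ε (fun i hi => hD i (by omega)) (fun i hi => hD' i (by omega)) hε h0 hd

lemma HasFiniteAddResolution.of_subsingleton {M : Type u} [AddCommGroup M] [Module A M]
    [Subsingleton M] : HasFiniteAddResolution A T M := by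
  refine ⟨0, fun _ => ModuleCat.of A PUnit, fun _ => 0, 0, fun _ _ => ?_, fun _ _ => ?_, ?_, ?_, ?_⟩
  · exact InAdd.of_subsingleton (X := PUnit)
  · exact inferInstanceAs (Subsingleton PUnit)
  · exact fun _ => ⟨0, Subsingleton.elim _ _⟩
  · exact fun _ => ⟨fun _ => ⟨0, rfl⟩, fun _ => Subsingleton.elim _ _⟩
  · exact fun _ _ => ⟨fun _ => ⟨0, rfl⟩, fun _ => rfl⟩

lemma HasFiniteAddResolution.cons {M C M₁ : Type u} [AddCommGroup M] [Module A M]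
    [AddCommGroup C] [Module A C] [AddCommGroup M₁] [Module A M₁] {f : M₁ →ₗ[A] C} {g : C →ₗ[A] M}
    (h : SES f g) (hC : InAdd A T C) (hM₁ : HasFiniteAddResolution A T M₁) :
    HasFiniteAddResolution A T M := by
  obtain ⟨t, D, d, ε, hD, hD', hε, h0, hd⟩ := hM₁
  have h₀ : Function.Exact (f ∘ₗ ε) g := fun x => (h.exact x).trans
    ⟨fun ⟨y, hy⟩ => (hε y).imp fun z hz => (congrArg f hz).trans hy, fun ⟨y, hy⟩ => ⟨ε y, hy⟩⟩
  have h₁ : Function.Exact (d 0) (f ∘ₗ ε) := fun x => (map_eq_zero_iff f h.inj).trans (h0 x)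
  let d' : ∀ i, consSeq (.of A C) D (i + 1) →ₗ[A] consSeq (.of A C) D i := fun i => match i with
    | 0 => (f ∘ₗ ε : D 0 →ₗ[A] C)
    | i + 1 => d i
  refine ⟨t + 1, consSeq (.of A C) D, d', g, ?_, ?_, h.surj, ?_, ?_⟩
  · rintro (_ | i) hi
    · exact hC
    · exact hD i (by omega)
  · rintro (_ | i) hi
    · omega
    · exact hD' i (by omega)
  · exact h₀
  · rintro (_ | i)
    · exact h₁
    · exact hd i

/-- Induction along a finite resolution. -/
lemma HasFiniteAddResolution.induction
    {motive : ∀ (M : Type u) [AddCommGroup M] [Module A M], Prop}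
    (zero : ∀ (M : Type u) [AddCommGroup M] [Module A M] [Subsingleton M], motive M)
    (cons : ∀ (M C M₁ : Type u) [AddCommGroup M] [Module A M] [AddCommGroup C] [Module A C]
      [AddCommGroup M₁] [Module A M₁] (f : M₁ →ₗ[A] C) (g : C →ₗ[A] M), SES f g → InAdd A T C →
      motive M₁ → motive M)
    {M : Type u} [AddCommGroup M] [Module A M] (h : HasFiniteAddResolution A T M) :
    motive M := by
  obtain ⟨t, D, d, ε, hD, hD', hε, h0, hd⟩ := h
  have key : ∀ (n : ℕ) (M : Type u) [AddCommGroup M] [Module A M] (D : ℕ → ModuleCat.{u} A)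
      (d : ∀ i, D (i + 1) →ₗ[A] D i) (ε : D 0 →ₗ[A] M), (∀ i, i < n → InAdd A T (D i)) →
      (∀ i, n ≤ i → Subsingleton (D i)) → Function.Surjective ε → Function.Exact (d 0) ε →
      (∀ i, Function.Exact (d (i + 1)) (d i)) → motive M := by
    intro n
    induction n with
    | zero =>
      intro M _ _ D d ε _ hD' hε _ _
      have := hD' 0 le_rfl
      have := hε.subsingleton
      exact zero M
    | succ n ih =>
      intro M _ _ D d ε hD hD' hε h0 hd
      refine cons M (D 0) (LinearMap.ker ε) _ ε (.of_ker hε) (hD 0 n.succ_pos) ?_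
      refine ih _ (fun i => D (i + 1)) (fun i => d (i + 1))
        ((d 0).codRestrict _ fun x => h0.apply_apply_eq_zero x) (fun i hi => hD _ (by omega))
        (fun i hi => hD' _ (by omega)) ?_ ?_ fun i => hd (i + 1)
      · rintro ⟨x, hx⟩
        obtain ⟨y, rfl⟩ := (h0 x).1 hx
        exact ⟨y, rfl⟩
      · intro x
        rw [← hd 0 x]
        exact Subtype.ext_iff
  exact key (t + 1) M D d ε (fun i hi => hD i (by omega)) (fun i hi => hD' i (by omega)) hε h0 hd

end Resolutions

/-! ### Characteristic tilting modules -/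

section CharacteristicTilting

variable {R : Type u} [CommRing R] {A : Type u} [Ring A] [Algebra R A] {Λ : Type w}
  [PartialOrder Λ] [Finite Λ]
  {Δ : Λ → Type u} [∀ l, AddCommGroup (Δ l)] [∀ l, Module R (Δ l)]
  [∀ l, Module A (Δ l)] [∀ l, IsScalarTower R A (Δ l)]
  {N : Λ → Type u} [∀ l, AddCommGroup (N l)] [∀ l, Module R (N l)]
  [∀ l, Module A (N l)] [∀ l, IsScalarTower R A (N l)]
  {T : Λ → Type u} [∀ l, AddCommGroup (T l)] [∀ l, Module R (T l)]
  [∀ l, Module A (T l)] [∀ l, IsScalarTower R A (T l)]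
  {T₀ : Type u} [AddCommGroup T₀] [Module R T₀] [Module A T₀] [IsScalarTower R A T₀]
  {M : Type u} [AddCommGroup M] [Module R M] [Module A M] [IsScalarTower R A M]

/-- The summands of a characteristic tilting module, with the `R`-module structures induced by
`R → A`, form a tilting family. -/
lemma IsCharacteristicTilting.exists_family {T₀ : Type u} [AddCommGroup T₀] [Module A T₀]
    (h : IsCharacteristicTilting R A Δ N T₀) :
    ∃ (T : Λ → Type u) (_ : ∀ l, AddCommGroup (T l)) (_ : ∀ l, Module R (T l))
      (_ : ∀ l, Module A (T l)) (_ : ∀ l, IsScalarTower R A (T l)),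
      IsTiltingFamily R A Δ N T ∧ (∀ l, InAdd A T₀ (T l)) ∧
      TildeFiltered R A Δ Set.univ T₀ ∧ TildeFiltered R A N Set.univ T₀ := by
  obtain ⟨T, ⟨e⟩, h⟩ := h
  let _ : ∀ l, Module R (T l) := fun l => Module.compHom (T l) (algebraMap R A)
  have _ : ∀ l, IsScalarTower R A (T l) := fun l => .of_compHom R A _
  obtain ⟨n, f, ⟨e'⟩⟩ := exists_directSum_equiv_pi (A := A) fun l => T l
  refine ⟨fun l => T l, inferInstance, inferInstance, inferInstance, inferInstance,
    ⟨fun l => (h l).1, fun l => (h l).2.1, fun l => (h l).2.2.1, fun l => (h l).2.2.2⟩,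
    fun l => ?_, ?_, ?_⟩
  · classical
    have h₁ : InAdd A T₀ T₀ := ⟨1, LinearMap.pi fun _ => LinearMap.id, LinearMap.proj 0, rfl⟩
    refine h₁.of_retract (e.symm.toLinearMap ∘ₗ DirectSum.lof A Λ (fun l => T l) l)
      (DirectSum.component A Λ (fun l => T l) l ∘ₗ e.toLinearMap) (LinearMap.ext fun x => ?_)
    simp [DirectSum.component.lof_self]
  · exact (TildeFiltered.pi (fun k => T (f k)) fun k => (h (f k)).1).of_linearEquiv
      (e ≪≫ₗ e').symm
  · exact (TildeFiltered.pi (fun k => T (f k)) fun k => (h (f k)).2.1).of_linearEquiv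
      (e ≪≫ₗ e').symm

/-- `F(Δ̃)` is the left `Ext`-orthogonal of the tilting module among the modules that are finitely
generated projective over `R`. -/
lemma IsTiltingFamily.standard_iff_ext (hT : IsTiltingFamily R A Δ N T)
    (hN : IsCostandard R A Δ N) (hΔ : IsSplitQuasiHereditary R A Δ)
    (hT₀ : ∀ l, InAdd A T₀ (T l)) (hTN : TildeFiltered R A N Set.univ T₀) :
    TildeFiltered R A Δ Set.univ M ↔ FP R M ∧ ∀ i, 0 < i → ExtVanishes A M T₀ i :=
  ⟨fun hM => ⟨hM.fp fun l _ => hΔ.fp_standard l, fun _ hi => hN.ext_filtered_vanishes hM hTN hi⟩,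
    fun hM => hT.standard_filtered_of_ext hN hΔ hT₀ hM.1 fun l =>
      hT.ext_costandard_vanishes hN hT₀ isLowerSet_univ (.standard (Set.mem_univ l)) hM.2 one_pos⟩

/-- `F(Ñ)` is the right `Ext`-orthogonal of the tilting module among the modules that are finitely
generated projective over `R`. -/
lemma IsTiltingFamily.costandard_iff_ext (hT : IsTiltingFamily R A Δ N T)
    (hN : IsCostandard R A Δ N) (hΔ : IsSplitQuasiHereditary R A Δ)
    (hT₀ : ∀ l, InAdd A T₀ (T l)) (hTΔ : TildeFiltered R A Δ Set.univ T₀) :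
    TildeFiltered R A N Set.univ M ↔ FP R M ∧ ∀ i, 0 < i → ExtVanishes A T₀ M i :=
  ⟨fun hM => ⟨hM.fp fun l _ => hN.fp_costandard hΔ l,
      fun _ hi => hN.ext_filtered_vanishes hTΔ hM hi⟩,
    fun hM => hT.costandard_filtered_of_ext hN hΔ hT₀ hM.1 fun l _ hi =>
      hT.ext_standard_vanishes hN hT₀ isLowerSet_univ (.standard (Set.mem_univ l)) hM.2 hi⟩

omit [Module R T₀] [IsScalarTower R A T₀] in
/-- `F(Ñ)` is the right `Ext`-orthogonal of the standard modules; this description does not involve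
the costandard modules. -/
lemma IsTiltingFamily.costandard_iff_ext_standard (hT : IsTiltingFamily R A Δ N T)
    (hN : IsCostandard R A Δ N) (hΔ : IsSplitQuasiHereditary R A Δ)
    (hT₀ : ∀ l, InAdd A T₀ (T l)) :
    TildeFiltered R A N Set.univ M ↔ FP R M ∧ ∀ l i, 0 < i → ExtVanishes A (Δ l) M i :=
  ⟨fun hM => ⟨hM.fp fun l _ => hN.fp_costandard hΔ l,
      fun l _ hi => hM.extVanishes_right fun m _ => hN.ext_eq_zero l m _ hi⟩,
    fun hM => hT.costandard_filtered_of_ext hN hΔ hT₀ hM.1 hM.2⟩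

lemma IsTiltingFamily.inAdd_iff (hT : IsTiltingFamily R A Δ N T)
    (hN : IsCostandard R A Δ N) (hΔ : IsSplitQuasiHereditary R A Δ)
    (hT₀ : ∀ l, InAdd A T₀ (T l)) (hTΔ : TildeFiltered R A Δ Set.univ T₀)
    (hTN : TildeFiltered R A N Set.univ T₀) :
    InAdd A T₀ M ↔ TildeFiltered R A Δ Set.univ M ∧ TildeFiltered R A N Set.univ M := by
  constructor
  · intro h
    have hMΔ : TildeFiltered R A Δ Set.univ M := by
      obtain ⟨n, i, p, hp⟩ := h
      exact hΔ.filtered_of_retract isLowerSet_univ (.pi (fun _ => T₀) fun _ => hTΔ) i p hp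
    exact ⟨hMΔ, (hT.costandard_iff_ext hN hΔ hT₀ hTΔ).2 ⟨hMΔ.fp fun l _ => hΔ.fp_standard l,
      fun i hi => h.extVanishes_right (hN.ext_filtered_vanishes hTΔ hTN hi)⟩⟩
  · rintro ⟨hMΔ, hMN⟩
    obtain ⟨C, _, _, _, _, X₁, _, _, _, _, j, c, hjc, hC, hX₁⟩ := hT.exists_embedding hN hT₀ hMΔ
    -- the embedding splits, since `Ext^1(X₁, M) = 0`
    obtain ⟨r, hr⟩ := hjc.exists_extend (hN.ext_filtered_vanishes hX₁ hMN one_pos) LinearMap.id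
    exact hC.inAdd.of_retract j r hr

lemma IsTiltingFamily.standard_iff_coresolution (hT : IsTiltingFamily R A Δ N T)
    (hN : IsCostandard R A Δ N) (hΔ : IsSplitQuasiHereditary R A Δ)
    (hT₀ : ∀ l, InAdd A T₀ (T l)) (hTΔ : TildeFiltered R A Δ Set.univ T₀)
    (hTN : TildeFiltered R A N Set.univ T₀) :
    TildeFiltered R A Δ Set.univ M ↔ HasFiniteAddCoresolution A T₀ M := by
  constructor
  · intro hM
    refine isLowerSet_univ.induction_below (p := fun S => ∀ (M : Type u) [AddCommGroup M]
      [Module R M] [Module A M] [IsScalarTower R A M], TildeFiltered R A Δ S M →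
      HasFiniteAddCoresolution A T₀ M) ?_ ?_ M hM
    · intro M _ _ _ _ hM
      have := hM.subsingleton
      exact .of_subsingleton
    · intro S hS ih M _ _ _ _ hM
      obtain ⟨C, _, _, _, _, X₁, _, _, _, _, j, c, hjc, hC, hX₁⟩ := hT.exists_embedding hN hT₀ hM
      exact .cons hjc hC.inAdd (ih X₁ hX₁)
  · intro h
    refine h.induction (motive := fun M _ _ => TildeFiltered R A Δ Set.univ M) ?_ ?_
    · intro M _ _ _
      exact .of_subsingleton
    · intro M C M₁ _ _ _ _ _ _ f g hfg hC hM₁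
      let _ : Module R M := Module.compHom M (algebraMap R A)
      let _ : Module R C := Module.compHom C (algebraMap R A)
      let _ : Module R M₁ := Module.compHom M₁ (algebraMap R A)
      have _ : IsScalarTower R A M := .of_compHom R A _
      have _ : IsScalarTower R A C := .of_compHom R A _
      have _ : IsScalarTower R A M₁ := .of_compHom R A _
      obtain ⟨hCΔ, hCN⟩ := (hT.inAdd_iff hN hΔ hT₀ hTΔ hTN).1 hC
      exact hT.standard_filtered_of_ext hN hΔ hT₀
        ((hfg.restrictScalars R).fp₁ (hCΔ.fp fun l _ => hΔ.fp_standard l)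
          (hM₁.fp fun l _ => hΔ.fp_standard l)) fun l =>
        hfg.extVanishes_left₁ (hCΔ.extVanishes_left fun m _ => hN.ext_eq_zero m l 1 one_pos)
          (hM₁.extVanishes_left fun m _ => hN.ext_eq_zero m l 2 two_pos)

lemma IsTiltingFamily.costandard_iff_resolution (hT : IsTiltingFamily R A Δ N T)
    (hN : IsCostandard R A Δ N) (hΔ : IsSplitQuasiHereditary R A Δ)
    (hT₀ : ∀ l, InAdd A T₀ (T l)) (hTN : TildeFiltered R A N Set.univ T₀) :
    TildeFiltered R A N Set.univ M ↔ HasFiniteAddResolution A T₀ M ∧ FP R M := by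
  constructor
  · intro hM
    refine ⟨?_, hM.fp fun l _ => hN.fp_costandard hΔ l⟩
    refine isLowerSet_univ.induction_below (p := fun S => ∀ (M : Type u) [AddCommGroup M]
      [Module R M] [Module A M] [IsScalarTower R A M], TildeFiltered R A N S M →
      HasFiniteAddResolution A T₀ M) ?_ ?_ M hM
    · intro M _ _ _ _ hM
      have := hM.subsingleton
      exact .of_subsingleton
    · intro S hS ih M _ _ _ _ hM
      obtain ⟨C, _, _, _, _, Y₁, _, _, _, _, k, t, hkt, hC, hY₁⟩ :=
        hT.exists_tilting_cover hN hT₀ hM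
      exact .cons hkt hC.inAdd (ih Y₁ hY₁)
  · rintro ⟨h, hM⟩
    refine hT.costandard_filtered_of_ext hN hΔ hT₀ hM ?_
    refine h.induction (motive := fun M _ _ => ∀ l i, 0 < i → ExtVanishes A (Δ l) M i) ?_ ?_
    · intro M _ _ _ l i _
      exact extVanishes_of_subsingleton_right _ _ _
    · intro M C M₁ _ _ _ _ _ _ f g hfg hC hM₁ l i hi
      exact hfg.extVanishes_right₃ (hM₁ l _ i.succ_pos) (hC.extVanishes_right
        (hTN.extVanishes_right fun m _ => hN.ext_eq_zero l m i hi))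

end CharacteristicTilting

theorem mainTheorem5
    (R : Type u) [CommRing R] [IsNoetherianRing R]
    (A : Type u) [Ring A] [Algebra R A]
    (Λ : Type w) [PartialOrder Λ] [Finite Λ]
    -- the standard modules
    (Δ : Λ → Type u) [∀ l, AddCommGroup (Δ l)] [∀ l, Module R (Δ l)]
    [∀ l, Module A (Δ l)] [∀ l, IsScalarTower R A (Δ l)]
    (hΔ : IsSplitQuasiHereditary R A Δ)
    -- the costandard modules
    (N : Λ → Type u) [∀ l, AddCommGroup (N l)] [∀ l, Module R (N l)]
    [∀ l, Module A (N l)] [∀ l, IsScalarTower R A (N l)]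
    (hN : IsCostandard R A Δ N)
    (T : Type u) [AddCommGroup T] [Module A T]
    (hT : IsCharacteristicTilting R A Δ N T) :
    (∀ (M : Type u) [AddCommGroup M] [Module R M] [Module A M] [IsScalarTower R A M]
      [Module.Finite A M],
      (TildeFiltered R A Δ Set.univ M ↔
        Module.Projective R M ∧ ∀ i, 0 < i → ExtVanishes A M T i) ∧
      (TildeFiltered R A Δ Set.univ M ↔ HasFiniteAddCoresolution A T M) ∧
      (TildeFiltered R A N Set.univ M ↔
        Module.Projective R M ∧ ∀ i, 0 < i → ExtVanishes A T M i) ∧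
      (TildeFiltered R A N Set.univ M ↔
        HasFiniteAddResolution A T M ∧ Module.Projective R M) ∧
      (InAdd A T M ↔
        TildeFiltered R A Δ Set.univ M ∧ TildeFiltered R A N Set.univ M)) ∧
    -- any two characteristic tilting modules have the same additive closure
    (∀ (N' : Λ → Type u) [∀ l, AddCommGroup (N' l)] [∀ l, Module R (N' l)]
      [∀ l, Module A (N' l)] [∀ l, IsScalarTower R A (N' l)],
      IsCostandard R A Δ N' →
      ∀ (T' : Type u) [AddCommGroup T'] [Module A T'],
        IsCharacteristicTilting R A Δ N' T' →
        ∀ (M : Type u) [AddCommGroup M] [Module A M], InAdd A T M ↔ InAdd A T' M) := by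
  obtain ⟨t, _, _, _, _, ht, htT, hTΔ, hTN⟩ := hT.exists_family
  let _ : Module R T := Module.compHom T (algebraMap R A)
  have _ : IsScalarTower R A T := .of_compHom R A _
  refine ⟨fun M _ _ _ _ _ => ?_, fun N' _ _ _ _ hN' T' _ _ hT' M _ _ => ?_⟩
  · have := hΔ.finite_algebra
    have hfp : Module.Projective R M ↔ FP R M :=
      ⟨fun h => ⟨Module.Finite.trans A M, h⟩, fun h => h.2⟩
    rw [hfp]
    exact ⟨ht.standard_iff_ext hN hΔ htT hTN, ht.standard_iff_coresolution hN hΔ htT hTΔ hTN,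
      ht.costandard_iff_ext hN hΔ htT hTΔ, ht.costandard_iff_resolution hN hΔ htT hTN,
      ht.inAdd_iff hN hΔ htT hTΔ hTN⟩
  · obtain ⟨t', _, _, _, _, ht', htT', hTΔ', hTN'⟩ := hT'.exists_family
    let _ : Module R T' := Module.compHom T' (algebraMap R A)
    have _ : IsScalarTower R A T' := .of_compHom R A _
    let _ : Module R M := Module.compHom M (algebraMap R A)
    have _ : IsScalarTower R A M := .of_compHom R A _
    rw [ht.inAdd_iff hN hΔ htT hTΔ hTN, ht'.inAdd_iff hN' hΔ htT' hTΔ' hTN',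
      ht.costandard_iff_ext_standard hN hΔ htT, ht'.costandard_iff_ext_standard hN' hΔ htT']
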